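/- Let $\mathbb F_4$ be the field with four elements and let $\Lambda\subset\mathbb F_4$ be a fixed set of three colours; $\log$ is to base $2$. A CSP (of arity two) consists of a finite set $V$ of variables, a finite family $E$ of constraints and an alphabet $\Sigma$; each constraint $e\in E$ joins two distinct variables $u_e,v_e\in V$ (several constraints may join the same pair) and has a check $\Pi_e\colon\Sigma\times\Sigma\to\{0,1\}$. An assignment $\sigma\colon V\to\Sigma$ is a solution if $\frac1{|E|}\sum_{e\in E}\Pi_e(\sigma(u_e),\sigma(v_e))=1$, and the CSP is satisfiable if it has a solution. It is an instance of 4-Regular 3-Coloring if $\Sigma=\mathbb F_4$, every variable lies in exactly four constraints, and every $\Pi_e(a,b)$ checks that $a,b\in\Lambda$ and $a\ne b$. A special vector-valued CSP (SVecCSP) over a finite field $\mathbb F$ of characteristic $2$ is a CSP with variable set $V=\{x_1,\dots,x_K\}\,\dot\cup\,\{y_1,\dots,y_K\}$ ($K\ge1$), alphabet $\Sigma=\mathbb F^t$ and constraint set $E=E_{\mathsf p}\,\dot\cup\,E_{\mathsf l}$ such that * every (parallel) constraint $e\in E_{\mathsf p}$, joining two distinct variables, has a sub-constraint $\Pi_e^{sub}\colon\mathbb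 F\times\mathbb F\to\{0,1\}$ with $\Pi_e(u,v)=\bigwedge_{j=1}^t\Pi_e^{sub}(u_j,v_j)$; * $E_{\mathsf l}$ consists of exactly one (linear) constraint on $\{x_i,y_i\}$ for each $i\in\{1,\dots,K\}$, and it checks $y_i=M_ix_i$ for some matrix $M_i\in\mathbb F^{t\times t}$. **Theorem.** There are an absolute constant $C$ and an algorithm with the following property. Given integers $6\le k\le n$ and an $n$-variable instance $\Gamma$ of 4-Regular 3-Coloring, the algorithm outputs an SVecCSP instance $G$ over $\mathbb F_4$ (its variables, its parallel constraints with their sub-constraints, and its matrices $M_i$) such that 1. $|V|\le Ck$ and $|E|\le Ck$; 2. the algorithm runs in time $\mathrm{poly}\bigl(n,2^{n\log k/k}\bigr)$, namely in at most $\bigl(n^2+(2^{n\log k/k})^2+C\bigr)^C$ steps (on a uniform-cost random access machine with addition and truncated subtraction); 3. the alphabet of $G$ is $\Sigma=\mathbb F_4^t$ with $t\le C\cdot\frac{n\log k}{k}$; 4. $G$ is satisfiable if and only if $\Gamma$ is satisfiable. -/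

import Mathlib

/-! ## Constraint satisfaction problems of arity two -/

/-- A CSP of arity two with variables `V`, constraints `E` and alphabet `A`. The constraint `e`
joins the two distinct variables `fst e` and `snd e`, and several constraints may join the same
pair. -/
structure CSP (V E A : Type*) where
  fst : E → V
  snd : E → V
  fst_ne_snd : ∀ e, fst e ≠ snd e
  rel : E → A → A → Prop

namespace CSP

variable {V E A : Type*}

/-- The fraction of the constraints that the assignment `σ` satisfies. -/
noncomputable def val (G : CSP V E A) (σ : V → A) : ℚ :=
  (Nat.card {e : E // G.rel e (σ (G.fst e)) (σ (G.snd e))} : ℚ) / (Nat.card E : ℚ)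

def IsSolution (G : CSP V E A) (σ : V → A) : Prop := G.val σ = 1

def Satisfiable (G : CSP V E A) : Prop := ∃ σ : V → A, G.IsSolution σ

theorem isSolution_iff [Finite E] [Nonempty E] (G : CSP V E A) (σ : V → A) :
    G.IsSolution σ ↔ ∀ e, G.rel e (σ (G.fst e)) (σ (G.snd e)) := by
  classical
  have := Fintype.ofFinite E
  have hE : (Nat.card E : ℚ) ≠ 0 := Nat.cast_ne_zero.mpr Nat.card_pos.ne'
  unfold IsSolution val
  rw [div_eq_one_iff_eq hE, Nat.cast_inj, Nat.card_eq_fintype_card, Nat.card_eq_fintype_card,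
    Fintype.card_subtype, Finset.card_eq_iff_eq_univ]
  simp [Finset.ext_iff]

/-- Every variable lies in exactly `d` constraints (parallel constraints counted separately). -/
def IsRegular (G : CSP V E A) (d : ℕ) : Prop :=
  ∀ v, Nat.card {e : E // G.fst e = v ∨ G.snd e = v} = d

end CSP

/-- The field with four elements. -/
abbrev F4 : Type := GaloisField 2 2

/-- Instances of 4-Regular 3-Coloring with colour set `Λ ⊆ F4`. -/
def IsFourRegularThreeColoring {V E : Type*} (Λ : Finset F4) (Γ : CSP V E F4) : Prop :=
  Γ.IsRegular 4 ∧ ∀ e a b, Γ.rel e a b ↔ a ∈ Λ ∧ b ∈ Λ ∧ a ≠ b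

/-! ## Special vector-valued CSPs -/

/-- A special vector-valued CSP over the field `F`: the variables are `x_i = inl i` and
`y_i = inr i` for `i < k`, the alphabet is `F ^ t`, there are `p` parallel constraints given by
their sub-constraints, and `k` linear constraints given by their matrices. -/
structure SVecCSP (F : Type*) [Field F] [Finite F] [CharP F 2] where
  k : ℕ
  k_pos : 0 < k
  t : ℕ
  p : ℕ
  src : Fin p → Fin k ⊕ Fin k
  tgt : Fin p → Fin k ⊕ Fin k
  src_ne_tgt : ∀ c, src c ≠ tgt c
  sub : Fin p → F → F → Bool
  mat : Fin k → Matrix (Fin t) (Fin t) F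

namespace SVecCSP

variable {F : Type*} [Field F] [Finite F] [CharP F 2]

abbrev Var (G : SVecCSP F) : Type := Fin G.k ⊕ Fin G.k

/-- The constraints: the parallel ones (`inl`) and the linear ones (`inr`). -/
abbrev Con (G : SVecCSP F) : Type := Fin G.p ⊕ Fin G.k

/-- The underlying CSP. A parallel constraint checks its sub-constraint on all coordinates; the
`i`-th linear constraint joins `x_i` and `y_i` and checks `y_i = M_i x_i`. -/
def toCSP (G : SVecCSP F) : CSP G.Var G.Con (Fin G.t → F) where
  fst := Sum.elim G.src Sum.inl
  snd := Sum.elim G.tgt Sum.inr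
  fst_ne_snd := by
    rintro (c | i)
    · exact G.src_ne_tgt c
    · simp
  rel := Sum.elim (fun c u v => ∀ j, G.sub c (u j) (v j) = true)
    (fun i u v => v = (G.mat i).mulVec u)

end SVecCSP

/-! ## The machine model -/

/-- The memory of a random access machine: registers and arrays, all holding natural numbers. -/
structure Store where
  reg : ℕ → ℕ
  arr : ℕ → ℕ → ℕ

namespace Store

def setReg (s : Store) (x v : ℕ) : Store := ⟨Function.update s.reg x v, s.arr⟩

def setArr (s : Store) (a i v : ℕ) : Store :=
  ⟨s.reg, Function.update s.arr a (Function.update (s.arr a) i v)⟩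

end Store

/-- Programs of a random access machine. A program names finitely many registers `x, y, z` and
arrays `a`; arrays are accessed by indirect addressing. The only arithmetic operations are addition
and truncated subtraction, so (apart from the constants of the program) the largest value at most
doubles in one step, and the uniform-cost measure below is polynomially related to the running time
of Turing machines. -/
inductive Program : Type
  /-- `x := c` -/
  | const (x c : ℕ)
  /-- `x := y + z` -/
  | add (x y z : ℕ)
  /-- `x := y - z`, truncated at zero -/
  | sub (x y z : ℕ)
  /-- `x := a[y]` -/
  | load (x a y : ℕ)
  /-- `a[y] := x` -/
  | store (a y x : ℕ)
  /-- `P; Q` -/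
  | seq (P Q : Program)
  /-- if `x ≠ 0` then `P` else `Q` -/
  | ite (x : ℕ) (P Q : Program)
  /-- while `x ≠ 0` do `P` -/
  | loop (x : ℕ) (P : Program)

/-- `Exec P s T s'`: started in `s`, the program `P` halts in `s'` after exactly `T` steps, where
each elementary instruction and each test costs one step. -/
inductive Exec : Program → Store → ℕ → Store → Prop
  | const (s : Store) (x c : ℕ) : Exec (.const x c) s 1 (s.setReg x c)
  | add (s : Store) (x y z : ℕ) : Exec (.add x y z) s 1 (s.setReg x (s.reg y + s.reg z))
  | sub (s : Store) (x y z : ℕ) : Exec (.sub x y z) s 1 (s.setReg x (s.reg y - s.reg z))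
  | load (s : Store) (x a y : ℕ) : Exec (.load x a y) s 1 (s.setReg x (s.arr a (s.reg y)))
  | store (s : Store) (a y x : ℕ) : Exec (.store a y x) s 1 (s.setArr a (s.reg y) (s.reg x))
  | seq {P Q : Program} {s s' s'' : Store} {T T' : ℕ} :
      Exec P s T s' → Exec Q s' T' s'' → Exec (.seq P Q) s (T + T') s''
  | ite_then {P Q : Program} {s s' : Store} {x T : ℕ} :
      s.reg x ≠ 0 → Exec P s T s' → Exec (.ite x P Q) s (T + 1) s'
  | ite_else {P Q : Program} {s s' : Store} {x T : ℕ} :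
      s.reg x = 0 → Exec Q s T s' → Exec (.ite x P Q) s (T + 1) s'
  | loop_done {P : Program} {s : Store} {x : ℕ} :
      s.reg x = 0 → Exec (.loop x P) s 1 s
  | loop_step {P : Program} {s s' s'' : Store} {x T T' : ℕ} :
      s.reg x ≠ 0 → Exec P s T s' → Exec (.loop x P) s' T' s'' →
      Exec (.loop x P) s (T + T' + 1) s''

/-- The initial memory on input `l`: array `0` holds `l`, register `0` its length, and everything
else is zero. -/
def inputStore (l : List ℕ) : Store where
  reg := fun x => if x = 0 then l.length else 0
  arr := fun a i => if a = 0 then l.getD i 0 else 0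

/-- The memory `s` presents the output `l`: array `1` holds `l` and register `0` its length. -/
def HoldsOutput (s : Store) (l : List ℕ) : Prop :=
  s.reg 0 = l.length ∧ ∀ i (hi : i < l.length), s.arr 1 i = l[i]

/-- On input `l` the program halts with output `l'` after exactly `T` steps. -/
def Program.Computes (P : Program) (l l' : List ℕ) (T : ℕ) : Prop :=
  ∃ s, Exec P (inputStore l) T s ∧ HoldsOutput s l'

/-! ## Encodings of the instances as lists of numbers -/

/-- The input of the reduction: the parameter, the numbers of variables and of constraints, and the
list of constraints (whose checks are the same for all constraints of a colouring instance). -/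
def encodeInput {n m : ℕ} {A : Type*} (k : ℕ) (Γ : CSP (Fin n) (Fin m) A) : List ℕ :=
  [k, n, m] ++ (List.finRange m).flatMap fun e => [(Γ.fst e : ℕ), (Γ.snd e : ℕ)]

namespace SVecCSP

variable {F : Type*} [Field F] [Finite F] [CharP F 2]

/-- `x_i` has number `i`, and `y_i` has number `k + i`. -/
def varCode (G : SVecCSP F) : G.Var → ℕ :=
  Sum.elim (fun i => (i : ℕ)) (fun i => G.k + i)

/-- The encoding of an instance, where the field elements are numbered by `num`: the sizes, then
the endpoints and the truth table of the sub-constraint of each parallel constraint, then the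
entries of the matrices, row by row. -/
def encode {q : ℕ} (num : F ≃ Fin q) (G : SVecCSP F) : List ℕ :=
  [G.k, G.t, G.p]
    ++ ((List.finRange G.p).flatMap fun c =>
        [G.varCode (G.src c), G.varCode (G.tgt c)]
          ++ (List.finRange q).flatMap fun a => (List.finRange q).map fun b =>
              (G.sub c (num.symm a) (num.symm b)).toNat)
    ++ ((List.finRange G.k).flatMap fun i => (List.finRange G.t).flatMap fun r =>
        (List.finRange G.t).map fun s => (num (G.mat i r s) : ℕ))

end SVecCSP

/-! ## A language of expressions and commands compiled to the machine -/

/-! Colours are carried by tokens instead of vertices. Every constraint of the colouring instance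
has two darts, one at each endpoint, and every dart has two tokens. Colouring the graph amounts to
colouring the tokens so that the two tokens of a dart agree, the two darts of a constraint get
different colours of `Λ`, and partners agree under a fixed pairing `ι` that strings the darts at
each vertex into a cycle (`exists_tokenColouring_iff`). With the numbering used here the first two
conditions compare tokens whose numbers differ in the binary digit of weight `1` or `2`; only the
pairing is long-range.

The `N = t * 2 ^ d` tokens are cut into `2 ^ d` blocks of `t = 4 * w` consecutive positions, and a
vector variable holds one block. A butterfly network with levels `0, …, d` carries the tokens
upwards: between levels `ℓ` and `ℓ + 1` a token may cross to the block whose number differs in digit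
`ℓ`, keeping its offset. At the top the partners have met in one block, where a matrix can compare
them. To choose the digits at one level, let `α` exchange the tokens whose positions differ in that
digit. Partners under `α` must get different digits, so that positions stay distinct, and partners
under `ι` equal ones. Such a choice exists because `α` preserves the parity of a token and `ι`
changes it: a closed alternating walk has an even number of `ι`-steps, hence of `α`-steps
(`TwoInvolutions.colouring`, `routing_step`, `Routing.succ`).

Each level and block gets four pairs of variables, whose matrices only select coordinates. Equality
constraints copy blocks, send the staying tokens straight up and the others across; at the top level
the remaining pairs return to level `0` and check darts and constraints
(`routingInstance_satisfiable_iff_tokenColouring`). With `d` maximal such that `(d + 1) * 2 ^ d ≤ k`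
there are `O(k)` variables and constraints, and `t = O(n / 2 ^ d) = O(n log k / k)` (`width_le`).

The construction takes time polynomial in `n` alone. It is written in a small language all of whose
loops are cut off at a bound, here `16 * n`, so that every program runs in time polynomial in the
bound by the way it is composed (`IsExpr`, `IsCmd`, `IsGen`). What remains is that the cut-offs
never take effect and the output is the encoded instance (`Ram.output_prepare`). -/

namespace Ram

/-- The part of the memory that expressions read: scalars and arrays, the input, and the number at
which the lengths of all loops are cut off. -/
structure Env where
  bound : ℕ
  inp : ℕ → ℕ
  var : ℕ → ℕ
  arr : ℕ → ℕ → ℕ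

namespace Env

def set (h : Env) (x n : ℕ) : Env := { h with var := Function.update h.var x n }

def put (h : Env) (a : ℕ) (f : ℕ → ℕ) : Env := { h with arr := Function.update h.arr a f }

@[simp] theorem set_bound (h : Env) (x n : ℕ) : (h.set x n).bound = h.bound := rfl
@[simp] theorem set_inp (h : Env) (x n : ℕ) : (h.set x n).inp = h.inp := rfl
@[simp] theorem set_arr (h : Env) (x n : ℕ) : (h.set x n).arr = h.arr := rfl
@[simp] theorem set_var (h : Env) (x n i : ℕ) :
    (h.set x n).var i = if i = x then n else h.var i := Function.update_apply ..
@[simp] theorem put_bound (h : Env) (a : ℕ) (f : ℕ → ℕ) : (h.put a f).bound = h.bound := rfl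
@[simp] theorem put_inp (h : Env) (a : ℕ) (f : ℕ → ℕ) : (h.put a f).inp = h.inp := rfl
@[simp] theorem put_var (h : Env) (a : ℕ) (f : ℕ → ℕ) : (h.put a f).var = h.var := rfl
@[simp] theorem put_arr (h : Env) (a : ℕ) (f : ℕ → ℕ) (i : ℕ) :
    (h.put a f).arr i = if i = a then f else h.arr i := Function.update_apply ..

/-- The machine memory `s` represents `h`: the bound is in register `1`, the scalar `i` in register
`2 * (i + 1)` and the array `a` in array `a + 2`. -/
structure Rel (h : Env) (s : Store) : Prop where
  bound : s.reg 1 = h.bound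
  var : ∀ i, s.reg (2 * (i + 1)) = h.var i
  inp : s.arr 0 = h.inp
  arr : ∀ a, s.arr (a + 2) = h.arr a

theorem Rel.congr {h : Env} {s s' : Store} (hs : h.Rel s) (ha : s'.arr = s.arr)
    (he : ∀ x, s'.reg (2 * x) = s.reg (2 * x)) (h1 : s'.reg 1 = s.reg 1) : h.Rel s' :=
  ⟨h1.trans hs.bound, fun i => (he _).trans (hs.var i), ha ▸ hs.inp, ha ▸ hs.arr⟩

theorem Rel.set {h : Env} {s : Store} (hs : h.Rel s) (x n : ℕ) :
    (h.set x n).Rel (s.setReg (2 * (x + 1)) n) where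
  bound := by simp [Store.setReg, Function.update_apply, hs.bound]; omega
  var i := by simp [Store.setReg, Function.update_apply, ← hs.var]
  inp := hs.inp
  arr := hs.arr

/-- Odd registers are temporaries, except that register `1` holds the bound; hence `1 ≤ x`. -/
theorem Rel.setTmp {h : Env} {s : Store} (hs : h.Rel s) (x n : ℕ) (hx : 1 ≤ x) :
    h.Rel (s.setReg (2 * x + 1) n) where
  bound := by rw [← hs.bound]; simp (disch := omega) [Store.setReg, Function.update_of_ne]
  var i := by rw [← hs.var]; simp (disch := omega) [Store.setReg, Function.update_of_ne]
  inp := hs.inp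
  arr := hs.arr

end Env

/-- `dst := src` -/
def move (dst src : ℕ) : Program := .seq (.const dst 0) (.add dst dst src)

theorem exec_move {dst src : ℕ} (h : src ≠ dst) (s : Store) :
    Exec (move dst src) s 2 (s.setReg dst (s.reg src)) := by
  have := (Exec.const s dst 0).seq (Exec.add (s.setReg dst 0) dst dst src)
  simpa [move, Store.setReg, Function.update_of_ne h] using this

/-- The register `c` counts down from `N`, so the loop stops after exactly `N` rounds. A round costs
its body and one test, and one more test ends the loop. -/
theorem exec_loop {Q : Program} {c τ N : ℕ} (Inv : ℕ → Store → Prop)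
    (hc : ∀ i s, Inv i s → s.reg c = N - i)
    (step : ∀ i < N, ∀ s, Inv i s → ∃ T s', Exec Q s T s' ∧ T ≤ τ ∧ Inv (i + 1) s')
    {s : Store} (hs : Inv 0 s) :
    ∃ T s', Exec (.loop c Q) s T s' ∧ T ≤ N * (τ + 1) + 1 ∧ Inv N s' := by
  suffices H : ∀ j i, i + j = N → ∀ s, Inv i s →
      ∃ T s', Exec (.loop c Q) s T s' ∧ T ≤ j * (τ + 1) + 1 ∧ Inv N s' from
    H N 0 (by omega) s hs
  intro j
  induction j with
  | zero =>
    intro i hi s hs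
    obtain rfl : i = N := by omega
    exact ⟨1, s, .loop_done (by simp [hc _ _ hs]), by omega, hs⟩
  | succ j ih =>
    intro i hi s hs
    obtain ⟨T, s', e, hT, hs'⟩ := step i (by omega) s hs
    obtain ⟨T', s'', e', hT', hs''⟩ := ih (i + 1) (by omega) s' hs'
    refine ⟨_, s'', .loop_step (by rw [hc _ _ hs]; omega) e e', ?_, hs''⟩
    linarith [add_mul j 1 (τ + 1)]

/-! ### Expressions -/

/-- `s'` differs from `s` only in the odd registers from `2 * L + 1` on. -/
structure Keeps (L : ℕ) (s s' : Store) : Prop where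
  arr : s'.arr = s.arr
  even : ∀ x, s'.reg (2 * x) = s.reg (2 * x)
  odd : ∀ x < L, s'.reg (2 * x + 1) = s.reg (2 * x + 1)

namespace Keeps

theorem rel {L : ℕ} {h : Env} {s s' : Store} (k : Keeps L s s') (hL : 1 ≤ L) (hs : h.Rel s) :
    h.Rel s' :=
  hs.congr k.arr k.even (k.odd 0 hL)

theorem trans {L M : ℕ} {s s' s'' : Store} (h : Keeps L s s') (h' : Keeps M s' s'')
    (hLM : L ≤ M) : Keeps L s s'' :=
  ⟨h'.arr.trans h.arr, fun x => (h'.even x).trans (h.even x),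
    fun x hx => (h'.odd x (hx.trans_le hLM)).trans (h.odd x hx)⟩

theorem setTmp (L M : ℕ) (s : Store) (n : ℕ) (h : L ≤ M) :
    Keeps L s (s.setReg (2 * M + 1) n) where
  arr := rfl
  even x := by simp (disch := omega) [Store.setReg, Function.update_of_ne]
  odd x hx := by simp (disch := omega) [Store.setReg, Function.update_of_ne]

end Keeps

/-- The machine can evaluate `v` in time polynomial in the bound, using only temporary registers
from a given number on. -/
class IsExpr (v : Env → ℕ) : Prop where
  exec : ∀ L, 1 ≤ L → ∃ (P : Program) (p : Polynomial ℕ), ∀ h s, h.Rel s →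
    ∃ T s', Exec P s T s' ∧ T ≤ p.eval h.bound ∧ Keeps L s s' ∧ s'.reg (2 * L + 1) = v h

abbrev eConst (c : ℕ) : Env → ℕ := fun _ => c
abbrev eVar (x : ℕ) : Env → ℕ := fun h => h.var x
def eInp (e : Env → ℕ) : Env → ℕ := fun h => h.inp (e h)
def eArr (a : ℕ) (e : Env → ℕ) : Env → ℕ := fun h => h.arr a (e h)
def eAdd (a b : Env → ℕ) : Env → ℕ := fun h => a h + b h
def eSub (a b : Env → ℕ) : Env → ℕ := fun h => a h - b h
def eCond (c a b : Env → ℕ) : Env → ℕ := fun h => if c h ≠ 0 then a h else b h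
def eLe (u v a b : Env → ℕ) : Env → ℕ := fun h => if u h ≤ v h then a h else b h
def eEq (u v a b : Env → ℕ) : Env → ℕ := fun h => if u h = v h then a h else b h
def eLet (x : ℕ) (a : Env → ℕ) (y : ℕ) (b e : Env → ℕ) : Env → ℕ :=
  fun h => e ((h.set x (a h)).set y (b h))

/-- `i`, modified by `st` for `y = 0, …, n - 1`, where `st` finds the current value in `x`. -/
def eFold (x y : ℕ) (n i st : Env → ℕ) : Env → ℕ := fun h =>
  Nat.rec (i h) (fun j r => st ((h.set x r).set y j)) (min (n h) h.bound)

/-- Products are repeated additions and remainders repeated subtractions, so the number of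
repetitions is cut off at the bound. The values are the true ones as long as `b`, respectively the
dividend, is at most the bound. -/
def eMul (a b : Env → ℕ) : Env → ℕ := fun h => a h * min (b h) h.bound
def eMod (a b : Env → ℕ) : Env → ℕ := fun h =>
  (fun r => if b h ≤ r then r - b h else r)^[min (a h) h.bound] (a h)

instance (c : ℕ) : IsExpr (eConst c) where
  exec L _ := ⟨.const (2 * L + 1) c, 1, fun h s _ =>
    ⟨1, _, .const s _ _, by simp, .setTmp L L s _ le_rfl, by simp [Store.setReg]⟩⟩

instance (x : ℕ) : IsExpr (eVar x) where
  exec L _ := ⟨move (2 * L + 1) (2 * (x + 1)), 2, fun h s hs =>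
    ⟨2, _, exec_move (by omega) s, by simp, .setTmp L L s _ le_rfl, by
      simp [Store.setReg, hs.var]⟩⟩

theorem isExpr_load {a : ℕ} {f : Env → ℕ → ℕ} (hf : ∀ h s, Env.Rel h s → s.arr a = f h)
    (e : Env → ℕ) [he : IsExpr e] : IsExpr fun h => f h (e h) where
  exec L hL := by
    obtain ⟨P, p, H⟩ := he.exec L hL
    refine ⟨.seq P (.load (2 * L + 1) a (2 * L + 1)), p + 1, fun h s hs => ?_⟩
    obtain ⟨T, s', e, hT, k, hv⟩ := H h s hs
    refine ⟨_, _, e.seq (.load ..), by simpa using hT, k.trans (.setTmp L L _ _ le_rfl) le_rfl, ?_⟩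
    simp [Store.setReg, hv, hf h s' (k.rel hL hs)]

instance (e : Env → ℕ) [IsExpr e] : IsExpr (eInp e) :=
  isExpr_load (f := fun h => h.inp) (fun _ _ hs => hs.inp) e

instance (a : ℕ) (e : Env → ℕ) [IsExpr e] : IsExpr (eArr a e) :=
  isExpr_load (f := fun h => h.arr a) (fun _ _ hs => hs.arr a) e

/-- The second operand is evaluated with temporaries from number `L + 1` on, so the first value
survives in register `2 * L + 1`. -/
theorem isExpr_op {op : ℕ → ℕ → ℕ → Program} {F : ℕ → ℕ → ℕ}
    (hop : ∀ s x y z, Exec (op x y z) s 1 (s.setReg x (F (s.reg y) (s.reg z))))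
    (a b : Env → ℕ) [ha : IsExpr a] [hb : IsExpr b] : IsExpr fun h => F (a h) (b h) where
  exec L hL := by
    obtain ⟨P, p, HP⟩ := ha.exec L hL
    obtain ⟨Q, q, HQ⟩ := hb.exec (L + 1) (by omega)
    refine ⟨.seq (.seq P Q) (op (2 * L + 1) (2 * L + 1) (2 * (L + 1) + 1)), p + q + 1,
      fun h s hs => ?_⟩
    obtain ⟨T, s1, e1, hT, k1, hv1⟩ := HP h s hs
    obtain ⟨T', s2, e2, hT', k2, hv2⟩ := HQ h s1 (k1.rel hL hs)
    refine ⟨_, _, (e1.seq e2).seq (hop ..), ?_,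
      (k1.trans k2 (by omega)).trans (.setTmp L L _ _ le_rfl) le_rfl, ?_⟩
    · simp; omega
    · simp [Store.setReg, hv2, k2.odd L (by omega), hv1]

instance (a b : Env → ℕ) [IsExpr a] [IsExpr b] : IsExpr (eAdd a b) :=
  isExpr_op (F := (· + ·)) (fun s x y z => Exec.add s x y z) a b

instance (a b : Env → ℕ) [IsExpr a] [IsExpr b] : IsExpr (eSub a b) :=
  isExpr_op (F := (· - ·)) (fun s x y z => Exec.sub s x y z) a b

instance (c a b : Env → ℕ) [hc : IsExpr c] [ha : IsExpr a] [hb : IsExpr b] :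
    IsExpr (eCond c a b) where
  exec L hL := by
    obtain ⟨P, p, HP⟩ := hc.exec L hL
    obtain ⟨Q, q, HQ⟩ := ha.exec L hL
    obtain ⟨R, r, HR⟩ := hb.exec L hL
    refine ⟨.seq P (.ite (2 * L + 1) Q R), p + q + r + 1, fun h s hs => ?_⟩
    obtain ⟨T, s1, e1, hT, k1, hv1⟩ := HP h s hs
    by_cases h0 : c h ≠ 0
    · obtain ⟨T', s2, e2, hT', k2, hv2⟩ := HQ h s1 (k1.rel hL hs)
      exact ⟨_, _, e1.seq (.ite_then (hv1 ▸ h0) e2), by simp; omega, k1.trans k2 le_rfl,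
        by simp [eCond, h0, hv2]⟩
    · obtain ⟨T', s2, e2, hT', k2, hv2⟩ := HR h s1 (k1.rel hL hs)
      push Not at h0
      exact ⟨_, _, e1.seq (.ite_else (hv1 ▸ h0) e2), by simp; omega, k1.trans k2 le_rfl,
        by simp [eCond, h0, hv2]⟩

instance (u v a b : Env → ℕ) [IsExpr u] [IsExpr v] [IsExpr a] [IsExpr b] :
    IsExpr (eLe u v a b) := by
  -- Truncated subtraction vanishes exactly when `u ≤ v`, so the branches trade places.
  have : eLe u v a b = eCond (eSub u v) b a := by
    funext h
    by_cases h' : u h ≤ v h <;> simp [eLe, eCond, eSub, h', Nat.sub_eq_zero_iff_le]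
  rw [this]; infer_instance

instance (u v a b : Env → ℕ) [IsExpr u] [IsExpr v] [IsExpr a] [IsExpr b] :
    IsExpr (eEq u v a b) := by
  have : eEq u v a b = eCond (eAdd (eSub u v) (eSub v u)) b a := by
    funext h
    by_cases h' : u h = v h
    · simp [eEq, eCond, eSub, eAdd, h']
    · have : u h - v h + (v h - u h) ≠ 0 := by omega
      simp only [eEq, eCond, eSub, eAdd, h', this, if_false, ne_eq, not_false_eq_true, if_true]
  rw [this]; infer_instance

/-- Ends the evaluation of `eLet` and `eFold`: the two borrowed scalars get back their saved values,
after which only temporaries have changed. If `x = y` the two writes agree. -/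
theorem Keeps.restore {L M : ℕ} {s s' : Store} {x y : ℕ} (ha : s'.arr = s.arr)
    (he : ∀ z, z ≠ x → z ≠ y → s'.reg (2 * (z + 1)) = s.reg (2 * (z + 1)))
    (h0 : s'.reg 0 = s.reg 0)
    (ho : ∀ z < L, s'.reg (2 * z + 1) = s.reg (2 * z + 1)) (hM : L ≤ M) (n : ℕ) :
    Keeps L s (((s'.setReg (2 * (y + 1)) (s.reg (2 * (y + 1)))).setReg (2 * (x + 1))
      (s.reg (2 * (x + 1)))).setReg (2 * M + 1) n) where
  arr := ha
  even z := by
    obtain _ | z := z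
    · simp (disch := omega) [Store.setReg, Function.update_of_ne, h0]
    · by_cases hx : z = x
      · subst hx; simp (disch := omega) [Store.setReg, Function.update_of_ne]
      by_cases hy : z = y
      · subst hy; simp (disch := omega) [Store.setReg, Function.update_of_ne]
      simp (disch := omega) [Store.setReg, Function.update_of_ne, he z hx hy]
  odd z hz := by simp (disch := omega) [Store.setReg, Function.update_of_ne, ho z hz]

instance (x : ℕ) (a : Env → ℕ) (y : ℕ) (b e : Env → ℕ) [ha : IsExpr a] [hb : IsExpr b]
    [he : IsExpr e] : IsExpr (eLet x a y b e) where
  exec L hL := by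
    obtain ⟨P, p, HP⟩ := ha.exec L hL
    obtain ⟨Q, q, HQ⟩ := hb.exec (L + 1) (by omega)
    obtain ⟨R, r, HR⟩ := he.exec (L + 4) (by omega)
    -- Temporaries `L` and `L + 1` hold the two values, `L + 2` and `L + 3` the old contents of `x`
    -- and `y`, and `e` is evaluated from `L + 4` on.
    refine ⟨.seq (.seq (.seq (.seq (.seq (.seq (.seq (.seq (.seq P Q)
      (move (2 * (L + 2) + 1) (2 * (x + 1)))) (move (2 * (L + 3) + 1) (2 * (y + 1))))
      (move (2 * (x + 1)) (2 * L + 1))) (move (2 * (y + 1)) (2 * (L + 1) + 1))) R)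
      (move (2 * (y + 1)) (2 * (L + 3) + 1))) (move (2 * (x + 1)) (2 * (L + 2) + 1)))
      (move (2 * L + 1) (2 * (L + 4) + 1)), p + q + r + 14, fun h s hs => ?_⟩
    obtain ⟨T1, s1, e1, hT1, k1, hv1⟩ := HP h s hs
    obtain ⟨T2, s2, e2, hT2, k2, hv2⟩ := HQ h s1 (k1.rel hL hs)
    have k12 : Keeps L s s2 := k1.trans k2 (by omega)
    have hs2 := k12.rel hL hs
    have hs3 := (((hs2.setTmp (L + 2) (s2.reg (2 * (x + 1))) (by omega)).setTmp (L + 3)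
      (s2.reg (2 * (y + 1))) (by omega)).set x (a h)).set y (b h)
    obtain ⟨T3, s3, e3, hT3, k3, hv3⟩ := HR _ _ hs3
    have E1 := (e1.seq e2).seq (exec_move (dst := 2 * (L + 2) + 1) (src := 2 * (x + 1))
      (by omega) _)
    have E2 := E1.seq (exec_move (dst := 2 * (L + 3) + 1) (src := 2 * (y + 1)) (by omega) _)
    have E3 := E2.seq (exec_move (dst := 2 * (x + 1)) (src := 2 * L + 1) (by omega) _)
    have E4 := E3.seq (exec_move (dst := 2 * (y + 1)) (src := 2 * (L + 1) + 1) (by omega) _)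
    have h1 : s2.reg (2 * L + 1) = a h := by rw [k2.odd L (by omega), hv1]
    simp (disch := omega) only [Store.setReg, Function.update_of_ne, h1, hv2] at E4
    have E5 := ((E4.seq e3).seq (exec_move (dst := 2 * (y + 1)) (src := 2 * (L + 3) + 1)
      (by omega) _)).seq (exec_move (dst := 2 * (x + 1)) (src := 2 * (L + 2) + 1) (by omega) _)
    have E6 := E5.seq (exec_move (dst := 2 * L + 1) (src := 2 * (L + 4) + 1) (by omega) _)
    refine ⟨_, _, E6, ?_, ?_, ?_⟩
    · simp at hT3 ⊢; omega
    · have hx : s3.reg (2 * (L + 2) + 1) = s.reg (2 * (x + 1)) := by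
        rw [k3.odd _ (by omega)]
        simp (disch := omega) [Store.setReg, Function.update_of_ne, k12.even]
      have hy : s3.reg (2 * (L + 3) + 1) = s.reg (2 * (y + 1)) := by
        rw [k3.odd _ (by omega)]
        simp (disch := omega) [Store.setReg, Function.update_of_ne, k12.even]
      have : (s3.setReg (2 * (y + 1)) (s3.reg (2 * (L + 3) + 1))).reg (2 * (L + 2) + 1) =
          s.reg (2 * (x + 1)) := by
        simp (disch := omega) [Store.setReg, Function.update_of_ne, hx]
      rw [this, hy]
      refine .restore (k3.arr.trans k12.arr) ?_ ?_ ?_ le_rfl _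
      · intro z hzx hzy
        rw [k3.even]
        simp (disch := omega) [Store.setReg, Function.update_of_ne, k12.even]
      · have := k3.even 0
        simp only [mul_zero] at this
        rw [this]
        have := k12.even 0
        simp (disch := omega) [Store.setReg, Function.update_of_ne] at this ⊢
        exact this
      · intro z hz
        rw [k3.odd _ (by omega)]
        simp (disch := omega) [Store.setReg, Function.update_of_ne, k12.odd z hz]
    · simp (disch := omega) [Store.setReg, Function.update_of_ne, hv3, eLet]

end Ram

/-! ### Execution of folds -/

namespace Ram

/-- `s'` agrees with `s` except for the scalars `x`, `y` and the odd registers from `2 * L + 1`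
on. -/
structure KeepsBut (x y L : ℕ) (s s' : Store) : Prop where
  arr : s'.arr = s.arr
  zero : s'.reg 0 = s.reg 0
  even : ∀ z, z ≠ x → z ≠ y → s'.reg (2 * (z + 1)) = s.reg (2 * (z + 1))
  odd : ∀ z < L, s'.reg (2 * z + 1) = s.reg (2 * z + 1)

namespace KeepsBut

variable {x y L : ℕ} {s s' s'' : Store}

/-- A round of a fold leaves arbitrary values in `x` and `y`; once both are written again, the store
represents an environment. -/
theorem rel (k : KeepsBut x y L s s') (hL : 1 ≤ L) {h : Env} (hs : h.Rel s) (a b : ℕ) :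
    ((h.set x a).set y b).Rel ((s'.setReg (2 * (x + 1)) a).setReg (2 * (y + 1)) b) where
  bound := by
    have := k.odd 0 hL
    rw [mul_zero, zero_add] at this
    simp (disch := omega) [Store.setReg, Function.update_of_ne, this, hs.bound]
  var i := by
    by_cases hx : i = x <;> by_cases hy : i = y <;>
      simp_all [Store.setReg, ← hs.var, k.even]
  inp := by simp [Store.setReg, k.arr, hs.inp]
  arr := by simp [Store.setReg, k.arr, hs.arr]

theorem keeps (k : KeepsBut x y L s s') {M : ℕ} (hM : L ≤ M) (k' : Keeps M s' s'') :
    KeepsBut x y L s s'' where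
  arr := k'.arr.trans k.arr
  zero := (k'.even 0).trans k.zero
  even z hx hy := (k'.even _).trans (k.even z hx hy)
  odd z hz := (k'.odd z (by omega)).trans (k.odd z hz)

theorem setX (k : KeepsBut x y L s s') (n : ℕ) :
    KeepsBut x y L s (s'.setReg (2 * (x + 1)) n) where
  arr := k.arr
  zero := by simp (disch := omega) [Store.setReg, Function.update_of_ne, k.zero]
  even z hx hy := by simp (disch := omega) [Store.setReg, Function.update_of_ne, k.even z hx hy]
  odd z hz := by simp (disch := omega) [Store.setReg, Function.update_of_ne, k.odd z hz]

theorem setY (k : KeepsBut x y L s s') (n : ℕ) :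
    KeepsBut x y L s (s'.setReg (2 * (y + 1)) n) where
  arr := k.arr
  zero := by simp (disch := omega) [Store.setReg, Function.update_of_ne, k.zero]
  even z hx hy := by simp (disch := omega) [Store.setReg, Function.update_of_ne, k.even z hx hy]
  odd z hz := by simp (disch := omega) [Store.setReg, Function.update_of_ne, k.odd z hz]

end KeepsBut

theorem Keeps.but {L : ℕ} {s s' : Store} (k : Keeps L s s') (x y : ℕ) : KeepsBut x y L s s' :=
  ⟨k.arr, k.even 0, fun _ _ _ => k.even _, k.odd⟩

/-- The state of the loop of a fold after `i` of its `N` rounds. -/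
structure FoldInv (x y L N : ℕ) (val : ℕ → ℕ) (s : Store) (i : ℕ) (s' : Store) : Prop where
  but : KeepsBut x y L s s'
  count : s'.reg (2 * L + 1) = N - i
  acc : s'.reg (2 * (L + 1) + 1) = val i
  oldX : s'.reg (2 * (L + 2) + 1) = s.reg (2 * (x + 1))
  oldY : s'.reg (2 * (L + 3) + 1) = s.reg (2 * (y + 1))
  one : s'.reg (2 * (L + 4) + 1) = 1
  idx : s'.reg (2 * (L + 5) + 1) = i

/-- Accumulator and index live in temporaries and are copied to `x` and `y` for each evaluation of
`st`, which works above both. The `8` extra steps are three moves of two steps and two arithmetic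
instructions. -/
theorem exec_fold_body {x y L N : ℕ} {st : Env → ℕ} {h : Env} {s : Store} (hL : 1 ≤ L)
    (hs : h.Rel s) {val : ℕ → ℕ} (hval : ∀ i, val (i + 1) = st ((h.set x (val i)).set y i))
    {R : Program} {τ : ℕ} (HR : ∀ h' s, h'.bound = h.bound → h'.Rel s →
      ∃ T s', Exec R s T s' ∧ T ≤ τ ∧ Keeps (L + 6) s s' ∧ s'.reg (2 * (L + 6) + 1) = st h')
    {i : ℕ} {s1 : Store} (inv : FoldInv x y L N val s i s1) :
    ∃ T s', Exec (.seq (.seq (.seq (.seq (.seq (move (2 * (x + 1)) (2 * (L + 1) + 1))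
      (move (2 * (y + 1)) (2 * (L + 5) + 1))) R) (move (2 * (L + 1) + 1) (2 * (L + 6) + 1)))
      (.add (2 * (L + 5) + 1) (2 * (L + 5) + 1) (2 * (L + 4) + 1)))
      (.sub (2 * L + 1) (2 * L + 1) (2 * (L + 4) + 1))) s1 T s' ∧ T ≤ τ + 8 ∧
      FoldInv x y L N val s (i + 1) s' := by
  have hr := inv.but.rel hL hs (val i) i
  obtain ⟨T, s2, e, hT, k, hv⟩ := HR ((h.set x (val i)).set y i) _ (by simp) hr
  have E := (exec_move (dst := 2 * (x + 1)) (src := 2 * (L + 1) + 1) (by omega) s1).seq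
    (exec_move (dst := 2 * (y + 1)) (src := 2 * (L + 5) + 1) (by omega) _)
  simp (disch := omega) only [Store.setReg, Function.update_of_ne, inv.acc, inv.idx] at E
  have E' := (((E.seq e).seq (exec_move (dst := 2 * (L + 1) + 1) (src := 2 * (L + 6) + 1)
    (by omega) _)).seq (Exec.add _ (2 * (L + 5) + 1) (2 * (L + 5) + 1) (2 * (L + 4) + 1))).seq
    (Exec.sub _ (2 * L + 1) (2 * L + 1) (2 * (L + 4) + 1))
  refine ⟨_, _, E', by omega, ?_⟩
  have o : ∀ z, L ≤ z → z < L + 6 → s2.reg (2 * z + 1) = s1.reg (2 * z + 1) := fun z _ hz => by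
    rw [k.odd z hz]
    simp (disch := omega) [Store.setReg, Function.update_of_ne]
  have kb : KeepsBut x y L s s2 := ((inv.but.setX (val i)).setY i).keeps (by omega) k
  constructor
  · exact ((kb.keeps le_rfl (.setTmp L _ _ _ (by omega))).keeps le_rfl
      (.setTmp L _ _ _ (by omega))).keeps le_rfl (.setTmp L _ _ _ (by omega))
  · simp (disch := omega) [Store.setReg, Function.update_of_ne, o, inv.count, inv.one]
    omega
  · simp (disch := omega) [Store.setReg, Function.update_of_ne, hv, hval]
  · simp (disch := omega) [Store.setReg, Function.update_of_ne, o, inv.oldX]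
  · simp (disch := omega) [Store.setReg, Function.update_of_ne, o, inv.oldY]
  · simp (disch := omega) [Store.setReg, Function.update_of_ne, o, inv.one]
  · simp (disch := omega) [Store.setReg, Function.update_of_ne, o, inv.one, inv.idx]

instance (x y : ℕ) (n i st : Env → ℕ) [hn : IsExpr n] [hi : IsExpr i] [hst : IsExpr st] :
    IsExpr (eFold x y n i st) where
  exec L hL := by
    obtain ⟨P, p, HP⟩ := hn.exec L hL
    obtain ⟨Q, q, HQ⟩ := hi.exec (L + 1) (by omega)
    obtain ⟨R, r, HR⟩ := hst.exec (L + 6) (by omega)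
    -- With truncation, bound minus (bound minus `n`) is the minimum of `n` and the bound; this cuts
    -- off the number of rounds.
    refine ⟨.seq (.seq (.seq (.seq (.seq (.seq (.seq (.seq (.seq (.seq (.seq P
      (.sub (2 * (L + 1) + 1) 1 (2 * L + 1))) (.sub (2 * L + 1) 1 (2 * (L + 1) + 1))) Q)
      (move (2 * (L + 2) + 1) (2 * (x + 1)))) (move (2 * (L + 3) + 1) (2 * (y + 1))))
      (.const (2 * (L + 4) + 1) 1)) (.const (2 * (L + 5) + 1) 0))
      (.loop (2 * L + 1) (.seq (.seq (.seq (.seq (.seq (move (2 * (x + 1)) (2 * (L + 1) + 1))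
        (move (2 * (y + 1)) (2 * (L + 5) + 1))) R) (move (2 * (L + 1) + 1) (2 * (L + 6) + 1)))
        (.add (2 * (L + 5) + 1) (2 * (L + 5) + 1) (2 * (L + 4) + 1)))
        (.sub (2 * L + 1) (2 * L + 1) (2 * (L + 4) + 1)))))
      (move (2 * (y + 1)) (2 * (L + 3) + 1))) (move (2 * (x + 1)) (2 * (L + 2) + 1)))
      (move (2 * L + 1) (2 * (L + 1) + 1)),
      p + q + Polynomial.X * (r + 9) + 15, fun h s hs => ?_⟩
    set N := min (n h) h.bound with hN
    set val : ℕ → ℕ := fun m =>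
      Nat.rec (i h) (fun j r => st ((h.set x r).set y j)) m with hval
    obtain ⟨T1, s1, e1, hT1, k1, hv1⟩ := HP h s hs
    have k2 := (k1.trans (.setTmp L (L + 1) _ (s1.reg 1 - s1.reg (2 * L + 1)) (by omega))
      le_rfl).trans (.setTmp L L _ N le_rfl) le_rfl
    obtain ⟨T2, s2, e2, hT2, k3, hv2⟩ := HQ h _ (k2.rel hL hs)
    have k := k2.trans k3 (by omega)
    have E1 := (e1.seq (Exec.sub s1 (2 * (L + 1) + 1) 1 (2 * L + 1))).seq
      (Exec.sub _ (2 * L + 1) 1 (2 * (L + 1) + 1))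
    have hN' : ((s1.setReg (2 * (L + 1) + 1) (s1.reg 1 - s1.reg (2 * L + 1))).reg 1 -
        (s1.setReg (2 * (L + 1) + 1) (s1.reg 1 - s1.reg (2 * L + 1))).reg (2 * (L + 1) + 1)) =
        N := by
      simp (disch := omega) [Store.setReg, Function.update_of_ne, hv1, (k1.rel hL hs).bound, hN]
      omega
    rw [hN'] at E1
    have E2 := ((((E1.seq e2).seq
      (exec_move (dst := 2 * (L + 2) + 1) (src := 2 * (x + 1)) (by omega) _)).seq
      (exec_move (dst := 2 * (L + 3) + 1) (src := 2 * (y + 1)) (by omega) _)).seq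
      (Exec.const _ (2 * (L + 4) + 1) 1)).seq (Exec.const _ (2 * (L + 5) + 1) 0)
    have hsetX : (s2.setReg (2 * (L + 2) + 1) (s2.reg (2 * (x + 1)))).reg (2 * (y + 1)) =
        s2.reg (2 * (y + 1)) := by simp (disch := omega) [Store.setReg, Function.update_of_ne]
    rw [hsetX] at E2
    have inv : FoldInv x y L N val s 0 ((((s2.setReg (2 * (L + 2) + 1)
        (s2.reg (2 * (x + 1)))).setReg (2 * (L + 3) + 1) (s2.reg (2 * (y + 1)))).setReg
        (2 * (L + 4) + 1) 1).setReg (2 * (L + 5) + 1) 0) := by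
      refine ⟨((((k.but x y).keeps le_rfl (.setTmp L (L + 2) _ (s2.reg (2 * (x + 1)))
        (by omega))).keeps le_rfl (.setTmp L (L + 3) _ (s2.reg (2 * (y + 1)))
        (by omega))).keeps le_rfl (.setTmp L (L + 4) _ 1
        (by omega))).keeps le_rfl (.setTmp L (L + 5) _ 0 (by omega)), ?_, ?_, ?_, ?_, ?_, ?_⟩
      · simp (disch := omega) [Store.setReg, Function.update_of_ne, k3.odd]
      · simp (disch := omega) [Store.setReg, Function.update_of_ne, hv2, hval]
      · simp (disch := omega) [Store.setReg, Function.update_of_ne, k.even]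
      · simp (disch := omega) [Store.setReg, Function.update_of_ne, k.even]
      · simp (disch := omega) [Store.setReg, Function.update_of_ne]
      · simp (disch := omega) [Store.setReg]
    have hloop := exec_loop (τ := r.eval h.bound + 8) (FoldInv x y L N val s)
      (fun i s inv => inv.count)
      (fun i _ s' inv => exec_fold_body hL hs (fun i => rfl) (fun h' s hb hs' => by
        have := HR h' s hs'
        rwa [hb] at this) inv) inv
    obtain ⟨T3, s3, e3, hT3, inv3⟩ := hloop
    have E3 := (((E2.seq e3).seq
      (exec_move (dst := 2 * (y + 1)) (src := 2 * (L + 3) + 1) (by omega) _)).seq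
      (exec_move (dst := 2 * (x + 1)) (src := 2 * (L + 2) + 1) (by omega) _)).seq
      (exec_move (dst := 2 * L + 1) (src := 2 * (L + 1) + 1) (by omega) _)
    refine ⟨_, _, E3, ?_, ?_, ?_⟩
    · have : N * (r.eval h.bound + 8 + 1) ≤ h.bound * (r.eval h.bound + 9) :=
        Nat.mul_le_mul (min_le_right _ _) le_rfl
      simp; omega
    · have : (s3.setReg (2 * (y + 1)) (s3.reg (2 * (L + 3) + 1))).reg (2 * (L + 2) + 1) =
          s.reg (2 * (x + 1)) := by
        simp (disch := omega) [Store.setReg, Function.update_of_ne, inv3.oldX]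
      rw [this, inv3.oldY]
      exact .restore inv3.but.arr inv3.but.even inv3.but.zero inv3.but.odd le_rfl _
    · simp (disch := omega) [Store.setReg, Function.update_of_ne, inv3.acc, eFold, hval, hN]

instance (a b : Env → ℕ) [IsExpr a] [IsExpr b] : IsExpr (eMul a b) := by
  -- The operands are put into scalars beforehand, since inside the fold they would see its changed
  -- scalars `2` and `3`.
  have : eMul a b = eLet 0 a 1 b (eFold 2 3 (eVar 1) (eConst 0) (eAdd (eVar 2) (eVar 0))) := by
    funext h
    simp only [eMul, eLet, eFold, eVar, eAdd, eConst, Env.set_var, Env.set_bound]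
    simp only [if_true, OfNat.zero_ne_ofNat, zero_ne_one, if_false, Nat.reduceEqDiff]
    generalize min (b h) h.bound = n
    induction n with
    | zero => rfl
    | succ n ih => rw [mul_add, ih, mul_one]
  rw [this]; infer_instance

instance (a b : Env → ℕ) [IsExpr a] [IsExpr b] : IsExpr (eMod a b) := by
  have : eMod a b = eLet 0 a 1 b (eFold 2 3 (eVar 0) (eVar 0)
      (eLe (eVar 1) (eVar 2) (eSub (eVar 2) (eVar 1)) (eVar 2))) := by
    funext h
    simp only [eMod, eLet, eFold, eVar, eLe, eSub, Env.set_var, Env.set_bound]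
    simp only [zero_ne_one, if_false, if_true, OfNat.one_ne_ofNat, Nat.reduceEqDiff]
    generalize min (a h) h.bound = n
    induction n with
    | zero => rfl
    | succ n ih => rw [Function.iterate_succ_apply', ih]
  rw [this]; infer_instance

end Ram

namespace Ram

/-! ### Loops around programs -/

/-- Once the loop starts, temporary `L` holds the rounds left, `L + 1` the old value of `x`, `L + 2`
the constant one and `L + 3` the index. The body may use those from `L + 4` on. -/
def forProgram (L x : ℕ) (P R : Program) : Program :=
  .seq (.seq (.seq (.seq (.seq (.seq (.seq P
    (.sub (2 * (L + 1) + 1) 1 (2 * L + 1))) (.sub (2 * L + 1) 1 (2 * (L + 1) + 1)))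
    (move (2 * (L + 1) + 1) (2 * (x + 1)))) (.const (2 * (L + 2) + 1) 1))
    (.const (2 * (L + 3) + 1) 0))
    (.loop (2 * L + 1) (.seq (.seq (.seq (move (2 * (x + 1)) (2 * (L + 3) + 1)) R)
      (.add (2 * (L + 3) + 1) (2 * (L + 3) + 1) (2 * (L + 2) + 1)))
      (.sub (2 * L + 1) (2 * L + 1) (2 * (L + 2) + 1)))))
    (move (2 * (x + 1)) (2 * (L + 1) + 1))

/-- Common to loops of commands and of generators: `Φ` describes the store between rounds, and `Ψ`
the store once `x` has been set for a round. The final restoration of `x` is left visible in the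
last store, for each use to deal with. -/
theorem exec_for {L x N τ B T₀ c : ℕ} {P R : Program} (hL : 1 ≤ L) {s : Store} {s₀ : Store}
    (Φ Ψ : ℕ → Store → Prop) (hΦ : ∀ i s s', Keeps L s s' → Φ i s → Φ i s')
    (hΨ : ∀ i s, Φ i s → Ψ i (s.setReg (2 * (x + 1)) i))
    (body : ∀ i < N, ∀ s, Ψ i s → ∃ T s', Exec R s T s' ∧ T ≤ τ ∧ Φ (i + 1) s' ∧
      ∀ z < L + 4, s'.reg (2 * z + 1) = s.reg (2 * z + 1))
    (hP : Exec P s T₀ s₀) (k : Keeps L s s₀) (hc : s₀.reg (2 * L + 1) = c)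
    (hB : s.reg 1 = B) (hN : N = min c B) (hs : Φ 0 s) :
    ∃ T s', Exec (forProgram L x P R) s T (s'.setReg (2 * (x + 1)) (s.reg (2 * (x + 1)))) ∧
      T ≤ T₀ + B * (τ + 5) + 9 ∧ Φ N s' ∧ ∀ z < L, s'.reg (2 * z + 1) = s.reg (2 * z + 1) := by
  let Inv : ℕ → Store → Prop := fun i s' => Φ i s' ∧
    (∀ z < L, s'.reg (2 * z + 1) = s.reg (2 * z + 1)) ∧ s'.reg (2 * L + 1) = N - i ∧
    s'.reg (2 * (L + 1) + 1) = s.reg (2 * (x + 1)) ∧ s'.reg (2 * (L + 2) + 1) = 1 ∧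
    s'.reg (2 * (L + 3) + 1) = i
  have E1 := (hP.seq (Exec.sub s₀ (2 * (L + 1) + 1) 1 (2 * L + 1))).seq
    (Exec.sub _ (2 * L + 1) 1 (2 * (L + 1) + 1))
  have hN' : ((s₀.setReg (2 * (L + 1) + 1) (s₀.reg 1 - s₀.reg (2 * L + 1))).reg 1 -
      (s₀.setReg (2 * (L + 1) + 1) (s₀.reg 1 - s₀.reg (2 * L + 1))).reg (2 * (L + 1) + 1)) =
      N := by
    have : s₀.reg 1 = B := (k.odd 0 hL).trans hB
    simp (disch := omega) [Store.setReg, Function.update_of_ne, hc, this, hN]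
    omega
  rw [hN'] at E1
  have E2 := ((E1.seq (exec_move (dst := 2 * (L + 1) + 1) (src := 2 * (x + 1)) (by omega) _)).seq
    (Exec.const _ (2 * (L + 2) + 1) 1)).seq (Exec.const _ (2 * (L + 3) + 1) 0)
  simp (disch := omega) only [Store.setReg, Function.update_of_ne, k.even] at E2
  have inv : Inv 0 (((((s₀.setReg (2 * (L + 1) + 1) (s₀.reg 1 - s₀.reg (2 * L + 1))).setReg
      (2 * L + 1) N).setReg (2 * (L + 1) + 1) (s.reg (2 * (x + 1)))).setReg
      (2 * (L + 2) + 1) 1).setReg (2 * (L + 3) + 1) 0) := by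
    refine ⟨hΦ 0 s _ (((((k.trans (.setTmp L (L + 1) _ (s₀.reg 1 - s₀.reg (2 * L + 1))
        (by omega)) le_rfl).trans
        (.setTmp L L _ N le_rfl) le_rfl).trans (.setTmp L (L + 1) _ (s.reg (2 * (x + 1)))
        (by omega)) le_rfl).trans
        (.setTmp L (L + 2) _ 1 (by omega)) le_rfl).trans (.setTmp L (L + 3) _ 0 (by omega))
        le_rfl) hs, ?_, ?_, ?_, ?_, ?_⟩
    · intro z hz
      simp (disch := omega) [Store.setReg, Function.update_of_ne, k.odd z hz]
    all_goals simp (disch := omega) [Store.setReg, Function.update_of_ne]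
  have hloop := exec_loop (c := 2 * L + 1) (τ := τ + 4) (N := N)
    (Q := .seq (.seq (.seq (move (2 * (x + 1)) (2 * (L + 3) + 1)) R)
      (.add (2 * (L + 3) + 1) (2 * (L + 3) + 1) (2 * (L + 2) + 1)))
      (.sub (2 * L + 1) (2 * L + 1) (2 * (L + 2) + 1))) Inv (fun i s h => h.2.2.1) (by
    rintro i hi s1 ⟨hp, ho, hcount, hold, hone, hidx⟩
    obtain ⟨T, s2, e, hT, hp2, ho2⟩ := body i hi _ (hΨ i s1 hp)
    have e0 := exec_move (dst := 2 * (x + 1)) (src := 2 * (L + 3) + 1) (by omega) s1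
    rw [hidx] at e0
    refine ⟨_, _, ((e0.seq e).seq (.add ..)).seq (.sub ..), by omega, ?_, ?_, ?_, ?_, ?_, ?_⟩
    · exact hΦ _ _ _ (.setTmp L L _ _ le_rfl) (hΦ _ _ _ (.setTmp L (L + 3) _ _ (by omega)) hp2)
    · intro z hz
      simp (disch := omega) [Store.setReg, Function.update_of_ne, ho2 z (by omega), ho z hz]
    all_goals
      simp (disch := omega) [Store.setReg, Function.update_of_ne, ho2, hcount, hold, hone, hidx]
    omega) inv
  obtain ⟨T3, s3, e3, hT3, hp, ho, -, hold, -, -⟩ := hloop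
  have E3 := (E2.seq e3).seq
    (exec_move (dst := 2 * (x + 1)) (src := 2 * (L + 1) + 1) (by omega) _)
  rw [hold] at E3
  refine ⟨_, s3, E3, ?_, hp, ho⟩
  have : N * (τ + 4 + 1) ≤ B * (τ + 5) := Nat.mul_le_mul (by omega) le_rfl
  omega

/-! ### Commands -/

/-- The machine can perform the change `f` in time polynomial in the bound. -/
class IsCmd (f : Env → Env) : Prop where
  bound : ∀ h, (f h).bound = h.bound
  exec : ∀ L, 1 ≤ L → ∃ (P : Program) (p : Polynomial ℕ), ∀ h s, h.Rel s →
    ∃ T s', Exec P s T s' ∧ T ≤ p.eval h.bound ∧ (f h).Rel s' ∧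
      ∀ x < L, s'.reg (2 * x + 1) = s.reg (2 * x + 1)

def cSet (x : ℕ) (e : Env → ℕ) : Env → Env := fun h => h.set x (e h)
def cPut (a : ℕ) (i e : Env → ℕ) : Env → Env := fun h =>
  h.put a (Function.update (h.arr a) (i h) (e h))
def cSeq (f g : Env → Env) : Env → Env := fun h => g (f h)
/-- `f`, performed for `x = 0, …, n - 1`; the value of `x` is restored. -/
def cFor (x : ℕ) (n : Env → ℕ) (f : Env → Env) : Env → Env := fun h =>
  Env.set (Nat.rec h (fun i h' => f (h'.set x i)) (min (n h) h.bound)) x (h.var x)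
def cLet (x : ℕ) (a : Env → ℕ) (y : ℕ) (b : Env → ℕ) (f : Env → Env) : Env → Env := fun h =>
  ((f ((h.set x (a h)).set y (b h))).set y (h.var y)).set x (h.var x)

theorem setReg_even_odd (s : Store) (x n z : ℕ) :
    (s.setReg (2 * (x + 1)) n).reg (2 * z + 1) = s.reg (2 * z + 1) := by
  simp (disch := omega) [Store.setReg, Function.update_of_ne]

instance (x : ℕ) (e : Env → ℕ) [he : IsExpr e] : IsCmd (cSet x e) where
  bound _ := rfl
  exec L hL := by
    obtain ⟨P, p, H⟩ := he.exec L hL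
    refine ⟨.seq P (move (2 * (x + 1)) (2 * L + 1)), p + 2, fun h s hs => ?_⟩
    obtain ⟨T, s1, e1, hT, k, hv⟩ := H h s hs
    have := e1.seq (exec_move (dst := 2 * (x + 1)) (src := 2 * L + 1) (by omega) s1)
    rw [hv] at this
    exact ⟨_, _, this, by simp; omega, (k.rel hL hs).set x _, fun z hz => by
      rw [setReg_even_odd, k.odd z hz]⟩

instance (a : ℕ) (i e : Env → ℕ) [hi : IsExpr i] [he : IsExpr e] : IsCmd (cPut a i e) where
  bound _ := rfl
  exec L hL := by
    obtain ⟨P, p, HP⟩ := hi.exec L hL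
    obtain ⟨Q, q, HQ⟩ := he.exec (L + 1) (by omega)
    refine ⟨.seq (.seq P Q) (.store (a + 2) (2 * L + 1) (2 * (L + 1) + 1)), p + q + 1,
      fun h s hs => ?_⟩
    obtain ⟨T1, s1, e1, hT1, k1, hv1⟩ := HP h s hs
    obtain ⟨T2, s2, e2, hT2, k2, hv2⟩ := HQ h s1 (k1.rel hL hs)
    have k := k1.trans k2 (by omega)
    have hr := k.rel hL hs
    have h1 : s2.reg (2 * L + 1) = i h := by rw [k2.odd L (by omega), hv1]
    have E := (e1.seq e2).seq (Exec.store s2 (a + 2) (2 * L + 1) (2 * (L + 1) + 1))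
    rw [h1, hv2] at E
    refine ⟨_, _, E, by simp; omega, ⟨hr.bound, hr.var, ?_, fun b => ?_⟩, k.odd⟩
    · simp (disch := omega) [Store.setArr, Function.update_of_ne, hr.inp, cPut, Env.put]
    · by_cases hb : b = a
      · subst hb; simp [Store.setArr, cPut, hr.arr]
      · simp [Store.setArr, cPut, hr.arr, hb]

instance (f g : Env → Env) [hf : IsCmd f] [hg : IsCmd g] : IsCmd (cSeq f g) where
  bound h := (hg.bound _).trans (hf.bound _)
  exec L hL := by
    obtain ⟨P, p, HP⟩ := hf.exec L hL
    obtain ⟨Q, q, HQ⟩ := hg.exec L hL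
    refine ⟨.seq P Q, p + q, fun h s hs => ?_⟩
    obtain ⟨T1, s1, e1, hT1, r1, o1⟩ := HP h s hs
    obtain ⟨T2, s2, e2, hT2, r2, o2⟩ := HQ _ s1 r1
    rw [hf.bound] at hT2
    exact ⟨_, s2, e1.seq e2, by simp; omega, r2, fun z hz => (o2 z hz).trans (o1 z hz)⟩

theorem IsCmd.iterate_bound (f : Env → Env) [hf : IsCmd f] (x : ℕ) (h : Env) (m : ℕ) :
    (Nat.rec h (fun i h' => f (h'.set x i)) m : Env).bound = h.bound := by
  induction m with
  | zero => rfl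
  | succ m ih => rw [← ih]; exact hf.bound _

instance (x : ℕ) (n : Env → ℕ) (f : Env → Env) [hn : IsExpr n] [hf : IsCmd f] :
    IsCmd (cFor x n f) where
  bound h := IsCmd.iterate_bound f x h _
  exec L hL := by
    obtain ⟨P, p, HP⟩ := hn.exec L hL
    obtain ⟨R, r, HR⟩ := hf.exec (L + 4) (by omega)
    refine ⟨forProgram L x P R, p + Polynomial.X * (r + 5) + 9, fun h s hs => ?_⟩
    obtain ⟨T1, s1, e1, hT1, k1, hv1⟩ := HP h s hs
    let env : ℕ → Env := fun m => Nat.rec h (fun i h' => f (h'.set x i)) m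
    have hb : ∀ m, (env m).bound = h.bound := IsCmd.iterate_bound f x h
    obtain ⟨T, s', e, hT, hr, ho⟩ := exec_for (N := min (n h) h.bound) (τ := r.eval h.bound)
      (R := R) (x := x) hL (fun i s => (env i).Rel s) (fun i s => ((env i).set x i).Rel s)
      (fun i s s' k hs => k.rel hL hs) (fun i s hs => hs.set x i) (fun i _ s hs => by
        have := HR _ s hs
        rw [Env.set_bound, hb i] at this
        exact this) e1 k1 hv1 hs.bound rfl hs
    refine ⟨T, _, e, by simp; omega, ?_, fun z hz => by rw [setReg_even_odd, ho z hz]⟩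
    rw [hs.var]
    exact hr.set x _

instance (x : ℕ) (a : Env → ℕ) (y : ℕ) (b : Env → ℕ) (f : Env → Env) [ha : IsExpr a]
    [hb : IsExpr b] [hf : IsCmd f] : IsCmd (cLet x a y b f) where
  bound h := hf.bound _
  exec L hL := by
    obtain ⟨P, p, HP⟩ := ha.exec L hL
    obtain ⟨Q, q, HQ⟩ := hb.exec (L + 1) (by omega)
    obtain ⟨R, r, HR⟩ := hf.exec (L + 4) (by omega)
    refine ⟨.seq (.seq (.seq (.seq (.seq (.seq (.seq (.seq P Q)
      (move (2 * (L + 2) + 1) (2 * (x + 1)))) (move (2 * (L + 3) + 1) (2 * (y + 1))))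
      (move (2 * (x + 1)) (2 * L + 1))) (move (2 * (y + 1)) (2 * (L + 1) + 1))) R)
      (move (2 * (y + 1)) (2 * (L + 3) + 1))) (move (2 * (x + 1)) (2 * (L + 2) + 1)),
      p + q + r + 12, fun h s hs => ?_⟩
    obtain ⟨T1, s1, e1, hT1, k1, hv1⟩ := HP h s hs
    obtain ⟨T2, s2, e2, hT2, k2, hv2⟩ := HQ h s1 (k1.rel hL hs)
    have k12 : Keeps L s s2 := k1.trans k2 (by omega)
    have hs2 := k12.rel hL hs
    have hs3 := (((hs2.setTmp (L + 2) (s2.reg (2 * (x + 1))) (by omega)).setTmp (L + 3)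
      (s2.reg (2 * (y + 1))) (by omega)).set x (a h)).set y (b h)
    obtain ⟨T3, s3, e3, hT3, hr, ho⟩ := HR _ _ hs3
    have E1 := (e1.seq e2).seq (exec_move (dst := 2 * (L + 2) + 1) (src := 2 * (x + 1))
      (by omega) _)
    have E2 := E1.seq (exec_move (dst := 2 * (L + 3) + 1) (src := 2 * (y + 1)) (by omega) _)
    have E3 := E2.seq (exec_move (dst := 2 * (x + 1)) (src := 2 * L + 1) (by omega) _)
    have E4 := E3.seq (exec_move (dst := 2 * (y + 1)) (src := 2 * (L + 1) + 1) (by omega) _)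
    have h1 : s2.reg (2 * L + 1) = a h := by rw [k2.odd L (by omega), hv1]
    simp (disch := omega) only [Store.setReg, Function.update_of_ne, h1, hv2] at E4
    have E5 := ((E4.seq e3).seq (exec_move (dst := 2 * (y + 1)) (src := 2 * (L + 3) + 1)
      (by omega) _)).seq (exec_move (dst := 2 * (x + 1)) (src := 2 * (L + 2) + 1) (by omega) _)
    have hx : s3.reg (2 * (L + 2) + 1) = h.var x := by
      rw [ho _ (by omega), ← hs.var]
      simp (disch := omega) [Store.setReg, Function.update_of_ne, k12.even]
    have hy : s3.reg (2 * (L + 3) + 1) = h.var y := by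
      rw [ho _ (by omega), ← hs.var]
      simp (disch := omega) [Store.setReg, Function.update_of_ne, k12.even]
    have hx' : (s3.setReg (2 * (y + 1)) (h.var y)).reg (2 * (L + 2) + 1) = h.var x := by
      rw [setReg_even_odd, hx]
    rw [hy, hx'] at E5
    refine ⟨_, _, E5, ?_, (hr.set y _).set x _, ?_⟩
    · simp at hT3 ⊢; omega
    · intro z hz
      rw [setReg_even_odd, setReg_even_odd, ho z (by omega)]
      simp (disch := omega) [Store.setReg, Function.update_of_ne, k12.odd z hz]

/-! ### Generators of output -/

/-- The machine can append the list `g` to the output in time polynomial in the bound. -/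
class IsGen (g : Env → List ℕ) : Prop where
  exec : ∀ L, 1 ≤ L → ∃ (P : Program) (p : Polynomial ℕ), ∀ h s out, h.Rel s →
    HoldsOutput s out → ∃ T s', Exec P s T s' ∧ T ≤ p.eval h.bound ∧ h.Rel s' ∧
      HoldsOutput s' (out ++ g h) ∧ ∀ x < L, s'.reg (2 * x + 1) = s.reg (2 * x + 1)

def gNil : Env → List ℕ := fun _ => []
def gCons (e : Env → ℕ) (g : Env → List ℕ) : Env → List ℕ := fun h => e h :: g h
def gConst (l : List ℕ) : Env → List ℕ := fun _ => l
def gAppend (g g' : Env → List ℕ) : Env → List ℕ := fun h => g h ++ g' h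
def gFor (x : ℕ) (n : Env → ℕ) (g : Env → List ℕ) : Env → List ℕ := fun h =>
  (List.range (min (n h) h.bound)).flatMap fun i => g (h.set x i)

theorem _root_.HoldsOutput.congr {s s' : Store} {l : List ℕ} (h : HoldsOutput s l)
    (h0 : s'.reg 0 = s.reg 0) (ha : s'.arr = s.arr) : HoldsOutput s' l :=
  ⟨h0.trans h.1, fun i hi => by rw [ha]; exact h.2 i hi⟩

theorem Keeps.holdsOutput {L : ℕ} {s s' : Store} (k : Keeps L s s') {l : List ℕ}
    (h : HoldsOutput s l) : HoldsOutput s' l := h.congr (k.even 0) k.arr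

instance : IsGen gNil where
  exec L hL := ⟨.const (2 * L + 1) 0, 1, fun h s out hs ho => by
    have k : Keeps L s (s.setReg (2 * L + 1) 0) := .setTmp L L s 0 le_rfl
    exact ⟨1, _, .const s _ _, by simp, k.rel hL hs,
      by rw [gNil, List.append_nil]; exact k.holdsOutput ho, k.odd⟩⟩

/-- Register `0`, the length of the output, is also the index of the next free place of array `1`.
-/
theorem isGen_emit (e : Env → ℕ) [he : IsExpr e] : IsGen fun h => [e h] where
  exec L hL := by
    obtain ⟨P, p, H⟩ := he.exec L hL
    refine ⟨.seq (.seq (.seq P (.store 1 0 (2 * L + 1))) (.const (2 * L + 1) 1))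
      (.add 0 0 (2 * L + 1)), p + 3, fun h s out hs ho => ?_⟩
    obtain ⟨T, s1, e1, hT, k, hv⟩ := H h s hs
    have E := ((e1.seq (Exec.store s1 1 0 (2 * L + 1))).seq
      (Exec.const _ (2 * L + 1) 1)).seq (Exec.add _ 0 0 (2 * L + 1))
    have hr := k.rel hL hs
    have ho1 := k.holdsOutput ho
    refine ⟨_, _, E, by simp; omega, ⟨?_, fun i => ?_, ?_, fun a => ?_⟩, ⟨?_, fun i hi => ?_⟩,
      fun z hz => ?_⟩
    · simp (disch := omega) [Store.setReg, Store.setArr, Function.update_of_ne, hr.bound]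
    · simp (disch := omega) [Store.setReg, Store.setArr, Function.update_of_ne, hr.var]
    · simp (disch := omega) [Store.setReg, Store.setArr, Function.update_of_ne, hr.inp]
    · simp (disch := omega) [Store.setReg, Store.setArr, Function.update_of_ne, hr.arr]
    · simp (disch := omega) [Store.setReg, Store.setArr, Function.update_of_ne, ho1.1]
    · rw [List.length_append, List.length_singleton] at hi
      simp only [Store.setReg, Store.setArr, Function.update_self, ho1.1, hv]
      rcases Nat.lt_succ_iff_lt_or_eq.mp hi with hi' | rfl
      · rw [Function.update_of_ne (by omega), ho1.2 i hi', List.getElem_append_left hi']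
      · simp
    · simp (disch := omega) [Store.setReg, Store.setArr, Function.update_of_ne, k.odd z hz]

instance (g g' : Env → List ℕ) [hg : IsGen g] [hg' : IsGen g'] : IsGen (gAppend g g') where
  exec L hL := by
    obtain ⟨P, p, HP⟩ := hg.exec L hL
    obtain ⟨Q, q, HQ⟩ := hg'.exec L hL
    refine ⟨.seq P Q, p + q, fun h s out hs ho => ?_⟩
    obtain ⟨T1, s1, e1, hT1, r1, o1, t1⟩ := HP h s out hs ho
    obtain ⟨T2, s2, e2, hT2, r2, o2, t2⟩ := HQ h s1 _ r1 o1
    exact ⟨_, s2, e1.seq e2, by simp; omega, r2, by rw [gAppend, ← List.append_assoc]; exact o2,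
      fun z hz => (t2 z hz).trans (t1 z hz)⟩

instance (e : Env → ℕ) (g : Env → List ℕ) [IsExpr e] [IsGen g] : IsGen (gCons e g) :=
  have := isGen_emit e
  inferInstanceAs (IsGen (gAppend (fun h => [e h]) g))

instance (l : List ℕ) : IsGen (gConst l) := by
  induction l with
  | nil => exact inferInstanceAs (IsGen gNil)
  | cons c l ih => exact inferInstanceAs (IsGen (gCons (eConst c) (gConst l)))

instance (x : ℕ) (n : Env → ℕ) (g : Env → List ℕ) [hn : IsExpr n] [hg : IsGen g] :
    IsGen (gFor x n g) where
  exec L hL := by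
    obtain ⟨P, p, HP⟩ := hn.exec L hL
    obtain ⟨R, r, HR⟩ := hg.exec (L + 4) (by omega)
    refine ⟨forProgram L x P R, p + Polynomial.X * (r + 5) + 9, fun h s out hs ho => ?_⟩
    obtain ⟨T1, s1, e1, hT1, k1, hv1⟩ := HP h s hs
    let O : ℕ → List ℕ := fun i => out ++ (List.range i).flatMap fun i => g (h.set x i)
    -- Between rounds the loop scalar holds some leftover value `j`, so the store represents `h`
    -- only up to that scalar.
    obtain ⟨T, s', e, hT, ⟨⟨j, hr⟩, ho'⟩, ht⟩ := exec_for (N := min (n h) h.bound)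
      (τ := r.eval h.bound) (R := R) (x := x) hL
      (fun i s => (∃ j, (h.set x j).Rel s) ∧ HoldsOutput s (O i))
      (fun i s => (h.set x i).Rel s ∧ HoldsOutput s (O i))
      (fun i s s' k hs => ⟨hs.1.imp fun j hj => k.rel hL hj, k.holdsOutput hs.2⟩)
      (fun i s ⟨⟨j, hj⟩, hs⟩ => ⟨by simpa [Env.set] using hj.set x i,
        hs.congr (by simp (disch := omega) [Store.setReg, Function.update_of_ne]) rfl⟩)
      (fun i _ s ⟨hs, hs'⟩ => by
        obtain ⟨T, s', e, hT, hr, ho, ht⟩ := HR _ s _ hs hs'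
        refine ⟨T, s', e, hT, ⟨⟨i, hr⟩, ?_⟩, ht⟩
        simpa [O, List.range_succ] using ho) e1 k1 hv1 hs.bound rfl
      ⟨⟨h.var x, by simpa [Env.set] using hs⟩, by simpa [O] using ho⟩
    refine ⟨T, _, e, by simp; omega, ?_, ?_, fun z hz => by rw [setReg_even_odd, ht z hz]⟩
    · have := hr.set x (s.reg (2 * (x + 1)))
      rw [hs.var] at this ⊢
      simpa [Env.set] using this
    · exact ho'.congr (by simp (disch := omega) [Store.setReg, Function.update_of_ne]) rfl

end Ram


/-! ## Flipping a binary digit -/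

/-- `y` with the binary digit of weight `H` flipped (if `H` is a power of two; in general the digit
of weight `H` in mixed radix notation). -/
def digitFlip (H y : ℕ) : ℕ := if y % (2 * H) < H then y + H else y - H

/-- `y` with the binary digit of weight `H` set to `c`. -/
def digitSet (H : ℕ) (c : Prop) [Decidable c] (y : ℕ) : ℕ :=
  (if y % (2 * H) < H then y else y - H) + if c then H else 0

section Digit

variable {H y : ℕ}

/-- The normal form behind all facts on digits: `b` is the digit of weight `H`. No power of two is
needed, since `H` will be `t * 2 ^ ℓ` for a general block length `t`. -/
theorem exists_digit (hH : 0 < H) (y : ℕ) : ∃ q b r, r < H ∧ b < 2 ∧ y = 2 * H * q + H * b + r := by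
  refine ⟨y / (2 * H), y % (2 * H) / H, y % H, Nat.mod_lt _ hH, ?_, ?_⟩
  · rw [Nat.div_lt_iff_lt_mul hH]; exact Nat.mod_lt _ (by omega)
  · have h1 := Nat.div_add_mod y (2 * H)
    have h2 := Nat.div_add_mod (y % (2 * H)) H
    rw [Nat.mod_mod_of_dvd y ⟨2, by ring⟩] at h2
    omega

theorem digit_mod {q b r : ℕ} (hr : r < H) (hb : b < 2) :
    (2 * H * q + H * b + r) % (2 * H) = H * b + r := by
  rw [add_assoc, Nat.mul_add_mod]
  apply Nat.mod_eq_of_lt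
  have : H * b ≤ H * 1 := Nat.mul_le_mul le_rfl (by omega)
  omega

theorem digitFlip_eq {q b r : ℕ} (hr : r < H) (hb : b < 2) :
    digitFlip H (2 * H * q + H * b + r) = 2 * H * q + H * (1 - b) + r := by
  rw [digitFlip, digit_mod hr hb]
  interval_cases b <;> simp [hr] <;> omega

theorem digitSet_eq {q b r : ℕ} (hr : r < H) (hb : b < 2) (c : Prop) [Decidable c] :
    digitSet H c (2 * H * q + H * b + r) = 2 * H * q + H * (if c then 1 else 0) + r := by
  rw [digitSet, digit_mod hr hb]
  interval_cases b <;> split_ifs <;> simp <;> omega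

theorem digitFlip_digitFlip (hH : 0 < H) (y : ℕ) : digitFlip H (digitFlip H y) = y := by
  obtain ⟨q, b, r, hr, hb, rfl⟩ := exists_digit hH y
  rw [digitFlip_eq hr hb, digitFlip_eq hr (by omega)]
  interval_cases b <;> simp

theorem digitFlip_ne (hH : 0 < H) (y : ℕ) : digitFlip H y ≠ y := by
  obtain ⟨q, b, r, hr, hb, rfl⟩ := exists_digit hH y
  rw [digitFlip_eq hr hb]
  interval_cases b <;> simp <;> omega

theorem digitFlip_lt {N : ℕ} (hH : 0 < H) (hN : 2 * H ∣ N) (hy : y < N) : digitFlip H y < N := by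
  obtain ⟨m, rfl⟩ := hN
  obtain ⟨q, b, r, hr, hb, rfl⟩ := exists_digit hH y
  rw [digitFlip_eq hr hb]
  have hq : q < m := by
    by_contra h
    have := Nat.mul_le_mul_left (2 * H) (not_lt.mp h)
    omega
  have := Nat.mul_le_mul_left (2 * H) (show q + 1 ≤ m from hq)
  have h2 : H * (1 - b) ≤ H * 1 := Nat.mul_le_mul le_rfl (by omega)
  rw [mul_add] at this
  omega

theorem digitFlip_mod_two (h : H % 2 = 0) (y : ℕ) : digitFlip H y % 2 = y % 2 := by
  rw [digitFlip]
  split_ifs with hy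
  · omega
  · have := Nat.mod_le y (2 * H)
    omega

theorem digitFlip_one_mod_two (y : ℕ) : digitFlip 1 y % 2 ≠ y % 2 := by
  rw [digitFlip]; split_ifs <;> omega

theorem digitSet_eq_or {c : Prop} [Decidable c] (hH : 0 < H) (y : ℕ) :
    digitSet H c y = y ∨ digitSet H c y = digitFlip H y := by
  obtain ⟨q, b, r, hr, hb, rfl⟩ := exists_digit hH y
  rw [digitFlip_eq hr hb, digitSet_eq hr hb]
  interval_cases b <;> by_cases c <;> simp_all

theorem digitSet_digitFlip {c : Prop} [Decidable c] (hH : 0 < H) (y : ℕ) :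
    digitSet H c (digitFlip H y) = digitSet H c y := by
  obtain ⟨q, b, r, hr, hb, rfl⟩ := exists_digit hH y
  rw [digitFlip_eq hr hb, digitSet_eq hr hb, digitSet_eq hr (by omega)]

theorem digitSet_ne {c c' : Prop} [Decidable c] [Decidable c'] (hH : 0 < H) (hc : ¬(c ↔ c'))
    (y : ℕ) : digitSet H c y ≠ digitSet H c' y := by
  obtain ⟨q, b, r, hr, hb, rfl⟩ := exists_digit hH y
  rw [digitSet_eq hr hb, digitSet_eq hr hb]
  by_cases h : c <;> by_cases h' : c' <;> simp_all <;> omega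

/-- Setting a digit forgets that digit and nothing else. This limits the possible collisions of new
positions to one pair of tokens. -/
theorem digitFlip_of_digitSet_eq {z : ℕ} {c c' : Prop} [Decidable c] [Decidable c'] (hH : 0 < H)
    (h : digitSet H c y = digitSet H c' z) : z = y ∨ z = digitFlip H y := by
  obtain ⟨q, b, r, hr, hb, rfl⟩ := exists_digit hH y
  have hz : digitSet H c' z = z ∨ digitSet H c' z = digitFlip H z := digitSet_eq_or hH z
  have hy := digitSet_eq_or (c := c) hH (2 * H * q + H * b + r)
  rw [← h] at hz
  rcases hz with hz | hz <;> rcases hy with hy | hy <;> rw [hy] at hz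
  · exact .inl hz.symm
  · exact .inr hz.symm
  · right; rw [hz, digitFlip_digitFlip hH]
  · left; rw [← digitFlip_digitFlip hH z, ← hz, digitFlip_digitFlip hH]

/-- Links positions with blocks: together with `digitFlip_mul_mod` it shows that the crossing edges
of the butterfly change one digit of the block and keep the offset. -/
theorem digitFlip_mul_div {t : ℕ} (ht : 0 < t) (y : ℕ) :
    digitFlip (t * H) y / t = digitFlip H (y / t) := by
  have : y % (2 * (t * H)) < t * H ↔ y / t % (2 * H) < H := by
    rw [show 2 * (t * H) = t * (2 * H) by ring, Nat.mod_mul, mul_comm t H,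
      ← Nat.div_lt_iff_lt_mul ht, Nat.add_mul_div_left _ _ ht,
      Nat.div_eq_of_lt (Nat.mod_lt _ ht), zero_add]
  rw [digitFlip, digitFlip]
  simp only [this]
  split_ifs with h
  · rw [Nat.add_mul_div_left _ _ ht]
  · rw [Nat.sub_mul_div]

theorem digitFlip_mul_mod {t : ℕ} (hH : 0 < t * H) (y : ℕ) : digitFlip (t * H) y % t = y % t := by
  obtain ⟨q, b, r, hr, hb, rfl⟩ := exists_digit hH y
  rw [digitFlip_eq hr hb, show 2 * (t * H) * q + t * H * (1 - b) + r =
    r + t * (2 * H * q + H * (1 - b)) by ring, show 2 * (t * H) * q + t * H * b + r =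
    r + t * (2 * H * q + H * b) by ring, Nat.add_mul_mod_self_left, Nat.add_mul_mod_self_left]

/-- The induction step for meeting at the top: blocks that agree in their `ℓ` low digits, and whose
digit `ℓ` is set to the same value, agree in `ℓ + 1` digits. -/
theorem digitSet_div_mod {t ℓ : ℕ} (ht : 0 < t) (c : Prop) [Decidable c] (y : ℕ) :
    digitSet (t * 2 ^ ℓ) c y / t % 2 ^ (ℓ + 1) =
      y / t % 2 ^ ℓ + 2 ^ ℓ * if c then 1 else 0 := by
  have hp : 0 < 2 ^ ℓ := by positivity
  obtain ⟨q, b, r, hr, hb, rfl⟩ := exists_digit (Nat.mul_pos ht hp) y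
  rw [digitSet_eq hr hb, show 2 * (t * 2 ^ ℓ) * q + t * 2 ^ ℓ * (if c then 1 else 0) + r =
    r + t * (2 ^ (ℓ + 1) * q + 2 ^ ℓ * if c then 1 else 0) by ring,
    show 2 * (t * 2 ^ ℓ) * q + t * 2 ^ ℓ * b + r =
    r + t * (2 ^ ℓ * (2 * q + b)) by ring, Nat.add_mul_div_left _ _ ht,
    Nat.add_mul_div_left _ _ ht, Nat.add_mul_mod_self_left]
  have hr' : r / t < 2 ^ ℓ := by rw [Nat.div_lt_iff_lt_mul ht]; linarith
  rw [Nat.mod_eq_of_lt hr', show r / t + (2 ^ (ℓ + 1) * q + 2 ^ ℓ * if c then 1 else 0) =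
    (r / t + 2 ^ ℓ * if c then 1 else 0) + 2 ^ (ℓ + 1) * q by ring, Nat.add_mul_mod_self_left]
  apply Nat.mod_eq_of_lt
  rw [pow_succ]
  split_ifs <;> omega

end Digit

/-! ## Two-colouring the cycles of two involutions -/

namespace TwoInvolutions

variable {τ : Type*} (α ι : Equiv.Perm τ)

/-- The walk along a cycle formed by `α` and `ι`. -/
def walk : Equiv.Perm τ := ι * α * ι * α

variable {α ι} (hα : α * α = 1) (hι : ι * ι = 1)
include hα hι

/-- Conjugation by `α` or by `ι` reverses the walk, as with the reflections and rotations of a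
dihedral group. -/
theorem walk_conj_zpow_left (k : ℤ) (y : τ) : α ((walk α ι ^ k) y) = (walk α ι ^ (-k)) (α y) := by
  have ha : α⁻¹ = α := inv_eq_of_mul_eq_one_left hα
  have hi : ι⁻¹ = ι := inv_eq_of_mul_eq_one_left hι
  have h : α * walk α ι * α⁻¹ = (walk α ι)⁻¹ := by
    simp only [walk, mul_inv_rev, ha, hi, mul_assoc, hα, mul_one]
  have := congrArg (· ^ k) h
  simp only [conj_zpow, inv_zpow'] at this
  rw [← this]
  simp

theorem walk_conj_zpow_right (k : ℤ) (y : τ) : ι ((walk α ι ^ k) y) = (walk α ι ^ (-k)) (ι y) := by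
  have ha : α⁻¹ = α := inv_eq_of_mul_eq_one_left hα
  have hi : ι⁻¹ = ι := inv_eq_of_mul_eq_one_left hι
  have h : ι * walk α ι * ι⁻¹ = (walk α ι)⁻¹ := by
    simp only [walk, mul_inv_rev, ha, hi, ← mul_assoc, hι, one_mul]
  have := congrArg (· ^ k) h
  simp only [conj_zpow, inv_zpow'] at this
  rw [← this]
  simp

/-- If `α y` were `k` walks away from `y`, reflecting at the midpoint would give a fixed point of
`α`: the midpoint itself for even `k`, and `ι (α z)` for odd `k`, where `z` is the point just before
the middle. -/
theorem not_sameCycle (fα : ∀ y, α y ≠ y) (y : τ) :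
    ¬ (walk α ι).SameCycle y (α y) := by
  rintro ⟨k, hk⟩
  rcases Int.even_or_odd' k with ⟨l, rfl | rfl⟩
  · apply fα ((walk α ι ^ l) y)
    rw [walk_conj_zpow_left hα hι, ← hk, ← Equiv.Perm.mul_apply, ← zpow_add]
    congr 2; ring
  · have h : α ((walk α ι ^ l) y) = walk α ι ((walk α ι ^ l) y) := by
      rw [walk_conj_zpow_left hα hι, ← hk, ← Equiv.Perm.mul_apply, ← Equiv.Perm.mul_apply,
        ← zpow_add, ← zpow_one_add]
      congr 2; ring
    generalize (walk α ι ^ l) y = z at h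
    have hi : ∀ z, ι (ι z) = z := fun z => by rw [← Equiv.Perm.mul_apply, hι]; rfl
    apply fα (ι (α z))
    conv_rhs => rw [h]
    simp [walk, hi]

/-- A two-colouring of the cycles formed by two involutions: the colour of `y` tells whether the
half of the cycle that contains `y` has the smaller minimum. -/
theorem colouring (fα : ∀ y, α y ≠ y) (side : τ → Prop) (sα : ∀ y, side (α y) ↔ side y)
    (sι : ∀ y, side (ι y) ↔ ¬ side y) (val : τ → ℕ) (hval : Function.Injective val) (m : τ → ℕ)
    (hm : ∀ y, (∃ z, (walk α ι).SameCycle y z ∧ m y = val z) ∧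
      ∀ z, (walk α ι).SameCycle y z → m y ≤ val z) (y : τ) :
    (min (m (ι y)) (m (ι (ι y))) < min (m (α (ι y))) (m (ι (α (ι y)))) ↔
      min (m y) (m (ι y)) < min (m (α y)) (m (ι (α y)))) ∧
    (min (m (α y)) (m (ι (α y))) < min (m (α (α y))) (m (ι (α (α y)))) ↔
      ¬ min (m y) (m (ι y)) < min (m (α y)) (m (ι (α y)))) := by
  have ha : ∀ z, α (α z) = z := fun z => by rw [← Equiv.Perm.mul_apply, hα]; rfl
  have hi : ∀ z, ι (ι z) = z := fun z => by rw [← Equiv.Perm.mul_apply, hι]; rfl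
  have hmσ : ∀ y z, (walk α ι).SameCycle y z → m y = m z := by
    intro y z h
    obtain ⟨⟨u, hu, eu⟩, ly⟩ := hm y
    obtain ⟨⟨v, hv, ev⟩, lz⟩ := hm z
    exact le_antisymm (ev ▸ ly v (h.trans hv)) (eu ▸ lz u (h.symm.trans hu))
  have sσ : ∀ y, side (walk α ι y) ↔ side y := fun y => by
    simp [walk, sα, sι]
  have scyc : ∀ y z, (walk α ι).SameCycle y z → (side z ↔ side y) := by
    rintro y z ⟨k, rfl⟩
    induction k using Int.induction_on with
    | zero => simp
    | succ i ih => rw [add_comm, zpow_add, zpow_one, Equiv.Perm.mul_apply, sσ, ih]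
    | pred i ih =>
      rw [← sσ, ← Equiv.Perm.mul_apply, ← zpow_one_add, add_sub_cancel]
      exact ih
  constructor
  -- The half of the cycle through `y` consists of the walk-cycles of `y` and `ι y`, the other half
  -- of those of `α y` and `ι (α y)`. Replacing `y` by `ι y` permutes the walk-cycles inside each
  -- half.
  · have h1 : m (α (ι y)) = m (ι (α y)) := hmσ _ _ ⟨1, by simp [walk, hi, ha]⟩
    have h2 : m (ι (α (ι y))) = m (α y) := (hmσ _ _ ⟨1, by simp [walk, ha]⟩).symm
    rw [hi, h1, h2, min_comm (m (ι y)), min_comm (m (ι (α y)))]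
  · rw [ha]
    -- Distinct walk-cycles are disjoint and `val` is injective, so their minima differ; then the
    -- minima of the two halves differ and exchanging the halves negates the comparison.
    have hne : ∀ u v, ¬ (walk α ι).SameCycle u v → m u ≠ m v := by
      intro u v h e
      obtain ⟨⟨z, hz, ez⟩, -⟩ := hm u
      obtain ⟨⟨w, hw, ew⟩, -⟩ := hm v
      have : z = w := hval (by omega)
      subst this
      exact h (hz.trans hw.symm)
    have n1 : m y ≠ m (α y) := hne _ _ (not_sameCycle hα hι fα y)
    have n2 : m (ι y) ≠ m (ι (α y)) := hne _ _ (by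
      rintro ⟨k, hk⟩
      apply not_sameCycle hα hι fα y
      refine ⟨-k, ?_⟩
      rw [← hi y, ← walk_conj_zpow_right hα hι, hk, hi, hi])
    -- The walk applies `ι` twice and so preserves the side, whereas `ι (α y)` lies on the other
    -- side from `y`. This is where parity excludes odd cycles.
    have n3 : m y ≠ m (ι (α y)) := hne _ _ (fun h => by
      have := scyc _ _ h
      rw [sι, sα] at this; tauto)
    have n4 : m (ι y) ≠ m (α y) := hne _ _ (fun h => by
      have := scyc _ _ h
      rw [sι, sα] at this; tauto)
    have : min (m y) (m (ι y)) ≠ min (m (α y)) (m (ι (α y))) := by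
      rcases min_choice (m y) (m (ι y)) with h | h <;>
        rcases min_choice (m (α y)) (m (ι (α y))) with h' | h' <;> rw [h, h'] <;> assumption
    omega

end TwoInvolutions


/-! ## Routing tokens through a butterfly network -/

/-- `ι` is an involution of the tokens `y < N` that changes their parity. -/
structure IsPairing (N : ℕ) (ι : ℕ → ℕ) : Prop where
  lt : ∀ y < N, ι y < N
  invol : ∀ y < N, ι (ι y) = y
  parity : ∀ y < N, ι y % 2 ≠ y % 2

/-- The tokens `y < N` have the distinct positions `P y < N`, of the same parity as `y`. -/
structure IsPlacing (N : ℕ) (P : ℕ → ℕ) : Prop where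
  lt : ∀ y < N, P y < N
  inj : ∀ y < N, ∀ z < N, P y = P z → y = z
  parity : ∀ y < N, P y % 2 = y % 2

namespace IsPlacing

variable {N : ℕ} {P : ℕ → ℕ}

theorem surj (hP : IsPlacing N P) {p : ℕ} (hp : p < N) : ∃ y < N, P y = p := by
  let f : Fin N → Fin N := fun y => ⟨P y, hP.lt y y.2⟩
  have hf : Function.Injective f := fun y z h =>
    Fin.ext (hP.inj y y.2 z z.2 (by simpa [f] using h))
  obtain ⟨y, hy⟩ := Finite.surjective_of_injective hf ⟨p, hp⟩
  exact ⟨y, y.2, congrArg Fin.val hy⟩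

end IsPlacing

/-- A cycle in `Fin N` has at most `N` elements. Hence the minimum over the iterates up to `N` is
the minimum over the whole cycle. -/
theorem exists_bounded_zpow {N : ℕ} (f : Equiv.Perm (Fin N)) (y : Fin N) (k : ℤ) :
    ∃ j ≤ N, (f ^ j) y = (f ^ k) y := by
  by_cases hy : y ∈ f.support
  · obtain ⟨i, hi, h⟩ := Equiv.Perm.SameCycle.exists_pow_eq_of_mem_support ⟨k, rfl⟩ hy
    exact ⟨i, hi.le.trans ((Finset.card_le_univ _).trans (by simp)), h⟩
  · refine ⟨0, N.zero_le, ?_⟩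
    rw [Equiv.Perm.notMem_support] at hy
    exact (Equiv.Perm.zpow_apply_eq_self_of_apply_eq_self hy k).symm

/-- The new digit of a token is its colour in `TwoInvolutions.colouring`, where `A` leads to the
token at the flipped position and `side` is the parity. As `H` is even and positions have the parity
of their tokens, `A` preserves parity, while `ι` changes it by assumption. -/
theorem routing_step {N H : ℕ} {P ι A M P' : ℕ → ℕ} (hH : 0 < H) (hH2 : H % 2 = 0)
    (hN : 2 * H ∣ N) (hP : IsPlacing N P) (hι : IsPairing N ι)
    (hA : ∀ y < N, A y < N ∧ P (A y) = digitFlip H (P y))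
    (hM : ∀ y < N, (∃ j, M y = (fun u => ι (A (ι (A u))))^[j] y) ∧
      ∀ j ≤ N, M y ≤ (fun u => ι (A (ι (A u))))^[j] y)
    (hP' : ∀ y < N, P' y =
      digitSet H (min (M y) (M (ι y)) < min (M (A y)) (M (ι (A y)))) (P y)) :
    IsPlacing N P' ∧ (∀ y < N, P' y = P y ∨ P' y = digitFlip H (P y)) ∧
      ∀ y < N, ∃ c : Prop, ∃ _ : Decidable c,
        P' y = digitSet H c (P y) ∧ P' (ι y) = digitSet H c (P (ι y)) := by
  have hAA : ∀ y < N, A (A y) = y := fun y hy =>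
    hP.inj _ (hA _ (hA y hy).1).1 _ hy (by
      rw [(hA _ (hA y hy).1).2, (hA y hy).2, digitFlip_digitFlip hH])
  have hApar : ∀ y < N, A y % 2 = y % 2 := fun y hy => by
    rw [← hP.parity _ (hA y hy).1, (hA y hy).2, digitFlip_mod_two hH2, hP.parity y hy]
  let αf : Fin N → Fin N := fun y => ⟨A y, (hA y y.2).1⟩
  let ιf : Fin N → Fin N := fun y => ⟨ι y, hι.lt y y.2⟩
  have αi : Function.Involutive αf := fun y => Fin.ext (hAA y y.2)
  have ιi : Function.Involutive ιf := fun y => Fin.ext (hι.invol y y.2)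
  let α : Equiv.Perm (Fin N) := αi.toPerm
  let κ : Equiv.Perm (Fin N) := ιi.toPerm
  have hwalk : ∀ (j : ℕ) (y : Fin N), ((TwoInvolutions.walk α κ ^ j) y : ℕ) =
      (fun u => ι (A (ι (A u))))^[j] y := by
    intro j y
    induction j with
    | zero => rfl
    | succ j ih =>
      rw [Function.iterate_succ_apply', ← ih, pow_succ', Equiv.Perm.mul_apply]
      rfl
  have col := fun y : Fin N => TwoInvolutions.colouring (α := α) (ι := κ)
    (Equiv.ext fun y => αi y) (Equiv.ext fun y => ιi y)
    (fun y h => by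
      have h1 := (hA y y.2).2
      rw [show A y = y from congrArg Fin.val h] at h1
      exact digitFlip_ne hH _ h1.symm)
    (fun y => (y : ℕ) % 2 = 0) (fun y => by
      change A y % 2 = 0 ↔ _
      rw [hApar y y.2])
    (fun y => by
      change ι y % 2 = 0 ↔ _
      have := hι.parity y y.2
      omega) Fin.val Fin.val_injective (fun y => M y) (fun y => by
      obtain ⟨⟨j, hj⟩, hle⟩ := hM y y.2
      refine ⟨⟨(TwoInvolutions.walk α κ ^ j) y, ⟨j, by simp⟩, ?_⟩, ?_⟩
      · rw [hwalk]; exact hj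
      · rintro z ⟨k, rfl⟩
        obtain ⟨j, hj, e⟩ := exists_bounded_zpow (TwoInvolutions.walk α κ) y k
        rw [← e, hwalk]
        exact hle j hj) y
  set c : ℕ → Prop := fun y => min (M y) (M (ι y)) < min (M (A y)) (M (ι (A y))) with hc
  have cι : ∀ y < N, (c (ι y) ↔ c y) := fun y hy => (col ⟨y, hy⟩).1
  have cA : ∀ y < N, (c (A y) ↔ ¬ c y) := fun y hy => (col ⟨y, hy⟩).2
  have hor : ∀ y < N, P' y = P y ∨ P' y = digitFlip H (P y) := fun y hy => by
    rw [hP' y hy]; exact digitSet_eq_or hH _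
  refine ⟨⟨fun y hy => ?_, fun y hy z hz h => ?_, fun y hy => ?_⟩, hor, fun y hy => ?_⟩
  · rcases hor y hy with h | h <;> rw [h]
    · exact hP.lt y hy
    · exact digitFlip_lt hH hN (hP.lt y hy)
  · rw [hP' y hy, hP' z hz] at h
    rcases digitFlip_of_digitSet_eq hH h with h1 | h1
    · exact (hP.inj _ hz _ hy h1).symm
    -- The only possible collision is between `y` and `A y`, and these receive opposite digits.
    · rw [← (hA y hy).2] at h1
      obtain rfl := hP.inj _ hz _ (hA y hy).1 h1
      rw [(hA y hy).2, digitSet_digitFlip hH] at h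
      have hne : ¬ (c y ↔ c (A y)) := by
        have := cA y hy
        tauto
      exact absurd h (digitSet_ne hH hne _)
  · rcases hor y hy with h | h <;> rw [h]
    · exact hP.parity y hy
    · rw [digitFlip_mod_two hH2, hP.parity y hy]
  · refine ⟨c y, inferInstance, hP' y hy, ?_⟩
    rw [hP' _ (hι.lt y hy)]
    have : min (M (ι y)) (M (ι (ι y))) < min (M (A (ι y))) (M (ι (A (ι y)))) ↔ c y := cι y hy
    simp only [digitSet, this]

/-- Positions `P ℓ y` of the tokens on the levels `ℓ ≤ d` of a butterfly network: from level `ℓ` to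
the next only the digit number `ℓ` of the block `P ℓ y / t` may change, and on the top level the two
tokens of each pair are in the same block. -/
structure Routing (d t N : ℕ) (ι : ℕ → ℕ) (P : ℕ → ℕ → ℕ) : Prop where
  placing : ∀ ℓ ≤ d, IsPlacing N (P ℓ)
  zero : ∀ y < N, P 0 y = y
  step : ∀ ℓ < d, ∀ y < N, P (ℓ + 1) y = P ℓ y ∨ P (ℓ + 1) y = digitFlip (t * 2 ^ ℓ) (P ℓ y)
  top : ∀ y < N, P d y / t % 2 ^ d = P d (ι y) / t % 2 ^ d

theorem Routing.succ {d t N : ℕ} {ι : ℕ → ℕ} {P : ℕ → ℕ → ℕ} (h : Routing d t N ι P) (ht : 0 < t)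
    (ht2 : t % 2 = 0) (hN : t * 2 ^ (d + 1) ∣ N) (hι : IsPairing N ι) {A M : ℕ → ℕ}
    (hA : ∀ y < N, A y < N ∧ P d (A y) = digitFlip (t * 2 ^ d) (P d y))
    (hM : ∀ y < N, (∃ j, M y = (fun u => ι (A (ι (A u))))^[j] y) ∧
      ∀ j ≤ N, M y ≤ (fun u => ι (A (ι (A u))))^[j] y)
    (hP : ∀ y < N, P (d + 1) y = digitSet (t * 2 ^ d)
      (min (M y) (M (ι y)) < min (M (A y)) (M (ι (A y)))) (P d y)) :
    Routing (d + 1) t N ι P := by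
  have hH : 0 < t * 2 ^ d := by positivity
  obtain ⟨h1, h2, h3⟩ := routing_step hH (by rw [Nat.mul_mod, ht2]; simp)
    (by rwa [show 2 * (t * 2 ^ d) = t * 2 ^ (d + 1) by ring]) (h.placing d le_rfl) hι hA hM hP
  refine ⟨fun ℓ hℓ => ?_, h.zero, fun ℓ hℓ y hy => ?_, fun y hy => ?_⟩
  · rcases Nat.le_succ_iff.mp hℓ with hl | rfl
    · exact h.placing ℓ hl
    · exact h1
  · rcases Nat.lt_succ_iff_lt_or_eq.mp hℓ with hl | rfl
    · exact h.step ℓ hl y hy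
    · exact h2 y hy
  · obtain ⟨c, _, e, e'⟩ := h3 y hy
    rw [e, e', digitSet_div_mod ht, digitSet_div_mod ht, h.top y hy]

/-- There are only `2 ^ d` blocks, so agreement in the `d` low digits is equality. -/
theorem Routing.top_eq {d t N : ℕ} {ι : ℕ → ℕ} {P : ℕ → ℕ → ℕ} (h : Routing d t N ι P)
    (hι : IsPairing N ι) (ht : 0 < t) (hN : N = t * 2 ^ d) {y : ℕ} (hy : y < N) :
    P d y / t = P d (ι y) / t := by
  have := h.top y hy
  have hlt : ∀ z < N, P d z / t < 2 ^ d := fun z hz => by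
    rw [Nat.div_lt_iff_lt_mul ht, mul_comm, ← hN]
    exact (h.placing d le_rfl).lt z hz
  rwa [Nat.mod_eq_of_lt (hlt y hy), Nat.mod_eq_of_lt (hlt _ (hι.lt y hy))] at this


/-! ## Linking the darts at each vertex in a cycle -/

section Darts

variable (vert : ℕ → ℕ)

/-- The last dart before `x` at the same vertex, or `x` if there is none. -/
def lastDart (x : ℕ) : ℕ := Nat.rec x (fun i r => if vert i = vert x then i else r) x

/-- The last clause is vacuous for the first dart at a vertex, which is its own `lastDart`; the swap
in `dartPairing` is then trivial. -/
theorem lastDart_spec (x : ℕ) :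
    lastDart vert x ≤ x ∧ vert (lastDart vert x) = vert x ∧
      ∀ i < x, vert i = vert x → i ≤ lastDart vert x ∧ lastDart vert x < x := by
  suffices H : ∀ j ≤ x, ∀ r, r = (Nat.rec x (fun i r => if vert i = vert x then i else r) j : ℕ) →
      r ≤ x ∧ vert r = vert x ∧ ∀ i < j, vert i = vert x → i ≤ r ∧ r < x from
    H x le_rfl _ rfl
  intro j
  induction j with
  | zero => rintro - r rfl; simp
  | succ j ih =>
    rintro hj r rfl
    obtain ⟨h1, h2, h3⟩ := ih (by omega) _ rfl
    by_cases hv : vert j = vert x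
    · simp only [hv, if_true, true_and]
      exact ⟨by omega, fun i hi _ => ⟨by omega, by omega⟩⟩
    · simp only [hv, if_false]
      refine ⟨h1, h2, fun i hi e => ?_⟩
      rcases Nat.lt_succ_iff_lt_or_eq.mp hi with hi' | rfl
      · exact h3 i hi' e
      · exact absurd e hv

/-- The pairing of the tokens `2 * x`, `2 * x + 1` of the darts, where the even token of each of the
first `M` darts is paired with the odd token of the next dart in a cyclic order of the darts at its
vertex. -/
def dartPairing : ℕ → Equiv.Perm ℕ
  | 0 => Function.Involutive.toPerm (digitFlip 1) (digitFlip_digitFlip one_pos)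
  | x + 1 => Equiv.swap (2 * lastDart vert x) (2 * x) * dartPairing x *
      Equiv.swap (2 * lastDart vert x) (2 * x)

theorem digitFlip_one_even (z : ℕ) : digitFlip 1 (2 * z) = 2 * z + 1 := by simp [digitFlip]

theorem digitFlip_one_odd (z : ℕ) : digitFlip 1 (2 * z + 1) = 2 * z := by
  rw [← digitFlip_one_even, digitFlip_digitFlip one_pos]

theorem dartPairing_invol (M y : ℕ) : dartPairing vert M (dartPairing vert M y) = y := by
  induction M generalizing y with
  | zero => exact digitFlip_digitFlip one_pos y
  | succ x ih => simp [dartPairing, ih]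

theorem swap_even_mod_two (a b y : ℕ) : Equiv.swap (2 * a) (2 * b) y % 2 = y % 2 := by
  rw [Equiv.swap_apply_def]
  split_ifs <;> omega

theorem dartPairing_parity (M y : ℕ) : dartPairing vert M y % 2 ≠ y % 2 := by
  induction M generalizing y with
  | zero => exact digitFlip_one_mod_two y
  | succ x ih =>
    simp only [dartPairing, Equiv.Perm.mul_apply, swap_even_mod_two]
    have := ih (Equiv.swap (2 * lastDart vert x) (2 * x) y)
    rwa [swap_even_mod_two] at this

theorem dartPairing_lt {M N : ℕ} (hN : N % 2 = 0) (hM : 2 * M ≤ N) {y : ℕ} (hy : y < N) :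
    dartPairing vert M y < N := by
  induction M generalizing y with
  | zero => exact digitFlip_lt one_pos (by omega) hy
  | succ x ih =>
    have hl := (lastDart_spec vert x).1
    have hs : ∀ y < N, Equiv.swap (2 * lastDart vert x) (2 * x) y < N := fun y hy => by
      rw [Equiv.swap_apply_def]; split_ifs <;> omega
    exact hs _ (ih (by omega) (hs _ hy))

theorem isPairing_dartPairing {M N : ℕ} (hN : N % 2 = 0) (hM : 2 * M ≤ N) :
    IsPairing N (dartPairing vert M) :=
  ⟨fun _ => dartPairing_lt vert hN hM, fun y _ => dartPairing_invol vert M y,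
    fun y _ => dartPairing_parity vert M y⟩

/-- A dart not yet processed is a cycle by itself. Therefore conjugating by the swap inserts `x`
behind its `lastDart` `l`: token `2 * l` gets the partner `2 * x + 1`, and `2 * x` takes over the
former partner of `2 * l`. -/
theorem dartPairing_of_le {M z : ℕ} (hz : M ≤ z) : dartPairing vert M (2 * z) = 2 * z + 1 := by
  induction M with
  | zero => exact digitFlip_one_even z
  | succ x ih =>
    have hl := (lastDart_spec vert x).1
    have e : Equiv.swap (2 * lastDart vert x) (2 * x) (2 * z) = 2 * z :=
      Equiv.swap_apply_of_ne_of_ne (by omega) (by omega)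
    rw [dartPairing, Equiv.Perm.mul_apply, Equiv.Perm.mul_apply, e, ih (by omega),
      Equiv.swap_apply_of_ne_of_ne (by omega) (by omega)]

theorem comp_swap_eq {A : Type*} {f : ℕ → A} {a b : ℕ} (h : f a = f b) (y : ℕ) :
    f (Equiv.swap a b y) = f y := by
  rw [Equiv.swap_apply_def]
  split_ifs with h1 h2
  · rw [h1, h]
  · rw [h2, h]
  · rfl

/-- A function of the tokens that is constant on the pairs, and on the two tokens of each dart, is
constant on the darts at each vertex. -/
theorem eq_of_dartPairing {A : Type*} {f : ℕ → A} (hf : ∀ z, f (2 * z) = f (2 * z + 1)) {M : ℕ}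
    (h : ∀ y, f (dartPairing vert M y) = f y) {x z : ℕ} (hx : x < M) (hz : z < M)
    (hv : vert x = vert z) : f (2 * x) = f (2 * z) := by
  have hlast : ∀ x < M, f (2 * lastDart vert x) = f (2 * x) := by
    clear hx hz hv x z
    induction M with
    | zero => simp
    | succ M ih =>
      -- The conjugated pairing joins `2 * lastDart vert M` with the odd token of dart `M`.
      have hl : f (2 * lastDart vert M) = f (2 * M) := by
        have h1 := h (2 * lastDart vert M)
        rw [dartPairing, Equiv.Perm.mul_apply, Equiv.Perm.mul_apply, Equiv.swap_apply_left,
          dartPairing_of_le vert le_rfl, Equiv.swap_apply_of_ne_of_ne (by omega) (by omega),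
          ← hf] at h1
        exact h1.symm
      -- By `hl` the swap does not affect `f`, so invariance passes to the pairing of the first `M`
      -- darts.
      have hM : ∀ y, f (dartPairing vert M y) = f y := fun y => by
        have := h (Equiv.swap (2 * lastDart vert M) (2 * M) y)
        rwa [dartPairing, Equiv.Perm.mul_apply, Equiv.Perm.mul_apply, Equiv.swap_apply_self,
          comp_swap_eq hl, comp_swap_eq hl] at this
      intro x hx
      rcases Nat.lt_succ_iff_lt_or_eq.mp hx with hx | rfl
      · exact ih hM x hx
      · exact hl
  clear h
  suffices H : ∀ x < M, ∀ z < x, vert z = vert x → f (2 * x) = f (2 * z) by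
    rcases lt_trichotomy x z with h | rfl | h
    · exact (H z hz x h hv).symm
    · rfl
    · exact H x hx z h hv.symm
  intro x
  induction x using Nat.strong_induction_on with
  | _ x ih =>
    intro hx z hz hv
    obtain ⟨-, h2, h3⟩ := lastDart_spec vert x
    obtain ⟨h4, h5⟩ := h3 z hz hv
    -- Descend from `x` through the earlier darts at its vertex until `z` is met.
    rw [← hlast x hx]
    rcases h4.lt_or_eq with h | rfl
    · exact ih _ h5 (by omega) z h (by rw [hv, h2])
    · rfl

theorem dartPairing_invariant {A : Type*} {f : ℕ → A} (hf : ∀ z, f (2 * z) = f (2 * z + 1)) {M : ℕ}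
    (h : ∀ x < M, ∀ z < M, vert x = vert z → f (2 * x) = f (2 * z)) (y : ℕ) :
    f (dartPairing vert M y) = f y := by
  induction M generalizing y with
  | zero =>
    change f (digitFlip 1 y) = f y
    obtain ⟨z, rfl | rfl⟩ := Nat.even_or_odd' y
    · rw [digitFlip_one_even, hf]
    · rw [digitFlip_one_odd, hf]
  | succ M ih =>
    obtain ⟨h1, h2, -⟩ := lastDart_spec vert M
    have hl : f (2 * lastDart vert M) = f (2 * M) := h _ (by omega) _ (by omega) h2
    rw [dartPairing, Equiv.Perm.mul_apply, Equiv.Perm.mul_apply, comp_swap_eq hl,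
      ih (fun x hx z hz => h x (by omega) z (by omega)), comp_swap_eq hl]

/-- How to update a table of the pairing when a dart is added. -/
theorem update_dartPairing {N x : ℕ} (hx : 2 * x < N) {a : ℕ → ℕ}
    (ha : ∀ y < N, a y = dartPairing vert x y) {y : ℕ} (hy : y < N) :
    Function.update (Function.update (Function.update (Function.update a (2 * x)
      (a (2 * lastDart vert x))) (2 * lastDart vert x) (a (2 * x))) (a (2 * lastDart vert x))
      (2 * x)) (a (2 * x)) (2 * lastDart vert x) y = dartPairing vert (x + 1) y := by
  have hl := (lastDart_spec vert x).1
  set l := lastDart vert x with hl'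
  rw [ha (2 * l) (by omega), ha (2 * x) hx, dartPairing, Equiv.Perm.mul_apply,
    Equiv.Perm.mul_apply, ← hl']
  have p1 := dartPairing_parity vert x (2 * l)
  have p2 := dartPairing_parity vert x (2 * x)
  have i1 := dartPairing_invol vert x (2 * l)
  have i2 := dartPairing_invol vert x (2 * x)
  have i3 := dartPairing_invol vert x y
  have ha := ha y hy
  have hinj : ∀ z, dartPairing vert x z = dartPairing vert x y ↔ z = y := fun z =>
    (dartPairing vert x).apply_eq_iff_eq
  have e1 := hinj (2 * l)
  have e2 := hinj (2 * x)
  simp only [Function.update_apply, Equiv.swap_apply_def]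
  generalize dartPairing vert x = ι at *
  -- Later writes prevail, so the cases go from the outermost update inwards.
  by_cases c1 : y = ι (2 * x)
  · subst c1
    simp only [if_true, if_neg (show ¬ ι (2 * x) = 2 * l by omega),
      if_neg (show ¬ ι (2 * x) = 2 * x by omega), i2]
    split_ifs <;> omega
  rw [if_neg c1]
  by_cases c2 : y = ι (2 * l)
  · subst c2
    simp only [if_true, if_neg (show ¬ ι (2 * l) = 2 * l by omega),
      if_neg (show ¬ ι (2 * l) = 2 * x by omega), i1]
  rw [if_neg c2]
  by_cases c3 : y = 2 * l
  · subst c3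
    simp only [if_true]
    rw [if_neg (by omega), if_neg (by omega)]
  by_cases c4 : y = 2 * x
  · subst c4
    simp only [if_neg c3, if_true]
    rw [if_neg (by omega), if_neg (by omega)]
  simp only [if_neg c3, if_neg c4, ha]
  rw [if_neg (fun h => c2 (by rw [← h, i3])), if_neg (fun h => c1 (by rw [← h, i3]))]

end Darts


/-! ## The instance built from a routing -/

/-- The number of the pair of variables of type `f < 4` on level `ℓ ≤ d` in block `b < Q`. -/
def pairIdx (d Q f ℓ b : ℕ) : ℕ := (f * (d + 1) + ℓ) * Q + b

theorem pairIdx_mod {d Q f ℓ b : ℕ} (hb : b < Q) : pairIdx d Q f ℓ b % Q = b := by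
  rw [pairIdx, mul_comm, Nat.mul_add_mod, Nat.mod_eq_of_lt hb]

theorem pairIdx_div {d Q f ℓ b : ℕ} (hb : b < Q) : pairIdx d Q f ℓ b / Q = f * (d + 1) + ℓ := by
  rw [pairIdx, mul_comm, Nat.mul_add_div (by omega), Nat.div_eq_of_lt hb, add_zero]

theorem pairIdx_div_mod {d Q f ℓ b : ℕ} (hb : b < Q) (hℓ : ℓ ≤ d) :
    pairIdx d Q f ℓ b / Q % (d + 1) = ℓ := by
  rw [pairIdx_div hb, mul_comm, Nat.mul_add_mod, Nat.mod_eq_of_lt (by omega)]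

theorem pairIdx_div_div {d Q f ℓ b : ℕ} (hb : b < Q) (hℓ : ℓ ≤ d) :
    pairIdx d Q f ℓ b / Q / (d + 1) = f := by
  rw [pairIdx_div hb, mul_comm, Nat.mul_add_div (by omega), Nat.div_eq_of_lt (by omega), add_zero]

theorem pairIdx_lt {d Q f ℓ b : ℕ} (hb : b < Q) (hℓ : ℓ ≤ d) (hf : f < 4) :
    pairIdx d Q f ℓ b < 4 * (d + 1) * Q := by
  have h1 : f * (d + 1) + ℓ + 1 ≤ 4 * (d + 1) := by
    have := Nat.mul_le_mul_right (d + 1) (show f + 1 ≤ 4 from hf)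
    rw [add_mul] at this; omega
  have := Nat.mul_le_mul_right Q h1
  rw [pairIdx]
  rw [add_mul (f * (d + 1) + ℓ)] at this
  omega

/-- The parallel constraints: codes of the two endpoints, and whether the sub-constraint is that of
a colouring (and not equality). -/
def conList (d Q : ℕ) : List (ℕ × ℕ × Bool) :=
  ((List.range d).flatMap fun ℓ => (List.range Q).flatMap fun b =>
    [(pairIdx d Q 0 ℓ b, pairIdx d Q 1 ℓ b, false),
      (pairIdx d Q 2 ℓ b, pairIdx d Q 3 ℓ b, false),
      (pairIdx d Q 2 ℓ b, pairIdx d Q 0 (ℓ + 1) b, false),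
      (4 * (d + 1) * Q + pairIdx d Q 0 ℓ b, 4 * (d + 1) * Q + pairIdx d Q 2 ℓ b, false),
      (4 * (d + 1) * Q + pairIdx d Q 1 ℓ b,
        4 * (d + 1) * Q + pairIdx d Q 3 ℓ (digitFlip (2 ^ ℓ) b), false)]) ++
  (List.range Q).flatMap fun b =>
    [(pairIdx d Q 0 d b, 4 * (d + 1) * Q + pairIdx d Q 0 d b, false),
      (pairIdx d Q 1 d b, pairIdx d Q 0 0 b, false),
      (pairIdx d Q 2 d b, pairIdx d Q 0 0 b, false),
      (pairIdx d Q 1 d b, 4 * (d + 1) * Q + pairIdx d Q 1 d b, false),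
      (pairIdx d Q 2 d b, 4 * (d + 1) * Q + pairIdx d Q 2 d b, true)]

theorem length_conList (d Q : ℕ) : (conList d Q).length = 5 * (d + 1) * Q := by
  simp [conList, List.length_flatMap]
  ring

theorem forall_mem_conList {d Q : ℕ} {φ : ℕ × ℕ × Bool → Prop} : (∀ c ∈ conList d Q, φ c) ↔
    (∀ ℓ < d, ∀ b < Q, φ (pairIdx d Q 0 ℓ b, pairIdx d Q 1 ℓ b, false) ∧
      φ (pairIdx d Q 2 ℓ b, pairIdx d Q 3 ℓ b, false) ∧
      φ (pairIdx d Q 2 ℓ b, pairIdx d Q 0 (ℓ + 1) b, false) ∧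
      φ (4 * (d + 1) * Q + pairIdx d Q 0 ℓ b, 4 * (d + 1) * Q + pairIdx d Q 2 ℓ b, false) ∧
      φ (4 * (d + 1) * Q + pairIdx d Q 1 ℓ b,
        4 * (d + 1) * Q + pairIdx d Q 3 ℓ (digitFlip (2 ^ ℓ) b), false)) ∧
    ∀ b < Q, φ (pairIdx d Q 0 d b, 4 * (d + 1) * Q + pairIdx d Q 0 d b, false) ∧
      φ (pairIdx d Q 1 d b, pairIdx d Q 0 0 b, false) ∧
      φ (pairIdx d Q 2 d b, pairIdx d Q 0 0 b, false) ∧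
      φ (pairIdx d Q 1 d b, 4 * (d + 1) * Q + pairIdx d Q 1 d b, false) ∧
      φ (pairIdx d Q 2 d b, 4 * (d + 1) * Q + pairIdx d Q 2 d b, true) := by
  simp only [conList, List.forall_mem_append, List.forall_mem_flatMap, List.mem_range,
    List.forall_mem_cons, List.not_mem_nil, false_imp_iff, implies_true, and_true]

/-- The variable with a given code: `x_c` for `c < K`, and `y_{c - K}` otherwise. -/
def codeVar {K : ℕ} (hK : 0 < K) (c : ℕ) : Fin K ⊕ Fin K :=
  if c < K then .inl ⟨c % K, Nat.mod_lt _ hK⟩ else .inr ⟨(c - K) % K, Nat.mod_lt _ hK⟩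

theorem codeVar_of_lt {K : ℕ} (hK : 0 < K) {c : ℕ} (hc : c < K) : codeVar hK c = .inl ⟨c, hc⟩ := by
  simp [codeVar, hc, Nat.mod_eq_of_lt hc]

theorem codeVar_add {K : ℕ} (hK : 0 < K) {c : ℕ} (hc : c < K) :
    codeVar hK (K + c) = .inr ⟨c, hc⟩ := by
  simp [codeVar, Nat.mod_eq_of_lt hc]

theorem elim_codeVar {K : ℕ} (hK : 0 < K) {c : ℕ} (hc : c < 2 * K) :
    Sum.elim (fun i : Fin K => (i : ℕ)) (fun i : Fin K => K + (i : ℕ)) (codeVar hK c) = c := by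
  rcases lt_or_ge c K with h | h
  · rw [codeVar_of_lt hK h]; rfl
  · obtain ⟨c, rfl⟩ := Nat.exists_eq_add_of_le h
    rw [codeVar_add hK (by omega)]; rfl

/-- The two ends of every parallel constraint differ in their type or in being an `x` or a `y`, so
they are distinct variables. -/
theorem conList_spec {d Q : ℕ} (hQ : Q = 2 ^ d) {c : ℕ × ℕ × Bool} (hc : c ∈ conList d Q) :
    c.1 < 2 * (4 * (d + 1) * Q) ∧ c.2.1 < 2 * (4 * (d + 1) * Q) ∧ c.1 ≠ c.2.1 := by
  revert c
  have lt : ∀ {f ℓ b}, f < 4 → ℓ ≤ d → b < Q → pairIdx d Q f ℓ b < 4 * (d + 1) * Q :=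
    fun hf hℓ hb => pairIdx_lt hb hℓ hf
  have ne : ∀ {f ℓ b f' ℓ' b'}, f ≠ f' → ℓ ≤ d → b < Q → ℓ' ≤ d → b' < Q →
      pairIdx d Q f ℓ b ≠ pairIdx d Q f' ℓ' b' := fun hf hℓ hb hℓ' hb' h => by
    have h1 := congrArg (· / Q / (d + 1)) h
    simp only [pairIdx_div_div hb hℓ, pairIdx_div_div hb' hℓ'] at h1
    exact hf h1
  rw [forall_mem_conList]
  constructor
  · intro ℓ hℓ b hb
    have hflip : digitFlip (2 ^ ℓ) b < Q := digitFlip_lt (by positivity) (by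
      rw [hQ, ← pow_succ']; exact pow_dvd_pow 2 hℓ) hb
    have h0 := lt (f := 0) (by omega) hℓ.le hb
    have h0' := lt (f := 0) (by omega) (show ℓ + 1 ≤ d from hℓ) hb
    have h1 := lt (f := 1) (by omega) hℓ.le hb
    have h2 := lt (f := 2) (by omega) hℓ.le hb
    have h3 := lt (f := 3) (by omega) hℓ.le hb
    have h3' := lt (f := 3) (by omega) hℓ.le hflip
    have n1 := ne (show 0 ≠ 1 by omega) hℓ.le hb hℓ.le hb
    have n2 := ne (show 2 ≠ 3 by omega) hℓ.le hb hℓ.le hb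
    have n3 := ne (show 2 ≠ 0 by omega) hℓ.le hb (show ℓ + 1 ≤ d from hℓ) hb
    have n4 := ne (show 0 ≠ 2 by omega) hℓ.le hb hℓ.le hb
    have n5 := ne (show 1 ≠ 3 by omega) hℓ.le hb hℓ.le hflip
    refine ⟨⟨?_, ?_, ?_⟩, ⟨?_, ?_, ?_⟩, ⟨?_, ?_, ?_⟩, ⟨?_, ?_, ?_⟩, ?_, ?_, ?_⟩ <;>
      dsimp only <;> omega
  · intro b hb
    have h0 := lt (f := 0) (by omega) le_rfl hb
    have h0' := lt (f := 0) (by omega) d.zero_le hb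
    have h1 := lt (f := 1) (by omega) le_rfl hb
    have h2 := lt (f := 2) (by omega) le_rfl hb
    have n1 := ne (show 1 ≠ 0 by omega) le_rfl hb d.zero_le hb
    have n2 := ne (show 2 ≠ 0 by omega) le_rfl hb d.zero_le hb
    refine ⟨⟨?_, ?_, ?_⟩, ⟨?_, ?_, ?_⟩, ⟨?_, ?_, ?_⟩, ⟨?_, ?_, ?_⟩, ?_, ?_, ?_⟩ <;>
      dsimp only <;> omega

open Classical in
/-- The two kinds of sub-constraints: equality, and being different colours of `Λ`. -/
noncomputable def subTable (Λ : Finset F4) (colour : Bool) (a b : F4) : Bool :=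
  if colour then decide (a ∈ Λ ∧ b ∈ Λ ∧ a ≠ b) else decide (a = b)

theorem subTable_false {Λ : Finset F4} {a b : F4} : subTable Λ false a b = true ↔ a = b := by
  simp [subTable]

theorem subTable_true {Λ : Finset F4} {a b : F4} :
    subTable Λ true a b = true ↔ a ∈ Λ ∧ b ∈ Λ ∧ a ≠ b := by
  simp [subTable]

/-- The matrix number `i` of the instance below. -/
noncomputable def routingMatrix (d Q t : ℕ) (g : ℕ → ℕ → ℕ → ℕ) (i : ℕ) : Matrix (Fin t) (Fin t) F4 :=
  Matrix.of fun r s =>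
    if g (i / Q / (d + 1)) (i / Q % (d + 1)) (i % Q * t + r) = i % Q * t + s + 1 then 1 else 0

/-- The instance with blocks of `t` coordinates in which the row `p % t` of the matrix of the pair
of type `f` on level `ℓ` in block `p / t` selects the coordinate at position `g f ℓ p - 1`. -/
noncomputable def routingInstance (d Q t : ℕ) (hQ : Q = 2 ^ d) (g : ℕ → ℕ → ℕ → ℕ)
    (Λ : Finset F4) : SVecCSP F4 where
  k := 4 * (d + 1) * Q
  k_pos := by rw [hQ]; positivity
  t := t
  p := (conList d Q).length
  src c := codeVar (by rw [hQ]; positivity) (conList d Q)[c].1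
  tgt c := codeVar (by rw [hQ]; positivity) (conList d Q)[c].2.1
  src_ne_tgt c h := by
    obtain ⟨h1, h2, h3⟩ := conList_spec hQ (List.getElem_mem c.2)
    have hK : 0 < 4 * (d + 1) * Q := by rw [hQ]; positivity
    have h' : codeVar hK (conList d Q)[c].1 = codeVar hK (conList d Q)[c].2.1 := h
    have e1 := elim_codeVar hK h1
    have e2 := elim_codeVar hK h2
    exact h3 (e1.symm.trans ((congrArg (Sum.elim _ _) h').trans e2))
  sub c := subTable Λ (conList d Q)[c].2.2
  mat i := routingMatrix d Q t g i

theorem routingInstance_satisfiable_iff {d Q t : ℕ} {hQ : Q = 2 ^ d} {g : ℕ → ℕ → ℕ → ℕ}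
    {Λ : Finset F4} (hK : 0 < 4 * (d + 1) * Q) :
    (routingInstance d Q t hQ g Λ).toCSP.Satisfiable ↔
      ∃ σ : Fin (4 * (d + 1) * Q) ⊕ Fin (4 * (d + 1) * Q) → Fin t → F4,
        (∀ c ∈ conList d Q, ∀ j, subTable Λ c.2.2 (σ (codeVar hK c.1) j)
          (σ (codeVar hK c.2.1) j) = true) ∧
        ∀ i, σ (.inr i) = (routingMatrix d Q t g i).mulVec (σ (.inl i)) := by
  have : Nonempty (routingInstance d Q t hQ g Λ).Con := ⟨.inr ⟨0, hK⟩⟩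
  refine exists_congr fun σ => ?_
  rw [CSP.isSolution_iff, Sum.forall]
  refine and_congr ⟨fun h c hc j => ?_, fun h c j => ?_⟩ Iff.rfl
  · obtain ⟨i, hi, rfl⟩ := List.getElem_of_mem hc
    exact h ⟨i, hi⟩ j
  · exact h _ (List.getElem_mem c.2) j

/-- A row has at most one nonzero entry, because `base + s + 1` determines `s`. The shift by one
makes `G = 0` stand for the zero row. -/
theorem selection_mulVec {t : ℕ} {G base : ℕ} (v : Fin t → F4) {a : F4}
    (h0 : (∀ s : Fin t, G ≠ base + s + 1) → a = 0)
    (h1 : ∀ s : Fin t, G = base + s + 1 → a = v s) :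
    ∑ s : Fin t, (if G = base + s + 1 then 1 else 0) * v s = a := by
  by_cases h : ∃ s : Fin t, G = base + s + 1
  · obtain ⟨s, hs⟩ := h
    rw [h1 s hs, Finset.sum_eq_single s]
    · simp [hs]
    · intro s' _ hne
      rw [if_neg, zero_mul]
      intro h
      exact hne (Fin.ext (by omega))
    · simp
  · push Not at h
    rw [h0 h, Finset.sum_eq_zero]
    intro s _
    rw [if_neg (h s), zero_mul]

/-- An assignment of the instance, read as values at the positions `p < N`. -/
structure NetSat (d t N : ℕ) (g : ℕ → ℕ → ℕ → ℕ) (Λ : Finset F4) (x y : ℕ → ℕ → ℕ → F4) :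
    Prop where
  copy₀₁ : ∀ ℓ < d, ∀ p < N, x 0 ℓ p = x 1 ℓ p
  copy₂₃ : ∀ ℓ < d, ∀ p < N, x 2 ℓ p = x 3 ℓ p
  up : ∀ ℓ < d, ∀ p < N, x 2 ℓ p = x 0 (ℓ + 1) p
  straight : ∀ ℓ < d, ∀ p < N, y 0 ℓ p = y 2 ℓ p
  cross : ∀ ℓ < d, ∀ p < N, y 1 ℓ p = y 3 ℓ (digitFlip (t * 2 ^ ℓ) p)
  top : ∀ p < N, x 0 d p = y 0 d p
  bottom₁ : ∀ p < N, x 1 d p = x 0 0 p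
  bottom₂ : ∀ p < N, x 2 d p = x 0 0 p
  side : ∀ p < N, x 1 d p = y 1 d p
  colour : ∀ p < N, x 2 d p ∈ Λ ∧ y 2 d p ∈ Λ ∧ x 2 d p ≠ y 2 d p
  none : ∀ f < 4, ∀ ℓ ≤ d, ∀ p < N, g f ℓ p = 0 → y f ℓ p = 0
  some : ∀ f < 4, ∀ ℓ ≤ d, ∀ p < N, ∀ q, q / t = p / t → g f ℓ p = q + 1 → y f ℓ p = x f ℓ q

/-! ### Assignments as values at network positions -/

section

variable {d Q t N : ℕ} {hQ : Q = 2 ^ d} {g : ℕ → ℕ → ℕ → ℕ} {Λ : Finset F4}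

theorem routingMatrix_mulVec {f ℓ b : ℕ} (hb : b < Q) (hℓ : ℓ ≤ d) (v : Fin t → F4)
    (r : Fin t) : (routingMatrix d Q t g (pairIdx d Q f ℓ b)).mulVec v r =
      ∑ s : Fin t, (if g f ℓ (b * t + r) = b * t + s + 1 then 1 else 0) * v s := by
  change ∑ s : Fin t, (if g (pairIdx d Q f ℓ b / Q / (d + 1)) (pairIdx d Q f ℓ b / Q % (d + 1))
    (pairIdx d Q f ℓ b % Q * t + r) = pairIdx d Q f ℓ b % Q * t + s + 1 then 1 else 0) * v s = _
  rw [pairIdx_mod hb, pairIdx_div_mod hb hℓ, pairIdx_div_div hb hℓ]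

/-- Position `p` is coordinate `p % t` of block `p / t`. The crossing constraint between blocks
becomes `cross` because flipping a block digit keeps the offset. -/
theorem exists_netSat (ht : 0 < t) (hN : N = t * Q)
    (h : (routingInstance d Q t hQ g Λ).toCSP.Satisfiable) : ∃ x y, NetSat d t N g Λ x y := by
  have hK : 0 < 4 * (d + 1) * Q := by rw [hQ]; positivity
  obtain ⟨σ, hσ, hl⟩ := (routingInstance_satisfiable_iff hK).mp h
  rw [forall_mem_conList] at hσ
  simp only [subTable_true, subTable_false] at hσ
  obtain ⟨h1, h2⟩ := hσ
  have hb : ∀ p < N, p / t < Q := fun p hp => by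
    rw [Nat.div_lt_iff_lt_mul ht, mul_comm, ← hN]; exact hp
  refine ⟨fun f ℓ p => σ (codeVar hK (pairIdx d Q f ℓ (p / t))) ⟨p % t, Nat.mod_lt _ ht⟩,
    fun f ℓ p => σ (codeVar hK (4 * (d + 1) * Q + pairIdx d Q f ℓ (p / t)))
      ⟨p % t, Nat.mod_lt _ ht⟩, ?_⟩
  constructor
  · exact fun ℓ hℓ p hp => (h1 ℓ hℓ _ (hb p hp)).1 _
  · exact fun ℓ hℓ p hp => (h1 ℓ hℓ _ (hb p hp)).2.1 _
  · exact fun ℓ hℓ p hp => (h1 ℓ hℓ _ (hb p hp)).2.2.1 _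
  · exact fun ℓ hℓ p hp => (h1 ℓ hℓ _ (hb p hp)).2.2.2.1 _
  · intro ℓ hℓ p hp
    simp only [digitFlip_mul_div ht, digitFlip_mul_mod (show 0 < t * 2 ^ ℓ by positivity)]
    exact (h1 ℓ hℓ _ (hb p hp)).2.2.2.2 _
  · exact fun p hp => (h2 _ (hb p hp)).1 _
  · exact fun p hp => (h2 _ (hb p hp)).2.1 _
  · exact fun p hp => (h2 _ (hb p hp)).2.2.1 _
  · exact fun p hp => (h2 _ (hb p hp)).2.2.2.1 _
  · exact fun p hp => (h2 _ (hb p hp)).2.2.2.2 _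
  · intro f hf ℓ hℓ p hp hg
    have hlt := pairIdx_lt (hb p hp) hℓ hf
    rw [codeVar_add hK hlt, hl, routingMatrix_mulVec (hb p hp) hℓ]
    have hp' : p / t * t + p % t = p := Nat.div_add_mod' p t
    apply selection_mulVec
    · exact fun _ => rfl
    · intro s hs
      simp only [hp', hg] at hs
      omega
  · intro f hf ℓ hℓ p hp q hq hg
    have hlt := pairIdx_lt (hb p hp) hℓ hf
    have hp' : p / t * t + p % t = p := Nat.div_add_mod' p t
    have hq' : p / t * t + q % t = q := by rw [← hq]; exact Nat.div_add_mod' q t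
    simp only [hq, codeVar_of_lt hK hlt]
    rw [codeVar_add hK hlt, hl, routingMatrix_mulVec (hb p hp) hℓ]
    apply selection_mulVec
    · intro h
      refine absurd ?_ (h ⟨q % t, Nat.mod_lt _ ht⟩)
      simp only [hp', hg]
      omega
    · intro s hs
      simp only [hp', hg] at hs
      have : q % t = s := by omega
      congr 1
      exact Fin.ext this

/-- `NetSat` determines `y` only where `g` is zero or points into the same block; `hg` says that
this covers every row. -/
theorem satisfiable_of_netSat (ht : 0 < t) (hN : N = t * Q) {x y : ℕ → ℕ → ℕ → F4}
    (h : NetSat d t N g Λ x y) (hg : ∀ f < 4, ∀ ℓ ≤ d, ∀ p < N, g f ℓ p = 0 ∨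
      ∃ q, q / t = p / t ∧ g f ℓ p = q + 1) :
    (routingInstance d Q t hQ g Λ).toCSP.Satisfiable := by
  have hK : 0 < 4 * (d + 1) * Q := by rw [hQ]; positivity
  have hQ0 : 0 < Q := by rw [hQ]; positivity
  rw [routingInstance_satisfiable_iff hK]
  let val : (ℕ → ℕ → ℕ → F4) → Fin (4 * (d + 1) * Q) → Fin t → F4 := fun x i j =>
    x (i / Q / (d + 1)) (i / Q % (d + 1)) (i % Q * t + j)
  let σ : Fin (4 * (d + 1) * Q) ⊕ Fin (4 * (d + 1) * Q) → Fin t → F4 := Sum.elim (val x) (val y)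
  have hx : ∀ {f ℓ b}, f < 4 → ℓ ≤ d → b < Q → ∀ j : Fin t,
      σ (codeVar hK (pairIdx d Q f ℓ b)) j = x f ℓ (b * t + j) := fun hf hℓ hb j => by
    rw [codeVar_of_lt hK (pairIdx_lt hb hℓ hf)]
    simp only [σ, val, Sum.elim_inl, pairIdx_mod hb, pairIdx_div_mod hb hℓ, pairIdx_div_div hb hℓ]
  have hy : ∀ {f ℓ b}, f < 4 → ℓ ≤ d → b < Q → ∀ j : Fin t,
      σ (codeVar hK (4 * (d + 1) * Q + pairIdx d Q f ℓ b)) j = y f ℓ (b * t + j) :=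
    fun hf hℓ hb j => by
    rw [codeVar_add hK (pairIdx_lt hb hℓ hf)]
    simp only [σ, val, Sum.elim_inr, pairIdx_mod hb, pairIdx_div_mod hb hℓ, pairIdx_div_div hb hℓ]
  have hp : ∀ {b}, b < Q → ∀ j : Fin t, b * t + j < N := fun {b} hb j => by
    have := Nat.mul_le_mul_left t (show b + 1 ≤ Q from hb)
    rw [hN]
    have := j.2
    nlinarith
  refine ⟨σ, ?_, fun i => ?_⟩
  · rw [forall_mem_conList]
    simp only [subTable_true, subTable_false]
    constructor
    · intro ℓ hℓ b hb
      have hflip : digitFlip (2 ^ ℓ) b < Q := digitFlip_lt (by positivity) (by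
        rw [hQ, ← pow_succ']; exact pow_dvd_pow 2 hℓ) hb
      refine ⟨fun j => ?_, fun j => ?_, fun j => ?_, fun j => ?_, fun j => ?_⟩
      · rw [hx (by omega) hℓ.le hb, hx (by omega) hℓ.le hb, h.copy₀₁ ℓ hℓ _ (hp hb j)]
      · rw [hx (by omega) hℓ.le hb, hx (by omega) hℓ.le hb, h.copy₂₃ ℓ hℓ _ (hp hb j)]
      · rw [hx (by omega) hℓ.le hb, hx (by omega) hℓ hb, h.up ℓ hℓ _ (hp hb j)]
      · rw [hy (by omega) hℓ.le hb, hy (by omega) hℓ.le hb, h.straight ℓ hℓ _ (hp hb j)]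
      · rw [hy (by omega) hℓ.le hb, hy (by omega) hℓ.le hflip, h.cross ℓ hℓ _ (hp hb j)]
        congr 1
        have e1 := digitFlip_mul_div ht (H := 2 ^ ℓ) (b * t + j)
        have e2 := digitFlip_mul_mod (t := t) (H := 2 ^ ℓ) (by positivity) (b * t + j)
        rw [mul_comm b t, Nat.mul_add_div ht, Nat.div_eq_of_lt j.2, add_zero] at e1
        rw [mul_comm b t, Nat.mul_add_mod, Nat.mod_eq_of_lt j.2] at e2
        rw [mul_comm b t, ← Nat.div_add_mod (digitFlip (t * 2 ^ ℓ) (t * b + j)) t, e1, e2, mul_comm]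
    · intro b hb
      have h0 := d.zero_le
      refine ⟨fun j => ?_, fun j => ?_, fun j => ?_, fun j => ?_, fun j => ?_⟩
      · rw [hx (by omega) le_rfl hb, hy (by omega) le_rfl hb, h.top _ (hp hb j)]
      · rw [hx (by omega) le_rfl hb, hx (by omega) h0 hb, h.bottom₁ _ (hp hb j)]
      · rw [hx (by omega) le_rfl hb, hx (by omega) h0 hb, h.bottom₂ _ (hp hb j)]
      · rw [hx (by omega) le_rfl hb, hy (by omega) le_rfl hb, h.side _ (hp hb j)]
      · rw [hx (by omega) le_rfl hb, hy (by omega) le_rfl hb]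
        exact h.colour _ (hp hb j)
  · funext r
    have hb : (i : ℕ) % Q < Q := Nat.mod_lt _ hQ0
    have hℓ : (i : ℕ) / Q % (d + 1) < d + 1 := Nat.mod_lt _ (by omega)
    have hf : (i : ℕ) / Q / (d + 1) < 4 := by
      rw [Nat.div_lt_iff_lt_mul (by omega), Nat.div_lt_iff_lt_mul hQ0]
      exact i.2
    have hpr := hp hb r
    have hdiv : ∀ s : Fin t, ((i : ℕ) % Q * t + s) / t = i % Q := fun s => by
      rw [mul_comm, Nat.mul_add_div ht, Nat.div_eq_of_lt s.2, add_zero]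
    symm
    refine selection_mulVec (σ (.inl i)) (fun hne => ?_) (fun s hs => ?_)
    · rcases hg _ hf _ (Nat.lt_succ_iff.mp hℓ) _ hpr with h0 | ⟨q, hq, e⟩
      · exact h.none _ hf _ (Nat.lt_succ_iff.mp hℓ) _ hpr h0
      · rw [hdiv r] at hq
        refine absurd ?_ (hne ⟨q % t, Nat.mod_lt _ ht⟩)
        rw [e, ← hq, Nat.div_add_mod' q t]
    · exact h.some _ hf _ (Nat.lt_succ_iff.mp hℓ) _ hpr _ (by rw [hdiv, hdiv]) hs

end


/-- What the program computes from a routing: on a level `ℓ < d` the pairs of types `0` and `2`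
select the tokens that stay in their block, and the pairs of types `1` and `3` those that move. -/
structure IsSelector (d t N : ℕ) (ι : ℕ → ℕ) (P : ℕ → ℕ → ℕ) (g : ℕ → ℕ → ℕ → ℕ) : Prop where
  stay₀ : ∀ ℓ < d, ∀ y < N, g 0 ℓ (P ℓ y) = if P (ℓ + 1) y = P ℓ y then P ℓ y + 1 else 0
  move₁ : ∀ ℓ < d, ∀ y < N, g 1 ℓ (P ℓ y) = if P (ℓ + 1) y = P ℓ y then 0 else P ℓ y + 1
  stay₂ : ∀ ℓ < d, ∀ y < N,
    g 2 ℓ (P (ℓ + 1) y) = if P (ℓ + 1) y = P ℓ y then P (ℓ + 1) y + 1 else 0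
  move₃ : ∀ ℓ < d, ∀ y < N,
    g 3 ℓ (P (ℓ + 1) y) = if P (ℓ + 1) y = P ℓ y then 0 else P (ℓ + 1) y + 1
  top : ∀ y < N, g 0 d (P d y) = P d (ι y) + 1
  side : ∀ p < N, g 1 d p = digitFlip 1 p + 1
  colour : ∀ p < N, g 2 d p = digitFlip 2 p + 1
  rest : ∀ p < N, g 3 d p = 0

/-! ### Satisfying assignments and colourings of the tokens -/

section

variable {d t N Q : ℕ} {ι : ℕ → ℕ} {P : ℕ → ℕ → ℕ} {g : ℕ → ℕ → ℕ → ℕ} {Λ : Finset F4}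

/-- Used for `H = 1` and `H = 2`: since `4 ∣ t`, the four tokens of a constraint lie in one block,
where a single matrix can compare them. -/
theorem digitFlip_div_of_dvd {H : ℕ} (hH : 0 < H) (ht : 0 < t) (h : 2 * H ∣ t) (p : ℕ) :
    digitFlip H p / t = p / t := by
  have e : digitFlip H p / (2 * H) = p / (2 * H) := by
    obtain ⟨q, b, r, hr, hb, rfl⟩ := exists_digit hH p
    rw [digitFlip_eq hr hb, add_assoc, add_assoc, Nat.mul_add_div (by omega),
      Nat.mul_add_div (by omega)]
    interval_cases b
    · rw [Nat.div_eq_of_lt (by omega), Nat.div_eq_of_lt (by omega)]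
    · rw [Nat.div_eq_of_lt (by omega), Nat.div_eq_of_lt (by omega)]
  obtain ⟨m, rfl⟩ := h
  rw [← Nat.div_div_eq_div_mul, e, Nat.div_div_eq_div_mul]

namespace IsSelector

theorem valid (hg : IsSelector d t N ι P g) (hι : IsPairing N ι) (hP : Routing d t N ι P)
    (ht : 0 < t) (ht4 : 4 ∣ t) (hN : N = t * 2 ^ d) : ∀ f < 4, ∀ ℓ ≤ d, ∀ p < N, g f ℓ p = 0 ∨
      ∃ q, q / t = p / t ∧ g f ℓ p = q + 1 := by
  intro f hf ℓ hℓ p hp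
  rcases hℓ.lt_or_eq with hℓ | rfl
  · obtain ⟨y, hy, rfl⟩ := (hP.placing ℓ hℓ.le).surj hp
    obtain ⟨z, hz, hzp⟩ := (hP.placing (ℓ + 1) hℓ).surj hp
    interval_cases f
    · rw [hg.stay₀ ℓ hℓ y hy]
      split_ifs
      · exact .inr ⟨_, rfl, rfl⟩
      · exact .inl rfl
    · rw [hg.move₁ ℓ hℓ y hy]
      split_ifs
      · exact .inl rfl
      · exact .inr ⟨_, rfl, rfl⟩
    · rw [← hzp, hg.stay₂ ℓ hℓ z hz]
      split_ifs
      · exact .inr ⟨_, rfl, rfl⟩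
      · exact .inl rfl
    · rw [← hzp, hg.move₃ ℓ hℓ z hz]
      split_ifs
      · exact .inl rfl
      · exact .inr ⟨_, rfl, rfl⟩
  · interval_cases f
    · obtain ⟨y, hy, rfl⟩ := (hP.placing ℓ le_rfl).surj hp
      exact .inr ⟨_, (hP.top_eq hι ht hN hy).symm, hg.top y hy⟩
    · exact .inr ⟨_, digitFlip_div_of_dvd one_pos ht (by omega) p, hg.side p hp⟩
    · exact .inr ⟨_, digitFlip_div_of_dvd two_pos ht (by omega) p, hg.colour p hp⟩
    · exact .inl (hg.rest p hp)

end IsSelector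

/-- A colouring of the tokens that is constant on pairs and on darts, and proper on edges. -/
structure TokenColouring (N : ℕ) (ι : ℕ → ℕ) (Λ : Finset F4) (f : ℕ → F4) : Prop where
  side : ∀ z, f (2 * z) = f (2 * z + 1)
  pair : ∀ y, f (ι y) = f y
  colour : ∀ p < N, f p ∈ Λ ∧ f (digitFlip 2 p) ∈ Λ ∧ f p ≠ f (digitFlip 2 p)

/-- The colour of a token is the value at its position on level `0`. It travels unchanged along the
route, by the straight constraint or the crossing one, and the top level equates partners. Beyond
`N` the colouring is zero, which respects darts as `N` is even and pairs by `hι'`. -/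
theorem NetSat.exists_tokenColouring {x y : ℕ → ℕ → ℕ → F4} (h : NetSat d t N g Λ x y)
    (hg : IsSelector d t N ι P g) (hι : IsPairing N ι) (hι' : ∀ y, N ≤ y → N ≤ ι y)
    (hP : Routing d t N ι P) (ht : 0 < t) (ht4 : 4 ∣ t) (hN : N = t * 2 ^ d) :
    ∃ f, TokenColouring N ι Λ f := by
  have hlt : ∀ {ℓ}, ℓ ≤ d → ∀ {y}, y < N → P ℓ y < N := fun hℓ _ hy => (hP.placing _ hℓ).lt _ hy
  have route : ∀ ℓ ≤ d, ∀ z < N, x 0 ℓ (P ℓ z) = x 0 0 z := by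
    intro ℓ
    induction ℓ with
    | zero => intro _ z hz; rw [hP.zero z hz]
    | succ ℓ ih =>
      intro hℓ z hz
      rw [← ih (by omega) z hz]
      have hp := hlt (ℓ := ℓ) (by omega) hz
      have hp' := hlt hℓ hz
      rw [← h.up ℓ hℓ _ hp']
      by_cases hs : P (ℓ + 1) z = P ℓ z
      · have g0 := hg.stay₀ ℓ hℓ z hz
        have g2 := hg.stay₂ ℓ hℓ z hz
        rw [if_pos hs] at g0 g2
        have y0 := h.some 0 (by omega) ℓ (by omega) _ hp _ rfl g0
        have y2 := h.some 2 (by omega) ℓ (by omega) _ hp' _ rfl g2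
        rw [← y0, ← y2, h.straight ℓ hℓ _ hp, hs]
      · have g1 := hg.move₁ ℓ hℓ z hz
        have g3 := hg.move₃ ℓ hℓ z hz
        rw [if_neg hs] at g1 g3
        have y1 := h.some 1 (by omega) ℓ (by omega) _ hp _ rfl g1
        have y3 := h.some 3 (by omega) ℓ (by omega) _ hp' _ rfl g3
        rw [h.copy₂₃ ℓ hℓ _ hp', ← y3, h.copy₀₁ ℓ hℓ _ hp, ← y1, h.cross ℓ hℓ _ hp,
          (hP.step ℓ hℓ z hz).resolve_left hs]
  have side : ∀ p < N, x 0 0 p = x 0 0 (digitFlip 1 p) := fun p hp => by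
    have hf : digitFlip 1 p < N := digitFlip_lt one_pos (by
      rw [hN]; exact Dvd.dvd.mul_right (by omega) _) hp
    rw [← h.bottom₁ p hp, ← h.bottom₁ _ hf, h.side p hp]
    exact h.some 1 (by omega) d le_rfl p hp _
      (digitFlip_div_of_dvd one_pos ht (by omega) p) (hg.side p hp)
  have flip2 : ∀ p < N, digitFlip 2 p < N := fun p hp => digitFlip_lt two_pos (by
      rw [hN]; exact Dvd.dvd.mul_right (by omega) _) hp
  have hN2 : N % 2 = 0 := by
    rw [hN, Nat.mul_mod, show t % 2 = 0 by omega]; simp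
  refine ⟨fun p => if p < N then x 0 0 p else 0, fun z => ?_, fun z => ?_, fun p hp => ?_⟩
  · by_cases hz : 2 * z < N
    · rw [if_pos hz, if_pos (by omega), side _ hz, digitFlip_one_even]
    · rw [if_neg hz, if_neg (by omega)]
  · by_cases hz : z < N
    · rw [if_pos hz, if_pos (hι.lt z hz), ← route d le_rfl z hz, ← route d le_rfl _ (hι.lt z hz),
        h.top _ (hlt le_rfl hz)]
      exact (h.some 0 (by omega) d le_rfl _ (hlt le_rfl hz) _ (hP.top_eq hι ht hN hz).symm
        (hg.top z hz)).symm
    · rw [if_neg hz, if_neg (by have := hι' z (by omega); omega)]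
  · rw [if_pos hp, if_pos (flip2 p hp)]
    have e : y 2 d p = x 0 0 (digitFlip 2 p) := by
      rw [← h.bottom₂ _ (flip2 p hp)]
      exact h.some 2 (by omega) d le_rfl p hp _
        (digitFlip_div_of_dvd two_pos ht (by omega) p) (hg.colour p hp)
    rw [← e, ← h.bottom₂ p hp]
    exact h.colour p hp

/-- Each position receives the colour of the token standing there, and the selections then determine
`y`. The masked rows must match on both sides of an edge: a token that stays at `p` is the one found
at `p` afterwards, and one that crosses is found at the flipped position. -/
theorem TokenColouring.exists_netSat {f : ℕ → F4} (h : TokenColouring N ι Λ f)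
    (hg : IsSelector d t N ι P g) (hι : IsPairing N ι) (hP : Routing d t N ι P)
    (ht : 0 < t) (ht4 : 4 ∣ t) (hN : N = t * 2 ^ d) : ∃ x y, NetSat d t N g Λ x y := by
  have hlt : ∀ {ℓ}, ℓ ≤ d → ∀ {y}, y < N → P ℓ y < N := fun hℓ _ hy => (hP.placing _ hℓ).lt _ hy
  have hinv : ∀ ℓ, ∃ v : ℕ → ℕ, ℓ ≤ d → ∀ y < N, v (P ℓ y) = y := by
    intro ℓ
    by_cases hℓ : ℓ ≤ d
    · have : Set.InjOn (P ℓ) {y | y < N} := fun y hy z hz e => (hP.placing ℓ hℓ).inj y hy z hz e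
      by_cases h0 : 0 < N
      · have : Nonempty ℕ := ⟨0⟩
        exact ⟨Function.invFunOn (P ℓ) {y | y < N}, fun _ y hy => Set.InjOn.leftInvOn_invFunOn ‹Set.InjOn _ _› hy⟩
      · exact ⟨id, fun _ y hy => absurd hy (by omega)⟩
    · exact ⟨id, fun h => absurd h hℓ⟩
  choose v hv using hinv
  -- Below the top, types `0` and `1` show level `ℓ` and types `2` and `3` level `ℓ + 1`. On level
  -- `d`, type `0` shows the top and the other types are copies of level `0`.
  let x : ℕ → ℕ → ℕ → F4 := fun k ℓ p =>
    f (v (if ℓ = d then if k = 0 then d else 0 else if k < 2 then ℓ else ℓ + 1) p)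
  have x0 : ∀ ℓ ≤ d, ∀ y < N, x 0 ℓ (P ℓ y) = f y := fun ℓ hℓ y hy => by
    have : (if ℓ = d then if 0 = 0 then d else 0 else if 0 < 2 then ℓ else ℓ + 1) = ℓ := by
      split_ifs <;> simp_all
    change f (v (if ℓ = d then if 0 = 0 then d else 0 else if 0 < 2 then ℓ else ℓ + 1) _) = _
    rw [this, hv ℓ hℓ y hy]
  have x1 : ∀ ℓ < d, ∀ y < N, x 1 ℓ (P ℓ y) = f y := fun ℓ hℓ y hy => by
    simp only [x, hℓ.ne, if_false, Nat.one_lt_two, if_true]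
    rw [hv ℓ hℓ.le y hy]
  have x2 : ∀ k, 2 ≤ k → ∀ ℓ < d, ∀ y < N, x k ℓ (P (ℓ + 1) y) = f y := fun k hk ℓ hℓ y hy => by
    simp only [x, hℓ.ne, if_false, hk.not_gt]
    rw [hv (ℓ + 1) hℓ y hy]
  have xd : ∀ k ≠ 0, ∀ y < N, x k d y = f y := fun k hk y hy => by
    simp only [x, if_true, if_neg hk]
    have := hv 0 d.zero_le y hy
    rw [hP.zero y hy] at this
    rw [this]
  have x00 : ∀ y < N, x 0 0 y = f y := fun y hy => by
    have := x0 0 d.zero_le y hy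
    rwa [hP.zero y hy] at this
  let y : ℕ → ℕ → ℕ → F4 := fun k ℓ p => if g k ℓ p = 0 then 0 else x k ℓ (g k ℓ p - 1)
  have ysome : ∀ k ℓ p q, g k ℓ p = q + 1 → y k ℓ p = x k ℓ q := fun k ℓ p q e => by
    simp [y, e]
  have yzero : ∀ k ℓ p, g k ℓ p = 0 → y k ℓ p = 0 := fun k ℓ p e => by simp [y, e]
  refine ⟨x, y, ?_⟩
  have flip : ∀ H, 0 < H → 2 * H ∣ t → ∀ p < N, digitFlip H p < N := fun H hH hd p hp =>
    digitFlip_lt hH (by rw [hN]; exact Dvd.dvd.mul_right hd _) hp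
  constructor
  · intro ℓ hℓ p hp
    obtain ⟨z, hz, rfl⟩ := (hP.placing ℓ hℓ.le).surj hp
    rw [x0 ℓ hℓ.le z hz, x1 ℓ hℓ z hz]
  · intro ℓ hℓ p hp
    obtain ⟨z, hz, rfl⟩ := (hP.placing (ℓ + 1) hℓ).surj hp
    rw [x2 2 le_rfl ℓ hℓ z hz, x2 3 (by omega) ℓ hℓ z hz]
  · intro ℓ hℓ p hp
    obtain ⟨z, hz, rfl⟩ := (hP.placing (ℓ + 1) hℓ).surj hp
    rw [x2 2 le_rfl ℓ hℓ z hz, x0 (ℓ + 1) hℓ z hz]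
  · intro ℓ hℓ p hp
    obtain ⟨z, hz, rfl⟩ := (hP.placing ℓ hℓ.le).surj hp
    by_cases hs : P (ℓ + 1) z = P ℓ z
    · have g0 := hg.stay₀ ℓ hℓ z hz
      have g2 := hg.stay₂ ℓ hℓ z hz
      rw [if_pos hs] at g0 g2
      rw [ysome _ _ _ _ g0, x0 ℓ hℓ.le z hz, ← hs, ysome _ _ _ _ g2, x2 2 le_rfl ℓ hℓ z hz]
    · have g0 := hg.stay₀ ℓ hℓ z hz
      rw [if_neg hs] at g0
      -- The token `w` found at this position on the next level cannot have stayed there, as it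
      -- would be `z`, which left. Hence both rows are zero.
      obtain ⟨w, hw, e⟩ := (hP.placing (ℓ + 1) hℓ).surj hp
      have g2 := hg.stay₂ ℓ hℓ w hw
      rw [if_neg (fun h => hs (by
        rw [e] at h
        rw [(hP.placing ℓ hℓ.le).inj _ hz _ hw h, e, h])), e] at g2
      rw [yzero _ _ _ g0, yzero _ _ _ g2]
  · intro ℓ hℓ p hp
    have hfp := digitFlip_lt (H := t * 2 ^ ℓ) (by positivity) (by
      rw [hN, show 2 * (t * 2 ^ ℓ) = t * 2 ^ (ℓ + 1) by ring]
      exact Nat.mul_dvd_mul_left t (pow_dvd_pow 2 hℓ)) hp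
    obtain ⟨z, hz, rfl⟩ := (hP.placing ℓ hℓ.le).surj hp
    by_cases hs : P (ℓ + 1) z = P ℓ z
    · have g1 := hg.move₁ ℓ hℓ z hz
      rw [if_pos hs] at g1
      -- Had the token `w` at the flipped position crossed, it would have come from the position of
      -- `z`, which stayed. Hence both rows are zero.
      obtain ⟨w, hw, e⟩ := (hP.placing (ℓ + 1) hℓ).surj hfp
      have g3 := hg.move₃ ℓ hℓ w hw
      rw [if_pos ((hP.step ℓ hℓ w hw).resolve_right (fun h => by
        rw [h] at e
        have e' := congrArg (digitFlip (t * 2 ^ ℓ)) e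
        rw [digitFlip_digitFlip (by positivity), digitFlip_digitFlip (by positivity)] at e'
        obtain rfl := (hP.placing ℓ hℓ.le).inj _ hw _ hz e'
        exact digitFlip_ne (by positivity) _ (h.symm.trans hs))), e] at g3
      rw [yzero _ _ _ g1, yzero _ _ _ g3]
    · have g1 := hg.move₁ ℓ hℓ z hz
      have g3 := hg.move₃ ℓ hℓ z hz
      rw [if_neg hs] at g1 g3
      rw [ysome _ _ _ _ g1, x1 ℓ hℓ z hz, ← (hP.step ℓ hℓ z hz).resolve_left hs,
        ysome _ _ _ _ g3, x2 3 (by omega) ℓ hℓ z hz]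
  · intro p hp
    obtain ⟨z, hz, rfl⟩ := (hP.placing d le_rfl).surj hp
    rw [ysome _ _ _ _ (hg.top z hz), x0 d le_rfl z hz, x0 d le_rfl _ (hι.lt z hz), h.pair]
  · intro p hp
    rw [xd 1 one_ne_zero p hp, x00 p hp]
  · intro p hp
    rw [xd 2 two_ne_zero p hp, x00 p hp]
  · intro p hp
    rw [ysome _ _ _ _ (hg.side p hp), xd 1 one_ne_zero p hp,
      xd 1 one_ne_zero _ (flip 1 one_pos (by omega) p hp)]
    obtain ⟨z, rfl | rfl⟩ := Nat.even_or_odd' p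
    · rw [digitFlip_one_even, h.side]
    · rw [digitFlip_one_odd, h.side]
  · intro p hp
    rw [ysome _ _ _ _ (hg.colour p hp), xd 2 two_ne_zero p hp,
      xd 2 two_ne_zero _ (flip 2 two_pos (by omega) p hp)]
    exact h.colour p hp
  · exact fun k _ ℓ _ p _ => yzero k ℓ p
  · exact fun k _ ℓ _ p _ q _ => ysome k ℓ p q

/-- The instance built from a routing is satisfiable if and only if the tokens can be coloured. -/
theorem routingInstance_satisfiable_iff_tokenColouring (hQ : Q = 2 ^ d)
    (hg : IsSelector d t N ι P g) (hι : IsPairing N ι) (hι' : ∀ y, N ≤ y → N ≤ ι y)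
    (hP : Routing d t N ι P) (ht : 0 < t) (ht4 : 4 ∣ t) (hN : N = t * Q) :
    (routingInstance d Q t hQ g Λ).toCSP.Satisfiable ↔ ∃ f, TokenColouring N ι Λ f := by
  have hN' : N = t * 2 ^ d := hQ ▸ hN
  constructor
  · intro h
    obtain ⟨x, y, hxy⟩ := exists_netSat ht hN h
    exact hxy.exists_tokenColouring hg hι hι' hP ht ht4 hN'
  · rintro ⟨f, hf⟩
    obtain ⟨x, y, hxy⟩ := hf.exists_netSat hg hι hP ht ht4 hN'
    exact satisfiable_of_netSat ht hN hxy (hg.valid hι hP ht ht4 hN')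

end

/-! ## Colourings of the tokens and of the graph -/

/-- Constraint `e` owns the tokens `4 * e, …, 4 * e + 3`, and flipping the digit of weight `2`
passes from one of its darts to the other. The padding tokens from `4 * m` on act as further
constraints with isolated darts, coloured by two fixed elements of `Λ`. -/
theorem exists_tokenColouring_iff {n m N : ℕ} {Λ : Finset F4} (hΛ : 1 < Λ.card)
    {Γ : CSP (Fin n) (Fin m) F4} (hΓ : ∀ e a b, Γ.rel e a b ↔ a ∈ Λ ∧ b ∈ Λ ∧ a ≠ b) (hm : 0 < m)
    (hN : 4 * m ≤ N) {vert : ℕ → ℕ}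
    (hfst : ∀ e : Fin m, vert (2 * e) = Γ.fst e) (hsnd : ∀ e : Fin m, vert (2 * e + 1) = Γ.snd e) :
    (∃ f, TokenColouring N (dartPairing vert (2 * m)) Λ f) ↔ Γ.Satisfiable := by
  have : Nonempty (Fin m) := ⟨⟨0, hm⟩⟩
  have hdf : ∀ e, digitFlip 2 (4 * e) = 4 * e + 2 := fun e => by
    rw [digitFlip, if_pos (by omega)]
  constructor
  · rintro ⟨f, hf⟩
    have key := fun {x z} hx hz hv => eq_of_dartPairing vert hf.side hf.pair (x := x) (z := z)
      (M := 2 * m) hx hz hv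
    -- Any dart at the vertex may be chosen, since `f` is constant on them; the value zero for a
    -- vertex without darts is never tested.
    let σ : Fin n → F4 := fun v =>
      if h : ∃ x < 2 * m, vert x = v then f (2 * h.choose) else 0
    have hσ : ∀ x < 2 * m, ∀ v : Fin n, vert x = v → σ v = f (2 * x) := by
      intro x hx v hv
      have h : ∃ x < 2 * m, vert x = v := ⟨x, hx, hv⟩
      simp only [σ, dif_pos h]
      exact key h.choose_spec.1 hx (h.choose_spec.2.trans hv.symm)
    refine ⟨σ, (CSP.isSolution_iff Γ σ).mpr fun e => ?_⟩
    have he := e.2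
    rw [hΓ, hσ (2 * e) (by omega) _ (hfst e), hσ (2 * e + 1) (by omega) _ (hsnd e)]
    have := hf.colour (4 * e) (by omega)
    rw [hdf] at this
    rwa [show 2 * (2 * (e : ℕ)) = 4 * e by ring, show 2 * (2 * (e : ℕ) + 1) = 4 * e + 2 by ring]
  · rintro ⟨χ, hχ⟩
    rw [CSP.isSolution_iff] at hχ
    obtain ⟨a, ha, b, hb, hab⟩ := Finset.one_lt_card.mp hΛ
    let c : ℕ → F4 := fun v => if h : v < n then χ ⟨v, h⟩ else 0
    have hc : ∀ v : Fin n, c v = χ v := fun v => by simp [c]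
    let f : ℕ → F4 := fun y => if y / 2 < 2 * m then c (vert (y / 2)) else
      if y / 2 % 2 = 0 then a else b
    have hside : ∀ z, f (2 * z) = f (2 * z + 1) := fun z => by
      simp only [f]
      rw [show 2 * z / 2 = z by omega, show (2 * z + 1) / 2 = z by omega]
    refine ⟨f, hside, fun y => dartPairing_invariant vert hside (fun x hx z hz hv => ?_) y,
      fun p hp => ?_⟩
    · simp only [f]
      rw [show 2 * x / 2 = x by omega, show 2 * z / 2 = z by omega, if_pos hx, if_pos hz, hv]
    · have main : ∀ e, f (4 * e) ∈ Λ ∧ f (4 * e + 2) ∈ Λ ∧ f (4 * e) ≠ f (4 * e + 2) := fun e => by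
        simp only [f]
        rw [show 4 * e / 2 = 2 * e by omega, show (4 * e + 2) / 2 = 2 * e + 1 by omega]
        by_cases he : e < m
        · rw [if_pos (by omega), if_pos (by omega), hfst ⟨e, he⟩, hsnd ⟨e, he⟩, hc, hc, ← hΓ]
          exact hχ ⟨e, he⟩
        · rw [if_neg (show ¬ 2 * e < 2 * m by omega), if_neg (show ¬ 2 * e + 1 < 2 * m by omega),
            if_pos (show 2 * e % 2 = 0 by omega), if_neg (show ¬ (2 * e + 1) % 2 = 0 by omega)]
          exact ⟨ha, hb, hab⟩
      obtain ⟨e, r, hr, rfl⟩ : ∃ e r, r < 4 ∧ p = 4 * e + r :=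
        ⟨p / 4, p % 4, by omega, by omega⟩
      obtain ⟨h1, h2, h3⟩ := main e
      have s1 : f (4 * e) = f (4 * e + 1) := by
        have := hside (2 * e); rwa [show 2 * (2 * e) = 4 * e by ring] at this
      have s2 : f (4 * e + 2) = f (4 * e + 3) := by
        have := hside (2 * e + 1); rwa [show 2 * (2 * e + 1) = 4 * e + 2 by ring] at this
      have d0 : digitFlip 2 (4 * e + r) = if r < 2 then 4 * e + r + 2 else 4 * e + r - 2 := by
        rw [digitFlip]
        congr 1
        apply propext
        omega
      rw [d0]
      interval_cases r
      · exact ⟨h1, h2, h3⟩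
      · simp only [Nat.one_lt_two, if_true]
        rw [← s1, show 4 * e + 1 + 2 = 4 * e + 3 by ring, ← s2]
        exact ⟨h1, h2, h3⟩
      · simp only [lt_irrefl, if_false, Nat.add_sub_cancel]
        exact ⟨h2, h1, h3.symm⟩
      · simp only [show ¬ 3 < 2 by omega, if_false, show 4 * e + 3 - 2 = 4 * e + 1 by omega]
        rw [← s1, ← s2]
        exact ⟨h2, h1, h3.symm⟩

namespace Ram

/-! ## The program -/

/-- The scalars bound here and below are reserved by purpose (`40`–`41` for powers, `20`–`27` for
searches and orbits, `10`–`16` for loops of commands, `30`–`34` for output), so that nested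
constructs do not disturb each other. -/
def ePow2 (e : Env → ℕ) : Env → ℕ := eFold 40 41 e (eConst 1) (eAdd (eVar 40) (eVar 40))

/-- The scalars `0, …, 5` hold `k`, `m`, `d`, `Q`, `t` and `N`. -/
def setup : Env → Env :=
  cSeq (cSet 0 (eInp (eConst 0))) <| cSeq (cSet 1 (eInp (eConst 2))) <|
  cSeq (cSet 2 (eFold 20 21 (eVar 0) (eConst 0)
    (eLe (eMul (ePow2 (eAdd (eVar 20) (eConst 1))) (eAdd (eVar 20) (eConst 2))) (eVar 0)
      (eAdd (eVar 20) (eConst 1)) (eVar 20)))) <|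
  cSeq (cSet 3 (ePow2 (eVar 2))) <|
  cSeq (cSet 4 (eMul (eFold 20 21 (eVar 1) (eConst 0) (eLe (eVar 1) (eMul (eVar 3) (eVar 20))
    (eVar 20) (eAdd (eVar 20) (eConst 1)))) (eConst 4))) <|
  cSet 5 (eMul (eVar 4) (eVar 3))

/-- The strict comparison `r < H` is tested as `r + 1 ≤ H`, here and in `eSetDigit`. -/
def eFlip (H y : Env → ℕ) : Env → ℕ :=
  eLe (eAdd (eMod y (eAdd H H)) (eConst 1)) H (eAdd y H) (eSub y H)

def eSetDigit (H a b y : Env → ℕ) : Env → ℕ :=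
  eAdd (eLe (eAdd (eMod y (eAdd H H)) (eConst 1)) H y (eSub y H))
    (eLe (eAdd a (eConst 1)) b H (eConst 0))

def eMin (a b : Env → ℕ) : Env → ℕ := eLe a b a b

def eVert (x : Env → ℕ) : Env → ℕ := eInp (eAdd x (eConst 3))

/-- Assign `v` to the places `base, …, base + n - 1` of the array `a`. -/
def cFill (a y : ℕ) (base n v : Env → ℕ) : Env → Env :=
  cFor y n (cPut a (eAdd base (eVar y)) v)

/-- Array `0` becomes the table of the pairing of the tokens. -/
def pairTokens : Env → Env :=
  cSeq (cFill 0 11 (eConst 0) (eVar 5) (eFlip (eConst 1) (eVar 11))) <|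
  cFor 12 (eAdd (eVar 1) (eVar 1)) <|
    cLet 13 (eMul (eFold 20 21 (eVar 12) (eVar 12)
      (eEq (eVert (eVar 21)) (eVert (eVar 12)) (eVar 21) (eVar 20))) (eConst 2))
      14 (eMul (eVar 12) (eConst 2)) <|
    cLet 15 (eArr 0 (eVar 13)) 16 (eArr 0 (eVar 14)) <|
    cSeq (cPut 0 (eVar 14) (eVar 15)) <| cSeq (cPut 0 (eVar 13) (eVar 16)) <|
    cSeq (cPut 0 (eVar 15) (eVar 14)) (cPut 0 (eVar 16) (eVar 13))

/-- The position of the token `y` on level `ℓ`. -/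
def ePos (ℓ y : Env → ℕ) : Env → ℕ := eArr 1 (eAdd (eMul (eVar 5) ℓ) y)

/-- The token with position `p` on level `ℓ`. -/
def eFind (ℓ p : Env → ℕ) : Env → ℕ :=
  eFold 22 23 (eVar 5) (eConst 0) (eEq (ePos ℓ (eVar 23)) p (eVar 23) (eVar 22))

/-- The weight of the digit that may change on the level in scalar `10`. -/
def eWeight : Env → ℕ := eMul (eVar 4) (ePow2 (eVar 10))

/-- Every iterate of the walk is recomputed from its start; this is wasteful but stays polynomial.
-/
def eOrbitMin : Env → ℕ :=
  eFold 24 25 (eVar 5) (eVar 11) (eMin (eVar 24)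
    (eFold 26 27 (eAdd (eVar 25) (eConst 1)) (eVar 11)
      (eArr 0 (eArr 2 (eArr 0 (eArr 2 (eVar 26)))))))

/-- Array `2` gets the tokens at the flipped positions, array `3` the minima of the walk-cycles and
array `4` the new positions. The latter are buffered because `cFill_eval` requires values that do
not depend on the array being filled. -/
def routeLevel : Env → Env :=
  cSeq (cFill 2 11 (eConst 0) (eVar 5)
    (eFind (eVar 10) (eFlip eWeight (ePos (eVar 10) (eVar 11))))) <|
  cSeq (cFill 3 11 (eConst 0) (eVar 5) eOrbitMin) <|
  cSeq (cFill 4 11 (eConst 0) (eVar 5) (eSetDigit eWeight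
    (eMin (eArr 3 (eVar 11)) (eArr 3 (eArr 0 (eVar 11))))
    (eMin (eArr 3 (eArr 2 (eVar 11))) (eArr 3 (eArr 0 (eArr 2 (eVar 11)))))
    (ePos (eVar 10) (eVar 11)))) <|
  cFill 1 11 (eMul (eVar 5) (eAdd (eVar 10) (eConst 1))) (eVar 5) (eArr 4 (eVar 11))

/-- Array `1` becomes the table of the positions of the tokens on all levels. -/
def routeTokens : Env → Env :=
  cSeq (cFill 1 11 (eConst 0) (eVar 5) (eVar 11)) (cFor 10 (eVar 2) routeLevel)

def eSelector (f ℓ p : Env → ℕ) : Env → ℕ :=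
  eEq ℓ (eVar 2)
    (eEq f (eConst 0) (eAdd (ePos (eVar 2) (eArr 0 (eFind (eVar 2) p))) (eConst 1))
      (eEq f (eConst 1) (eAdd (eFlip (eConst 1) p) (eConst 1))
        (eEq f (eConst 2) (eAdd (eFlip (eConst 2) p) (eConst 1)) (eConst 0))))
    (eEq (ePos (eAdd ℓ (eConst 1)) (eFind (eLe f (eConst 1) ℓ (eAdd ℓ (eConst 1))) p))
      (ePos ℓ (eFind (eLe f (eConst 1) ℓ (eAdd ℓ (eConst 1))) p))
      (eEq f (eConst 0) (eAdd p (eConst 1)) (eEq f (eConst 2) (eAdd p (eConst 1)) (eConst 0)))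
      (eEq f (eConst 1) (eAdd p (eConst 1)) (eEq f (eConst 3) (eAdd p (eConst 1)) (eConst 0))))

def ePair (f : ℕ) (ℓ b : Env → ℕ) : Env → ℕ :=
  eAdd (eMul (eAdd (eMul (eAdd (eVar 2) (eConst 1)) (eConst f)) ℓ) (eVar 3)) b

def ePair' (f : ℕ) (ℓ b : Env → ℕ) : Env → ℕ :=
  eAdd (ePair 4 (eConst 0) (eConst 0)) (ePair f ℓ b)

def gCon (u v : Env → ℕ) (l : List ℕ) : Env → List ℕ := gCons u (gCons v (gConst l))

def gConstraints (T : Bool → List ℕ) : Env → List ℕ :=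
  gAppend (gFor 31 (eVar 2) <| gFor 32 (eVar 3) <|
    gAppend (gCon (ePair 0 (eVar 31) (eVar 32)) (ePair 1 (eVar 31) (eVar 32)) (T false)) <|
    gAppend (gCon (ePair 2 (eVar 31) (eVar 32)) (ePair 3 (eVar 31) (eVar 32)) (T false)) <|
    gAppend (gCon (ePair 2 (eVar 31) (eVar 32)) (ePair 0 (eAdd (eVar 31) (eConst 1)) (eVar 32))
      (T false)) <|
    gAppend (gCon (ePair' 0 (eVar 31) (eVar 32)) (ePair' 2 (eVar 31) (eVar 32)) (T false))
      (gCon (ePair' 1 (eVar 31) (eVar 32))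
        (ePair' 3 (eVar 31) (eFlip (ePow2 (eVar 31)) (eVar 32))) (T false))) <|
  gFor 32 (eVar 3) <|
    gAppend (gCon (ePair 0 (eVar 2) (eVar 32)) (ePair' 0 (eVar 2) (eVar 32)) (T false)) <|
    gAppend (gCon (ePair 1 (eVar 2) (eVar 32)) (ePair 0 (eConst 0) (eVar 32)) (T false)) <|
    gAppend (gCon (ePair 2 (eVar 2) (eVar 32)) (ePair 0 (eConst 0) (eVar 32)) (T false)) <|
    gAppend (gCon (ePair 1 (eVar 2) (eVar 32)) (ePair' 1 (eVar 2) (eVar 32)) (T false))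
      (gCon (ePair 2 (eVar 2) (eVar 32)) (ePair' 2 (eVar 2) (eVar 32)) (T true))

def gMatrices (c₀ c₁ : ℕ) : Env → List ℕ :=
  gFor 30 (eConst 4) <| gFor 31 (eAdd (eVar 2) (eConst 1)) <| gFor 32 (eVar 3) <|
    gFor 33 (eVar 4) <| gFor 34 (eVar 4) <|
    gCons (eEq (eSelector (eVar 30) (eVar 31) (eAdd (eMul (eVar 4) (eVar 32)) (eVar 33)))
      (eAdd (eAdd (eMul (eVar 4) (eVar 32)) (eVar 34)) (eConst 1)) (eConst c₁) (eConst c₀)) gNil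

/-- The output; `T` gives the truth tables of the sub-constraints, and `c₀`, `c₁` are the numbers
of the field elements `0` and `1`. -/
def output (T : Bool → List ℕ) (c₀ c₁ : ℕ) : Env → List ℕ :=
  gCons (ePair 4 (eConst 0) (eConst 0)) <| gCons (eVar 4) <|
  gCons (eMul (eMul (eAdd (eVar 2) (eConst 1)) (eConst 5)) (eVar 3)) <|
  gAppend (gConstraints T) (gMatrices c₀ c₁)

instance (e : Env → ℕ) [IsExpr e] : IsExpr (ePow2 e) := by unfold ePow2; infer_instance
instance (H y : Env → ℕ) [IsExpr H] [IsExpr y] : IsExpr (eFlip H y) := by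
  unfold eFlip; infer_instance
instance (H a b y : Env → ℕ) [IsExpr H] [IsExpr a] [IsExpr b] [IsExpr y] :
    IsExpr (eSetDigit H a b y) := by unfold eSetDigit; infer_instance
instance (a b : Env → ℕ) [IsExpr a] [IsExpr b] : IsExpr (eMin a b) := by
  unfold eMin; infer_instance
instance (x : Env → ℕ) [IsExpr x] : IsExpr (eVert x) := by unfold eVert; infer_instance
instance (a y : ℕ) (base n v : Env → ℕ) [IsExpr base] [IsExpr n] [IsExpr v] :
    IsCmd (cFill a y base n v) := by unfold cFill; infer_instance
instance (ℓ y : Env → ℕ) [IsExpr ℓ] [IsExpr y] : IsExpr (ePos ℓ y) := by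
  unfold ePos; infer_instance
instance (ℓ p : Env → ℕ) [IsExpr ℓ] [IsExpr p] : IsExpr (eFind ℓ p) := by
  unfold eFind; infer_instance
instance : IsExpr eWeight := by unfold eWeight; infer_instance
instance : IsExpr eOrbitMin := by unfold eOrbitMin; infer_instance
instance (f ℓ p : Env → ℕ) [IsExpr f] [IsExpr ℓ] [IsExpr p] : IsExpr (eSelector f ℓ p) := by
  unfold eSelector; infer_instance
instance (f : ℕ) (ℓ b : Env → ℕ) [IsExpr ℓ] [IsExpr b] : IsExpr (ePair f ℓ b) := by
  unfold ePair; infer_instance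
instance (f : ℕ) (ℓ b : Env → ℕ) [IsExpr ℓ] [IsExpr b] : IsExpr (ePair' f ℓ b) := by
  unfold ePair'; infer_instance
instance (u v : Env → ℕ) (l : List ℕ) [IsExpr u] [IsExpr v] : IsGen (gCon u v l) := by
  unfold gCon; infer_instance
instance : IsCmd setup := by unfold setup; infer_instance
instance : IsCmd pairTokens := by unfold pairTokens; infer_instance
instance : IsCmd routeLevel := by unfold routeLevel; infer_instance
instance : IsCmd routeTokens := by unfold routeTokens; infer_instance
instance (T : Bool → List ℕ) : IsGen (gConstraints T) := by unfold gConstraints; infer_instance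
instance (c₀ c₁ : ℕ) : IsGen (gMatrices c₀ c₁) := by unfold gMatrices; infer_instance
instance (T : Bool → List ℕ) (c₀ c₁ : ℕ) : IsGen (output T c₀ c₁) := by
  unfold output; infer_instance

/-! ### Evaluation of the expressions -/

theorem eLe_eval {u v a b : Env → ℕ} {h : Env} {u' v' a' b' : ℕ} (hu : u h = u') (hv : v h = v')
    (ha : a h = a') (hb : b h = b') : eLe u v a b h = if u' ≤ v' then a' else b' := by
  subst hu hv ha hb; rfl

theorem eEq_eval {u v a b : Env → ℕ} {h : Env} {u' v' a' b' : ℕ} (hu : u h = u') (hv : v h = v')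
    (ha : a h = a') (hb : b h = b') : eEq u v a b h = if u' = v' then a' else b' := by
  subst hu hv ha hb; rfl

theorem eMul_eval {a b : Env → ℕ} {h : Env} {a' b' : ℕ} (ha : a h = a') (hb : b h = b')
    (hle : b' ≤ h.bound) : eMul a b h = a' * b' := by
  subst ha hb; rw [eMul, min_eq_left hle]

theorem eAdd_eval {a b : Env → ℕ} {h : Env} {a' b' : ℕ} (ha : a h = a') (hb : b h = b') :
    eAdd a b h = a' + b' := by
  subst ha hb; rfl

theorem ePow2_eval {e : Env → ℕ} {h : Env} (he : e h ≤ h.bound) : ePow2 e h = 2 ^ e h := by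
  rw [ePow2, eFold, min_eq_left he]
  generalize e h = n
  induction n with
  | zero => rfl
  | succ n ih =>
    rw [pow_succ, mul_two, ← ih]
    simp [eAdd, eVar]

/-- Every effective subtraction lowers the value by at least one, so as many rounds as the dividend
suffice; surplus rounds change nothing. -/
theorem eMod_eval {a b : Env → ℕ} {h : Env} (ha : a h ≤ h.bound) (hb : 0 < b h) :
    eMod a b h = a h % b h := by
  rw [eMod, min_eq_left ha]
  generalize b h = b at hb
  suffices H : ∀ n r, r ≤ n → (fun r => if b ≤ r then r - b else r)^[n] r = r % b from H _ _ le_rfl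
  intro n
  induction n with
  | zero => intro r hr; obtain rfl : r = 0 := by omega
            simp
  | succ n ih =>
    intro r hr
    rw [Function.iterate_succ_apply]
    by_cases h : b ≤ r
    · rw [if_pos h, ih _ (by omega), ← Nat.mod_eq_sub_mod h]
    · rw [if_neg h, Function.iterate_fixed (by rw [if_neg h]), Nat.mod_eq_of_lt (by omega)]

theorem eFlip_eval {H y : Env → ℕ} {h : Env} (hH : 0 < H h) (hy : y h ≤ h.bound) :
    eFlip H y h = digitFlip (H h) (y h) := by
  have : eMod y (eAdd H H) h = y h % (2 * H h) := by
    rw [eMod_eval hy (by simp only [eAdd]; omega), eAdd, two_mul]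
  simp only [eFlip, eLe, eAdd, eSub, this, digitFlip]
  rfl

theorem eSetDigit_eval {H a b y : Env → ℕ} {h : Env} (hH : 0 < H h) (hy : y h ≤ h.bound) :
    eSetDigit H a b y h = digitSet (H h) (a h < b h) (y h) := by
  have : eMod y (eAdd H H) h = y h % (2 * H h) := by
    rw [eMod_eval hy (by simp only [eAdd]; omega), eAdd, two_mul]
  simp only [eSetDigit, eLe, eAdd, eSub, this, digitSet]
  rfl

/-- The last `j < N` with `F j = p`. -/
def lastPreimage (N : ℕ) (F : ℕ → ℕ) (p : ℕ) : ℕ := Nat.rec 0 (fun j r => if F j = p then j else r) N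

theorem lastPreimage_eq {N : ℕ} {F : ℕ → ℕ} (hF : ∀ y < N, ∀ z < N, F y = F z → y = z) {y : ℕ}
    (hy : y < N) : lastPreimage N F (F y) = y := by
  induction N with
  | zero => omega
  | succ N ih =>
    change (if F N = F y then N else lastPreimage N F (F y)) = y
    split_ifs with h
    · exact hF N (by omega) y hy h
    · have : y ≠ N := fun e => h (e ▸ rfl)
      exact ih (fun y hy z hz => hF y (by omega) z (by omega)) (by omega)

/-- The search binds scalars `22` and `23`, so `ℓ` and `p` must not depend on them. -/
theorem eFind_eval {ℓ p : Env → ℕ} {h : Env} {L q : ℕ} (hN : h.var 5 ≤ h.bound) (hL : L ≤ h.bound)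
    (hℓ : ∀ r j, ℓ ((h.set 22 r).set 23 j) = L) (hp : ∀ r j, p ((h.set 22 r).set 23 j) = q) :
    eFind ℓ p h = lastPreimage (h.var 5) (fun j => h.arr 1 (h.var 5 * L + j)) q := by
  rw [eFind, eFold, min_eq_left hN]
  simp [eEq, ePos, eArr, eAdd, eMul, hℓ, hp, min_eq_left hL, lastPreimage]

theorem ePos_eval {ℓ y : Env → ℕ} {h : Env} (hℓ : ℓ h ≤ h.bound) :
    ePos ℓ y h = h.arr 1 (h.var 5 * ℓ h + y h) := by
  simp [ePos, eArr, eAdd, eMul, hℓ]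

/-! ### Evaluation of the loops -/

theorem cFor_induction {x : ℕ} {n : Env → ℕ} {f : Env → Env} {h : Env} {M : ℕ} (hM : n h = M)
    (hn : M ≤ h.bound) (Inv : ℕ → Env → Prop) (h0 : Inv 0 h)
    (step : ∀ i < M, ∀ h', Inv i h' → Inv (i + 1) (f (h'.set x i))) :
    ∃ h', Inv M h' ∧ cFor x n f h = h'.set x (h.var x) := by
  subst hM
  refine ⟨_, ?_, rfl⟩
  rw [min_eq_left hn]
  suffices H : ∀ m ≤ n h, Inv m (Nat.rec h (fun i h' => f (h'.set x i)) m) from H _ le_rfl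
  intro m
  induction m with
  | zero => exact fun _ => h0
  | succ m ih => exact fun hm => step m hm _ (ih (by omega))

theorem Env.set_set (h : Env) (x a b : ℕ) : (h.set x a).set x b = h.set x b := by
  simp [Env.set]

theorem Env.put_set (h : Env) (x a b : ℕ) (f : ℕ → ℕ) :
    (h.set x b).put a f = (h.put a f).set x b := rfl

/-- The quantifier over `f` expresses that neither `base` nor the values read the array while it is
being filled; thus the order of the writes is irrelevant. -/
theorem cFill_eval {a y : ℕ} {base n v : Env → ℕ} {h : Env} {b : ℕ} {V : ℕ → ℕ}
    (hn : n h ≤ h.bound) (hb : ∀ f i, base ((h.put a f).set y i) = b)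
    (hv : ∀ f, ∀ i < n h, v ((h.put a f).set y i) = V i) : cFill a y base n v h =
      h.put a (fun j => if b ≤ j ∧ j < b + n h then V (j - b) else h.arr a j) := by
  obtain ⟨h', ⟨c, e⟩, e'⟩ := cFor_induction (x := y) (f := cPut a (eAdd base (eVar y)) v) rfl hn
    (fun m h' => ∃ c, h' =
      (h.put a (fun j => if b ≤ j ∧ j < b + m then V (j - b) else h.arr a j)).set y c)
    ⟨h.var y, by
      have : ∀ j, ¬ (b ≤ j ∧ j < b + 0) := fun j => by omega
      simp only [this, if_false]
      simp [Env.set, Env.put]⟩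
    (by
      rintro i hi h' ⟨c, rfl⟩
      refine ⟨i, ?_⟩
      rw [Env.set_set, cPut, hv _ i hi, eAdd, hb, Env.put_set]
      simp only [Env.set_var, if_true, Env.set_arr, Env.put_arr]
      congr 1
      simp only [Env.put, Function.update_idem]
      congr 2
      funext j
      rw [Function.update_apply]
      by_cases hj : j = b + i
      · subst hj
        simp
      · rw [if_neg hj]
        congr 1
        apply propext
        omega)
  rw [cFill, e', e, Env.set_set]
  simp [Env.set, Env.put]

end Ram

namespace Ram

/-! ### The sizes -/

theorem eFold_eq {x y : ℕ} {n i st : Env → ℕ} {h : Env} (V : ℕ → ℕ) (hn : n h ≤ h.bound)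
    (h0 : i h = V 0) (hs : ∀ j < n h, st ((h.set x (V j)).set y j) = V (j + 1)) :
    eFold x y n i st h = V (n h) := by
  rw [eFold, min_eq_left hn]
  suffices H : ∀ m ≤ n h, (Nat.rec (i h) (fun j r => st ((h.set x r).set y j)) m : ℕ) = V m from
    H _ le_rfl
  intro m
  induction m with
  | zero => exact fun _ => h0
  | succ m ih =>
    intro hm
    change st ((h.set x (Nat.rec (i h) (fun j r => st ((h.set x r).set y j)) m)).set y m) = _
    rw [ih (by omega), hs m (by omega)]

/-- The first `r` with `¬ c r`, searched for in `n` steps. -/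
def firstFailure (c : ℕ → Prop) [DecidablePred c] (n : ℕ) : ℕ :=
  Nat.rec 0 (fun _ r => if c r then r + 1 else r) n

/-- The search stops at the first failure or when its `n` rounds are used up; only in the first case
is failure guaranteed. -/
theorem firstFailure_spec (c : ℕ → Prop) [DecidablePred c] (n : ℕ) :
    firstFailure c n ≤ n ∧ (∀ i < firstFailure c n, c i) ∧
      (firstFailure c n < n → ¬ c (firstFailure c n)) := by
  induction n with
  | zero => simp [firstFailure]
  | succ n ih =>
    obtain ⟨h1, h2, h3⟩ := ih
    have e : firstFailure c (n + 1) =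
      if c (firstFailure c n) then firstFailure c n + 1 else firstFailure c n := rfl
    rw [e]
    split_ifs with h
    · refine ⟨by omega, fun i hi => ?_, fun hlt => absurd h (h3 (by omega))⟩
      rcases Nat.lt_succ_iff_lt_or_eq.mp hi with hi | rfl
      exacts [h2 i hi, h]
    · exact ⟨by omega, h2, fun _ => h⟩

/-- Two searches: `d` is the last exponent with `(d + 1) * 2 ^ d ≤ k`, and `w` is `m / 2 ^ d`
rounded up. The assumptions on the bound keep all cut-offs from taking effect. -/
theorem setup_eval {h : Env} (hk : 1 ≤ h.inp 0) (hk' : 2 * h.inp 0 ≤ h.bound)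
    (hm : h.inp 2 + 4 ≤ h.bound) : ∃ d w, setup h =
      (((((h.set 0 (h.inp 0)).set 1 (h.inp 2)).set 2 d).set 3 (2 ^ d)).set 4 (4 * w)).set 5
        (4 * w * 2 ^ d) ∧ (d + 1) * 2 ^ d ≤ h.inp 0 ∧ h.inp 0 < (d + 2) * 2 ^ (d + 1) ∧
      h.inp 2 ≤ 2 ^ d * w ∧ (0 < w → 2 ^ d * (w - 1) < h.inp 2) := by
  set k := h.inp 0 with hk0
  set m := h.inp 2 with hm0
  obtain ⟨d1, d2, d3⟩ := firstFailure_spec (fun r => 2 ^ (r + 1) * (r + 2) ≤ k) k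
  have e2 : eFold 20 21 (eVar 0) (eConst 0)
    (eLe (eMul (ePow2 (eAdd (eVar 20) (eConst 1))) (eAdd (eVar 20) (eConst 2))) (eVar 0)
      (eAdd (eVar 20) (eConst 1)) (eVar 20)) ((h.set 0 k).set 1 m) =
      firstFailure (fun r => 2 ^ (r + 1) * (r + 2) ≤ k) k := by
    refine (eFold_eq (firstFailure fun r => 2 ^ (r + 1) * (r + 2) ≤ k) ?_ rfl
      fun j hj => ?_).trans ?_
    · simp [eVar]; omega
    · simp only [eVar, Env.set_var] at hj
      have hj : j < k := by simpa using hj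
      have := (firstFailure_spec (fun r => 2 ^ (r + 1) * (r + 2) ≤ k) j).1
      have e20 : eVar 20 ((((h.set 0 k).set 1 m).set 20
        (firstFailure (fun r => 2 ^ (r + 1) * (r + 2) ≤ k) j)).set 21 j) =
        firstFailure (fun r => 2 ^ (r + 1) * (r + 2) ≤ k) j := by simp
      refine eLe_eval (eMul_eval ((ePow2_eval ?_).trans (congrArg (2 ^ ·) (eAdd_eval e20 rfl)))
        (eAdd_eval e20 rfl) ?_) ?_ (eAdd_eval e20 rfl) e20
      · rw [eAdd_eval e20 rfl]
        change firstFailure (fun r => 2 ^ (r + 1) * (r + 2) ≤ k) j + 1 ≤ h.bound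
        omega
      · change firstFailure (fun r => 2 ^ (r + 1) * (r + 2) ≤ k) j + 2 ≤ h.bound
        omega
      · simp
    · simp [eVar]
  generalize firstFailure (fun r => 2 ^ (r + 1) * (r + 2) ≤ k) k = d at *
  have hd : (d + 1) * 2 ^ d ≤ k := by
    rcases d with _ | d
    · simpa using hk
    · have := d2 d (by omega)
      rw [mul_comm]; exact this
  -- The search for `d` has thus ended by a failure and not by running out of rounds.
  have hdk : d < k := by
    have : d < 2 ^ d := Nat.lt_two_pow_self
    nlinarith
  have hQ : 0 < 2 ^ d := by positivity
  have hQk : 2 ^ d ≤ k := by nlinarith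
  obtain ⟨w1, w2, w3⟩ := firstFailure_spec (fun r => ¬ m ≤ 2 ^ d * r) m
  have e4 : eFold 20 21 (eVar 1) (eConst 0) (eLe (eVar 1) (eMul (eVar 3) (eVar 20))
    (eVar 20) (eAdd (eVar 20) (eConst 1))) ((((h.set 0 k).set 1 m).set 2 d).set 3 (2 ^ d)) =
      firstFailure (fun r => ¬ m ≤ 2 ^ d * r) m := by
    refine (eFold_eq (firstFailure fun r => ¬ m ≤ 2 ^ d * r) ?_ rfl
      fun j hj => ?_).trans ?_
    · simp [eVar]; omega
    · have hj : j < m := by simpa [eVar] using hj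
      have := (firstFailure_spec (fun r => ¬ m ≤ 2 ^ d * r) j).1
      have e20 : eVar 20 ((((((h.set 0 k).set 1 m).set 2 d).set 3 (2 ^ d)).set 20
        (firstFailure (fun r => ¬ m ≤ 2 ^ d * r) j)).set 21 j) =
        firstFailure (fun r => ¬ m ≤ 2 ^ d * r) j := by simp
      refine (eLe_eval (u' := m) ?_ (eMul_eval (a' := 2 ^ d) ?_ e20 ?_) e20
        (eAdd_eval e20 rfl)).trans (ite_not ..).symm
      · simp
      · simp
      · change firstFailure (fun r => ¬ m ≤ 2 ^ d * r) j ≤ h.bound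
        omega
    · simp [eVar]
  generalize firstFailure (fun r => ¬ m ≤ 2 ^ d * r) m = w at *
  refine ⟨d, w, ?_, hd, ?_, ?_, fun hw => ?_⟩
  · have e0 : cSet 0 (eInp (eConst 0)) h = h.set 0 k := rfl
    have e1 : cSet 1 (eInp (eConst 2)) (h.set 0 k) = (h.set 0 k).set 1 m := rfl
    simp only [setup, cSeq, e0, e1]
    simp only [cSet]
    rw [e2, ePow2_eval (by simp [eVar]; omega)]
    have : eVar 2 (((h.set 0 k).set 1 m).set 2 d) = d := by simp [eVar]
    rw [this]
    have : ∀ e h', 4 ≤ h'.bound → eMul e (eConst 4) h' = 4 * e h' := fun e h' hb => by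
      rw [eMul, eConst, min_eq_left hb, mul_comm]
    rw [this _ _ (by simp; omega), e4]
    congr 1
    refine eMul_eval ?_ ?_ ?_
    · simp
    · simp
    · simp; omega
  · have := d3 hdk
    rw [mul_comm]; omega
  · by_cases hwm : w < m
    · simpa using w3 hwm
    -- If the rounds are used up then `w = m`, which is large enough because `1 ≤ 2 ^ d`.
    · obtain rfl : w = m := by omega
      nlinarith
  · have := w2 (w - 1) (by omega)
    omega

/-! ### The pairing of the tokens -/

theorem pairTokens_eval {h : Env} {m N : ℕ} (hm : h.var 1 = m) (hN : h.var 5 = N)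
    (hb : N ≤ h.bound) (hb2 : 2 * m ≤ h.bound) (hb' : 2 ≤ h.bound) (hmN : 4 * m ≤ N) :
    ∃ a, pairTokens h = h.put 0 a ∧
      ∀ y < N, a y = dartPairing (fun x => h.inp (x + 3)) (2 * m) y := by
  have e0 : cFill 0 11 (eConst 0) (eVar 5) (eFlip (eConst 1) (eVar 11)) h =
      h.put 0 (fun j => if 0 ≤ j ∧ j < 0 + h.var 5 then digitFlip 1 (j - 0) else h.arr 0 j) := by
    refine cFill_eval (by rw [eVar, hN]; exact hb) (fun _ _ => rfl) fun f i hi => ?_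
    have hi : i < N := hN ▸ hi
    rw [eFlip_eval (by simp) (by simp; omega)]
    simp
  obtain ⟨h', ⟨c, a, rfl, ha⟩, e'⟩ := cFor_induction (x := 12) (n := eAdd (eVar 1) (eVar 1))
    (f := cLet 13 (eMul (eFold 20 21 (eVar 12) (eVar 12)
      (eEq (eVert (eVar 21)) (eVert (eVar 12)) (eVar 21) (eVar 20))) (eConst 2))
      14 (eMul (eVar 12) (eConst 2)) <|
    cLet 15 (eArr 0 (eVar 13)) 16 (eArr 0 (eVar 14)) <|
    cSeq (cPut 0 (eVar 14) (eVar 15)) <| cSeq (cPut 0 (eVar 13) (eVar 16)) <|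
    cSeq (cPut 0 (eVar 15) (eVar 14)) (cPut 0 (eVar 16) (eVar 13)))
    (h := h.put 0 (fun j => if 0 ≤ j ∧ j < 0 + h.var 5 then digitFlip 1 (j - 0) else h.arr 0 j))
    (M := 2 * m) (by rw [eAdd]; change h.var 1 + h.var 1 = _; omega) hb2
    (fun i h' => ∃ c a, h' = (h.put 0 a).set 12 c ∧
      ∀ y < N, a y = dartPairing (fun x => h.inp (x + 3)) i y)
    ⟨h.var 12, fun j => if 0 ≤ j ∧ j < 0 + h.var 5 then digitFlip 1 (j - 0) else h.arr 0 j,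
      by simp [Env.set, Env.put], fun y hy => by
      exact if_pos ⟨by omega, by omega⟩⟩
    (by
      rintro i hi h' ⟨c, a, rfl, ha⟩
      refine ⟨i, _, ?_, fun y hy => update_dartPairing (x := i) _ (by omega) ha hy⟩
      rw [Env.set_set]
      have e1 : eMul (eFold 20 21 (eVar 12) (eVar 12)
          (eEq (eVert (eVar 21)) (eVert (eVar 12)) (eVar 21) (eVar 20))) (eConst 2)
          ((h.put 0 a).set 12 i) = 2 * lastDart (fun x => h.inp (x + 3)) i := by
        rw [mul_comm]
        refine eMul_eval ?_ rfl hb'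
        rw [eFold, min_eq_left (by simp; omega)]
        simp [lastDart, eEq, eVert, eInp, eAdd]
      have e2 : eMul (eVar 12) (eConst 2) ((h.put 0 a).set 12 i) = 2 * i := by
        rw [mul_comm]
        exact eMul_eval (by simp) rfl hb'
      rw [cLet, e1, e2]
      simp only [cLet, cSeq, cPut, eArr, Env.set_var, Env.put_var, Env.set_arr, Env.put_arr,
        if_true, Nat.reduceEqDiff, if_false]
      simp only [Env.set, Env.put, Function.update_idem]
      congr 1
      funext x
      simp only [Function.update_apply]
      split_ifs <;> simp_all)
  refine ⟨a, ?_, ha⟩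
  rw [pairTokens, cSeq, e0, e', Env.set_set]
  simp [Env.set, Env.put]

end Ram


/-- The arrays of the program agree with the intended tables only for tokens below `N` and for the
levels computed so far; a routing depends on nothing else. -/
theorem Routing.congr {d t N : ℕ} {ι ι' : ℕ → ℕ} {P P' : ℕ → ℕ → ℕ} (h : Routing d t N ι P)
    (hι : ∀ y < N, ι y < N) (hP : ∀ ℓ ≤ d, ∀ y < N, P' ℓ y = P ℓ y)
    (hιι : ∀ y < N, ι' y = ι y) : Routing d t N ι' P' where
  placing ℓ hℓ := by
    refine ⟨fun y hy => ?_, fun y hy z hz => ?_, fun y hy => ?_⟩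
    · rw [hP ℓ hℓ y hy]; exact (h.placing ℓ hℓ).lt y hy
    · rw [hP ℓ hℓ y hy, hP ℓ hℓ z hz]; exact (h.placing ℓ hℓ).inj y hy z hz
    · rw [hP ℓ hℓ y hy]; exact (h.placing ℓ hℓ).parity y hy
  zero y hy := by rw [hP 0 (by omega) y hy]; exact h.zero y hy
  step ℓ hℓ y hy := by rw [hP ℓ (by omega) y hy, hP (ℓ + 1) hℓ y hy]; exact h.step ℓ hℓ y hy
  top y hy := by
    rw [hιι y hy, hP d le_rfl y hy, hP d le_rfl _ (hι y hy)]; exact h.top y hy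

theorem Routing.zero_id {t N : ℕ} {ι : ℕ → ℕ} : Routing 0 t N ι fun _ y => y where
  placing _ _ := ⟨fun _ hy => hy, fun _ _ _ _ h => h, fun _ _ => rfl⟩
  zero _ _ := rfl
  step _ h := absurd h (by omega)
  top _ _ := by simp [Nat.mod_one]

namespace Ram

/-! ### The routing of the tokens -/

/-- The minimum of `f^[j] y` over `j ≤ n`. -/
def orbitMin (f : ℕ → ℕ) (n y : ℕ) : ℕ :=
  Nat.rec y (fun j r => min r (f^[j + 1] y)) n

theorem orbitMin_spec (f : ℕ → ℕ) (n y : ℕ) :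
    (∃ j, orbitMin f n y = f^[j] y) ∧ ∀ j ≤ n, orbitMin f n y ≤ f^[j] y := by
  induction n with
  | zero =>
    refine ⟨⟨0, rfl⟩, fun j hj => ?_⟩
    obtain rfl : j = 0 := by omega
    exact le_rfl
  | succ n ih =>
    have e : orbitMin f (n + 1) y = min (orbitMin f n y) (f^[n + 1] y) := rfl
    obtain ⟨⟨i, hi⟩, h⟩ := ih
    rw [e]
    refine ⟨?_, fun j hj => ?_⟩
    · rcases min_choice (orbitMin f n y) (f^[n + 1] y) with h | h
      exacts [⟨i, h.trans hi⟩, ⟨n + 1, h⟩]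
    · rcases Nat.lt_succ_iff_lt_or_eq.mp (Nat.lt_succ_of_le hj) with hj | rfl
      exacts [(min_le_left _ _).trans (h j (by omega)), min_le_right _ _]

theorem eMin_eval (a b : Env → ℕ) (h : Env) : eMin a b h = min (a h) (b h) := by
  rw [eMin, eLe, min_def]

theorem eOrbitMin_eval {h : Env} (hN : h.var 5 ≤ h.bound) : eOrbitMin h =
    orbitMin (fun u => h.arr 0 (h.arr 2 (h.arr 0 (h.arr 2 u)))) (h.var 5) (h.var 11) := by
  refine (eFold_eq (n := eVar 5)
    (orbitMin (fun u => h.arr 0 (h.arr 2 (h.arr 0 (h.arr 2 u)))) · (h.var 11)) hN rfl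
    fun j hj => ?_)
  have hj : j < h.var 5 := hj
  rw [eMin_eval]
  change _ = min (orbitMin _ j _) _
  congr 1
  refine (eFold_eq (fun i => (fun u => h.arr 0 (h.arr 2 (h.arr 0 (h.arr 2 u))))^[i] (h.var 11))
    ?_ ?_ fun i hi => ?_).trans ?_
  · simp [eAdd, eVar]; omega
  · simp [eVar]
  · rw [Function.iterate_succ_apply']
    simp [eArr, eVar]
  · simp [eAdd, eVar, eConst]

theorem routeLevel_spec {h : Env} {t N ℓ d : ℕ} (h4 : h.var 4 = t) (h5 : h.var 5 = N)
    (h10 : h.var 10 = ℓ) (hN : N ≤ h.bound) (hNd : N = t * 2 ^ d) (hℓ : ℓ < d)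
    (hd : 2 ^ d ≤ h.bound) (ht : 0 < t) (ht2 : t % 2 = 0) (hι : IsPairing N (h.arr 0))
    (hP : Routing ℓ t N (h.arr 0) fun ℓ y => h.arr 1 (N * ℓ + y)) :
    (routeLevel h).bound = h.bound ∧ (routeLevel h).inp = h.inp ∧ (routeLevel h).var = h.var ∧
      (routeLevel h).arr 0 = h.arr 0 ∧
      Routing (ℓ + 1) t N (h.arr 0) fun ℓ y => (routeLevel h).arr 1 (N * ℓ + y) := by
  have hdb : d < h.bound := lt_of_lt_of_le Nat.lt_two_pow_self hd
  have hW : 0 < t * 2 ^ ℓ := by positivity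
  have hdvd : 2 * (t * 2 ^ ℓ) ∣ N := by
    rw [hNd, show 2 * (t * 2 ^ ℓ) = t * 2 ^ (ℓ + 1) by ring]
    exact mul_dvd_mul_left t (pow_dvd_pow 2 hℓ)
  have hw : ∀ h' : Env, h'.bound = h.bound → h'.var 4 = t → h'.var 10 = ℓ →
      eWeight h' = t * 2 ^ ℓ := fun h' e1 e2 e3 => by
    have : 2 ^ ℓ ≤ 2 ^ d := Nat.pow_le_pow_right (by omega) hℓ.le
    refine eMul_eval e2 ((ePow2_eval ?_).trans (congrArg (2 ^ ·) e3)) ?_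
    · change h'.var 10 ≤ _; omega
    · omega
  have hpl := hP.placing ℓ le_rfl
  let Pℓ := fun y => h.arr 1 (N * ℓ + y)
  have hPlt : ∀ y < N, Pℓ y < N := hpl.lt
  let A := fun y => lastPreimage N Pℓ (digitFlip (t * 2 ^ ℓ) (Pℓ y))
  have hA : ∀ y < N, A y < N ∧ Pℓ (A y) = digitFlip (t * 2 ^ ℓ) (Pℓ y) := fun y hy => by
    obtain ⟨z, hz, e⟩ := hpl.surj (digitFlip_lt hW hdvd (hPlt y hy))
    have : A y = z := by
      change lastPreimage N Pℓ (digitFlip (t * 2 ^ ℓ) (Pℓ y)) = z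
      rw [← e]
      exact lastPreimage_eq hpl.inj hz
    rw [this]
    exact ⟨hz, e⟩
  let α := fun j => if 0 ≤ j ∧ j < 0 + h.var 5 then A (j - 0) else h.arr 2 j
  have hα : ∀ y < N, α y = A y := fun y hy => if_pos ⟨by omega, by omega⟩
  let M := fun y => orbitMin (fun u => h.arr 0 (α (h.arr 0 (α u)))) N y
  let μ := fun j => if 0 ≤ j ∧ j < 0 + h.var 5 then M (j - 0) else h.arr 3 j
  have hμ : ∀ y < N, μ y = M y := fun y hy => if_pos ⟨by omega, by omega⟩
  let R := fun y => digitSet (t * 2 ^ ℓ)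
    (min (μ y) (μ (h.arr 0 y)) < min (μ (α y)) (μ (h.arr 0 (α y)))) (Pℓ y)
  let τ := fun j => if 0 ≤ j ∧ j < 0 + h.var 5 then R (j - 0) else h.arr 4 j
  have hτ : ∀ y < N, τ y = R y := fun y hy => if_pos ⟨by omega, by omega⟩
  let π := fun j => if N * (ℓ + 1) ≤ j ∧ j < N * (ℓ + 1) + h.var 5 then τ (j - N * (ℓ + 1))
    else h.arr 1 j
  have e1 : cFill 2 11 (eConst 0) (eVar 5)
      (eFind (eVar 10) (eFlip eWeight (ePos (eVar 10) (eVar 11)))) h = h.put 2 α := by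
    refine cFill_eval (by rw [eVar, h5]; exact hN) (fun _ _ => rfl) fun f i hi => ?_
    have hi : i < N := h5 ▸ hi
    refine (eFind_eval (L := ℓ) (q := digitFlip (t * 2 ^ ℓ) (Pℓ i)) ?_ ?_ ?_ ?_).trans ?_
    · simp; omega
    · simp; omega
    · intro r j; simp [h10]
    · intro r j
      have hp : ePos (eVar 10) (eVar 11) (((((h.put 2 f).set 11 i).set 22 r).set 23 j)) = Pℓ i := by
        rw [ePos_eval (by simp [eVar]; omega)]
        simp [eVar, h5, h10, Pℓ]
      have hw' := hw ((((h.put 2 f).set 11 i).set 22 r).set 23 j) rfl (by simpa) (by simpa)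
      rw [eFlip_eval (by rw [hw']; exact hW) (by rw [hp]; exact (hPlt i hi).le.trans hN), hp, hw']
    · simp [h5, A, Pℓ]
  have e2 : cFill 3 11 (eConst 0) (eVar 5) eOrbitMin (h.put 2 α) = (h.put 2 α).put 3 μ := by
    refine cFill_eval (by rw [eVar, Env.put_var, h5]; exact hN) (fun _ _ => rfl) fun f i hi => ?_
    rw [eOrbitMin_eval (by simp; omega)]
    simp [M, h5]
  have e3 : cFill 4 11 (eConst 0) (eVar 5) (eSetDigit eWeight
      (eMin (eArr 3 (eVar 11)) (eArr 3 (eArr 0 (eVar 11))))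
      (eMin (eArr 3 (eArr 2 (eVar 11))) (eArr 3 (eArr 0 (eArr 2 (eVar 11)))))
      (ePos (eVar 10) (eVar 11))) ((h.put 2 α).put 3 μ) = ((h.put 2 α).put 3 μ).put 4 τ := by
    refine cFill_eval (by rw [eVar, Env.put_var, Env.put_var, h5]; exact hN) (fun _ _ => rfl)
      fun f i hi => ?_
    have hi : i < N := h5 ▸ hi
    have hp : ePos (eVar 10) (eVar 11) ((((h.put 2 α).put 3 μ).put 4 f).set 11 i) = Pℓ i := by
      rw [ePos_eval (by simp [eVar]; omega)]
      simp [eVar, h5, h10, Pℓ]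
    have hw' := hw ((((h.put 2 α).put 3 μ).put 4 f).set 11 i) rfl (by simpa) (by simpa)
    rw [eSetDigit_eval (by rw [hw']; exact hW) (by rw [hp]; exact (hPlt i hi).le.trans hN)]
    simp only [hp, hw', eMin_eval]
    simp [eArr, eVar, R]
  have e4 : cFill 1 11 (eMul (eVar 5) (eAdd (eVar 10) (eConst 1))) (eVar 5) (eArr 4 (eVar 11))
      (((h.put 2 α).put 3 μ).put 4 τ) = (((h.put 2 α).put 3 μ).put 4 τ).put 1 π := by
    refine cFill_eval (b := N * (ℓ + 1)) (V := τ) (by simp only [eVar, Env.put_var, h5]; exact hN)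
      (fun f i => ?_) fun f i hi => ?_
    · exact eMul_eval (by simp [h5]) (eAdd_eval (by simpa) rfl) (by simp; omega)
    · simp [eArr, eVar]
  have e : routeLevel h = (((h.put 2 α).put 3 μ).put 4 τ).put 1 π := by
    rw [routeLevel, cSeq, cSeq, cSeq, e1, e2, e3, e4]
  have hπ : ∀ y < N, π (N * (ℓ + 1) + y) = R y := fun y hy => by
    rw [← hτ y hy]
    refine (if_pos ⟨by omega, by omega⟩).trans ?_
    rw [Nat.add_sub_cancel_left]
  -- The new level is written from place `N * (ℓ + 1)` on, beyond all earlier levels.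
  have hπ' : ∀ ℓ' ≤ ℓ, ∀ y < N, π (N * ℓ' + y) = h.arr 1 (N * ℓ' + y) := fun ℓ' hℓ' y hy => by
    refine if_neg fun hc => ?_
    have : N * ℓ' ≤ N * ℓ := Nat.mul_le_mul_left _ hℓ'
    rw [mul_add] at hc
    omega
  rw [e]
  refine ⟨rfl, rfl, rfl, by simp, ?_⟩
  have e' : ((((h.put 2 α).put 3 μ).put 4 τ).put 1 π).arr 1 = π := by simp
  rw [e']
  -- The table `α` agrees with `A` only below `N`, but the walk never leaves that range.
  have hiter : ∀ j, ∀ y < N, (fun u => h.arr 0 (α (h.arr 0 (α u))))^[j] y =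
      (fun u => h.arr 0 (A (h.arr 0 (A u))))^[j] y ∧
      (fun u => h.arr 0 (A (h.arr 0 (A u))))^[j] y < N := by
    intro j
    induction j with
    | zero => exact fun y hy => ⟨rfl, hy⟩
    | succ j ih =>
      intro y hy
      have h1 := hι.lt _ (hA y hy).1
      have h2 := hι.lt _ (hA _ h1).1
      rw [Function.iterate_succ_apply, Function.iterate_succ_apply, hα y hy, hα _ h1]
      exact ih _ h2
  have hP' : Routing ℓ t N (h.arr 0) fun ℓ y => π (N * ℓ + y) :=
    hP.congr hι.lt hπ' fun _ _ => rfl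
  refine hP'.succ ht ht2 ?_ hι (A := A) (M := M) (fun y hy => ⟨(hA y hy).1, ?_⟩) (fun y hy => ?_)
    fun y hy => ?_
  · rwa [show t * 2 ^ (ℓ + 1) = 2 * (t * 2 ^ ℓ) by ring]
  · rw [hπ' ℓ le_rfl y hy, hπ' ℓ le_rfl _ (hA y hy).1]
    exact (hA y hy).2
  · obtain ⟨⟨j, hj⟩, hm⟩ := orbitMin_spec (fun u => h.arr 0 (α (h.arr 0 (α u)))) N y
    refine ⟨⟨j, hj.trans (hiter j y hy).1⟩, fun j hj => ?_⟩
    rw [← (hiter j y hy).1]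
    exact hm j hj
  · rw [hπ y hy, hπ' ℓ le_rfl y hy]
    simp only [R]
    rw [hα y hy, hμ y hy, hμ _ (hι.lt y hy), hμ _ (hA y hy).1, hμ _ (hι.lt _ (hA y hy).1)]

theorem routeTokens_spec {h : Env} {t N d : ℕ} (h2 : h.var 2 = d) (h4 : h.var 4 = t)
    (h5 : h.var 5 = N) (hN : N ≤ h.bound) (hNd : N = t * 2 ^ d) (hd : 2 ^ d ≤ h.bound)
    (ht : 0 < t) (ht2 : t % 2 = 0) (hι : IsPairing N (h.arr 0)) :
    (routeTokens h).bound = h.bound ∧ (∀ i ≤ 5, (routeTokens h).var i = h.var i) ∧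
      (routeTokens h).arr 0 = h.arr 0 ∧
      Routing d t N (h.arr 0) fun ℓ y => (routeTokens h).arr 1 (N * ℓ + y) := by
  have hdb : d < h.bound := lt_of_lt_of_le Nat.lt_two_pow_self hd
  have e0 : cFill 1 11 (eConst 0) (eVar 5) (eVar 11) h =
      h.put 1 fun j => if 0 ≤ j ∧ j < 0 + h.var 5 then j - 0 else h.arr 1 j :=
    cFill_eval (V := fun j => j) (by rw [eVar, h5]; exact hN) (fun _ _ => rfl)
      fun f i hi => by simp
  obtain ⟨h', ⟨b1, b2, b3, b4⟩, e'⟩ := cFor_induction (x := 10) (n := eVar 2) (f := routeLevel)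
    (h := h.put 1 fun j => if 0 ≤ j ∧ j < 0 + h.var 5 then j - 0 else h.arr 1 j) (M := d)
    (by simpa) (by simpa using hdb.le)
    (fun ℓ h' => h'.bound = h.bound ∧ (∀ i ≤ 5, h'.var i = h.var i) ∧ h'.arr 0 = h.arr 0 ∧
      Routing ℓ t N (h.arr 0) fun ℓ y => h'.arr 1 (N * ℓ + y))
    ⟨rfl, fun _ _ => rfl, by simp, Routing.zero_id.congr hι.lt (fun ℓ hℓ y hy => by
      obtain rfl : ℓ = 0 := by omega
      simp [h5, hy]) fun _ _ => rfl⟩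
    (by
      rintro ℓ hℓ h' ⟨b1, b2, b3, b4⟩
      obtain ⟨c1, -, c2, c3, c4⟩ := routeLevel_spec (h := h'.set 10 ℓ) (t := t) (N := N) (ℓ := ℓ)
        (d := d) (by simp [b2, h4]) (by simp [b2, h5]) (by simp) (by simpa [b1]) hNd hℓ
        (by simpa [b1]) ht ht2 (by simpa [b3]) (by simpa [b3])
      refine ⟨c1.trans b1, fun i hi => ?_, c3.trans b3, ?_⟩
      · rw [c2, Env.set_var, if_neg (by omega), b2 i hi]
      · simpa [b3] using c4)
  have e : routeTokens h = h'.set 10 (h.var 10) := by rw [routeTokens, cSeq, e0, e']; rfl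
  rw [e]
  refine ⟨b1, fun i hi => ?_, b3, b4⟩
  rw [Env.set_var, if_neg (by omega), b2 i hi]

end Ram


/-! ### Correctness of the selection and of the output -/

/-- Merges the output loops over type, level and block into one loop over the numbers `pairIdx`. -/
theorem List.flatMap_range_mul {A : Type*} (a b : ℕ) (F : ℕ → List A) :
    (List.range (a * b)).flatMap F =
      (List.range a).flatMap fun i => (List.range b).flatMap fun j => F (i * b + j) := by
  induction a with
  | zero => simp
  | succ a ih =>
    rw [Nat.succ_mul, List.range_add, List.flatMap_append, ih, List.range_succ,
      List.flatMap_append, List.flatMap_map]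
    simp

theorem List.flatMap_congr_mem {A B : Type*} {l : List A} {F G : A → List B}
    (h : ∀ a ∈ l, F a = G a) : l.flatMap F = l.flatMap G := by
  rw [List.flatMap_def, List.flatMap_def, List.map_congr_left h]

namespace Ram

/-- The selection of the coordinates by the matrices, computed from the pairing `ι` and the
positions `P`. -/
def selector (N d : ℕ) (ι : ℕ → ℕ) (P : ℕ → ℕ → ℕ) (f ℓ p : ℕ) : ℕ :=
  if ℓ = d then
    if f = 0 then P d (ι (lastPreimage N (P d) p)) + 1
    else if f = 1 then digitFlip 1 p + 1 else if f = 2 then digitFlip 2 p + 1 else 0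
  else if P (ℓ + 1) (lastPreimage N (P (if f ≤ 1 then ℓ else ℓ + 1)) p) =
      P ℓ (lastPreimage N (P (if f ≤ 1 then ℓ else ℓ + 1)) p) then
    if f = 0 then p + 1 else if f = 2 then p + 1 else 0
  else if f = 1 then p + 1 else if f = 3 then p + 1 else 0

theorem isSelector_selector {d t N : ℕ} {ι ι' : ℕ → ℕ} {P : ℕ → ℕ → ℕ} (h : Routing d t N ι P)
    (hι : ∀ y < N, ι' y = ι y) : IsSelector d t N ι P (selector N d ι' P) := by
  have key : ∀ ℓ ≤ d, ∀ y < N, lastPreimage N (P ℓ) (P ℓ y) = y := fun ℓ hℓ y hy =>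
    lastPreimage_eq (h.placing ℓ hℓ).inj hy
  constructor
  · intro ℓ hℓ y hy
    simp [selector, hℓ.ne, key ℓ hℓ.le y hy]
  · intro ℓ hℓ y hy
    simp [selector, hℓ.ne, key ℓ hℓ.le y hy]
  · intro ℓ hℓ y hy
    simp [selector, hℓ.ne, key (ℓ + 1) hℓ y hy]
  · intro ℓ hℓ y hy
    simp [selector, hℓ.ne, key (ℓ + 1) hℓ y hy]
  · intro y hy
    simp [selector, key d le_rfl y hy, hι y hy]
  · intro p _
    simp [selector]
  · intro p _
    simp [selector]
  · intro p _
    simp [selector]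

/-! ### The output -/

theorem eSelector_eval {f ℓ p : Env → ℕ} {h : Env} {N d F L p' : ℕ} (h2 : h.var 2 = d)
    (h5 : h.var 5 = N) (hN : N ≤ h.bound) (hd : d ≤ h.bound) (hL : L < h.bound)
    (hp' : p' ≤ h.bound) (hf : ∀ r j, f ((h.set 22 r).set 23 j) = F)
    (hℓ : ∀ r j, ℓ ((h.set 22 r).set 23 j) = L) (hp : ∀ r j, p ((h.set 22 r).set 23 j) = p')
    (hf0 : f h = F) (hℓ0 : ℓ h = L) (hp0 : p h = p') :
    eSelector f ℓ p h = selector N d (h.arr 0) (fun ℓ y => h.arr 1 (N * ℓ + y)) F L p' := by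
  have pos : ∀ {ℓ y : Env → ℕ} {L Y}, ℓ h = L → y h = Y → L ≤ h.bound →
      ePos ℓ y h = h.arr 1 (N * L + Y) := fun e1 e2 e3 => by
    rw [ePos_eval (by omega), e1, e2, h5]
  have find : ∀ {ℓ : Env → ℕ} {L}, L ≤ h.bound → (∀ r j, ℓ ((h.set 22 r).set 23 j) = L) →
      eFind ℓ p h = lastPreimage N (fun y => h.arr 1 (N * L + y)) p' := fun e1 e2 => by
    rw [eFind_eval (h5 ▸ hN) e1 e2 hp, h5]
  have hp1 : eAdd p (eConst 1) h = p' + 1 := eAdd_eval hp0 rfl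
  have find' : eFind (eLe f (eConst 1) ℓ (eAdd ℓ (eConst 1))) p h =
      lastPreimage N (fun y => h.arr 1 (N * (if F ≤ 1 then L else L + 1) + y)) p' := by
    refine find ?_ fun r j => eLe_eval (hf r j) rfl (hℓ r j) (eAdd_eval (hℓ r j) rfl)
    split_ifs <;> omega
  have flip : ∀ H, 0 < H → eAdd (eFlip (eConst H) p) (eConst 1) h = digitFlip H p' + 1 :=
    fun H hH => eAdd_eval ((eFlip_eval hH (by omega)).trans (by rw [hp0])) rfl
  refine eEq_eval hℓ0 h2
    (eEq_eval hf0 rfl (eAdd_eval (pos h2 (congrArg (h.arr 0) (find hd fun r j => ?_)) hd) rfl)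
      (eEq_eval hf0 rfl (flip 1 one_pos) (eEq_eval hf0 rfl (flip 2 two_pos) rfl)))
    (eEq_eval (pos (eAdd_eval hℓ0 rfl) find' hL) (pos hℓ0 find' hL.le)
      (eEq_eval hf0 rfl hp1 (eEq_eval hf0 rfl hp1 rfl))
      (eEq_eval hf0 rfl hp1 (eEq_eval hf0 rfl hp1 rfl)))
  simp [h2]

theorem ePair_eval {f d Q L B : ℕ} {ℓ b : Env → ℕ} {h : Env} (h2 : h.var 2 = d) (h3 : h.var 3 = Q)
    (hf : f ≤ h.bound) (hQ : Q ≤ h.bound) (hℓ : ℓ h = L) (hb : b h = B) :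
    ePair f ℓ b h = pairIdx d Q f L B := by
  refine eAdd_eval (eMul_eval (eAdd_eval ?_ hℓ) h3 hQ) hb
  rw [mul_comm]
  exact eMul_eval (eAdd_eval h2 rfl) rfl hf

theorem ePair'_eval {f d Q L B : ℕ} {ℓ b : Env → ℕ} {h : Env} (h2 : h.var 2 = d) (h3 : h.var 3 = Q)
    (hf : f ≤ 4) (hb4 : 4 ≤ h.bound) (hQ : Q ≤ h.bound) (hℓ : ℓ h = L) (hb : b h = B) :
    ePair' f ℓ b h = 4 * (d + 1) * Q + pairIdx d Q f L B :=
  eAdd_eval ((ePair_eval h2 h3 hb4 hQ rfl rfl).trans (by simp [pairIdx]))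
    (ePair_eval h2 h3 (hf.trans hb4) hQ hℓ hb)

theorem gFor_eval {x : ℕ} {n : Env → ℕ} {g : Env → List ℕ} {h : Env} {M : ℕ} {G : ℕ → List ℕ}
    (hn : n h = M) (hM : M ≤ h.bound) (hg : ∀ i < M, g (h.set x i) = G i) :
    gFor x n g h = (List.range M).flatMap G := by
  rw [gFor, hn, min_eq_left hM]
  exact List.flatMap_congr_mem fun i hi => hg i (List.mem_range.mp hi)

theorem gConstraints_eval {d Q : ℕ} {h : Env} (T : Bool → List ℕ) (h2 : h.var 2 = d)
    (h3 : h.var 3 = Q) (hQ : Q = 2 ^ d) (hb : Q ≤ h.bound) (hb4 : 4 ≤ h.bound) :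
    gConstraints T h = (conList d Q).flatMap fun c => c.1 :: c.2.1 :: T c.2.2 := by
  have hd : d ≤ h.bound := (hQ ▸ Nat.lt_two_pow_self.le : d ≤ Q).trans hb
  have con : ∀ {h' : Env} {u v : Env → ℕ} {U V : ℕ} (l : List ℕ), u h' = U → v h' = V →
      gCon u v l h' = U :: V :: l := fun l e1 e2 => by rw [← e1, ← e2]; rfl
  have app : ∀ {h' : Env} {g g' : Env → List ℕ} {l l' : List ℕ}, g h' = l → g' h' = l' →
      gAppend g g' h' = l ++ l' := fun e1 e2 => by rw [← e1, ← e2]; rfl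
  simp only [conList, List.flatMap_append, List.flatMap_assoc, List.flatMap_cons,
    List.flatMap_nil, List.append_nil]
  refine app (gFor_eval h2 hd fun ℓ hℓ => gFor_eval (by simpa) (by simpa) fun b hb' => ?_)
    (gFor_eval h3 hb fun b hb' => ?_)
  · have v2 : ((h.set 31 ℓ).set 32 b).var 2 = d := by simpa
    have v3 : ((h.set 31 ℓ).set 32 b).var 3 = Q := by simpa
    have v31 : eVar 31 ((h.set 31 ℓ).set 32 b) = ℓ := by simp
    have v32 : eVar 32 ((h.set 31 ℓ).set 32 b) = b := by simp
    have pair : ∀ f ≤ 4, ePair f (eVar 31) (eVar 32) ((h.set 31 ℓ).set 32 b) =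
      pairIdx d Q f ℓ b := fun f hf => ePair_eval v2 v3 (hf.trans hb4) hb v31 v32
    have pair' : ∀ f ≤ 4, ePair' f (eVar 31) (eVar 32) ((h.set 31 ℓ).set 32 b) =
      4 * (d + 1) * Q + pairIdx d Q f ℓ b := fun f hf => ePair'_eval v2 v3 hf hb4 hb v31 v32
    have e2 : ePow2 (eVar 31) ((h.set 31 ℓ).set 32 b) = 2 ^ ℓ := by
      rw [ePow2_eval (by rw [v31]; exact hℓ.le.trans hd), v31]
    refine app (con _ (pair 0 (by omega)) (pair 1 (by omega))) <|
      app (con _ (pair 2 (by omega)) (pair 3 (by omega))) <|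
      app (con _ (pair 2 (by omega))
        (ePair_eval v2 v3 (by omega) hb (eAdd_eval v31 rfl) v32)) <|
      app (con _ (pair' 0 (by omega)) (pair' 2 (by omega)))
        (con _ (pair' 1 (by omega)) (ePair'_eval v2 v3 (by omega) hb4 hb v31 ?_))
    rw [eFlip_eval (by rw [e2]; positivity) (by rw [v32]; exact hb'.le.trans hb), e2, v32]
  · have v2 : eVar 2 (h.set 32 b) = d := by simpa
    have v3 : (h.set 32 b).var 3 = Q := by simpa
    have v32 : eVar 32 (h.set 32 b) = b := by simp
    have pair : ∀ f ≤ 4, ∀ {e : Env → ℕ} {ℓ}, e (h.set 32 b) = ℓ →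
      ePair f e (eVar 32) (h.set 32 b) = pairIdx d Q f ℓ b :=
      fun f hf _ _ he => ePair_eval v2 v3 (hf.trans hb4) hb he v32
    have pair' : ∀ f ≤ 4, ePair' f (eVar 2) (eVar 32) (h.set 32 b) =
      4 * (d + 1) * Q + pairIdx d Q f d b := fun f hf => ePair'_eval v2 v3 hf hb4 hb v2 v32
    exact app (con _ (pair 0 (by omega) v2) (pair' 0 (by omega))) <|
      app (con _ (pair 1 (by omega) v2) (pair 0 (by omega) rfl)) <|
      app (con _ (pair 2 (by omega) v2) (pair 0 (by omega) rfl)) <|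
      app (con _ (pair 1 (by omega) v2) (pair' 1 (by omega)))
        (con _ (pair 2 (by omega) v2) (pair' 2 (by omega)))

theorem gMatrices_eval {d Q t N : ℕ} {h : Env} (c₀ c₁ : ℕ) (h2 : h.var 2 = d)
    (h3 : h.var 3 = Q) (h4 : h.var 4 = t) (h5 : h.var 5 = N) (hQ : Q = 2 ^ d) (hNQ : N = t * Q)
    (hb : Q ≤ h.bound) (hbN : N ≤ h.bound) (hb4 : 4 ≤ h.bound) :
    gMatrices c₀ c₁ h = (List.range (4 * (d + 1) * Q)).flatMap fun i =>
      (List.range t).flatMap fun r => (List.range t).map fun s =>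
        if selector N d (h.arr 0) (fun ℓ y => h.arr 1 (N * ℓ + y)) (i / Q / (d + 1))
          (i / Q % (d + 1)) (i % Q * t + r) = i % Q * t + s + 1 then c₁ else c₀ := by
  have hd : d < h.bound := (hQ ▸ Nat.lt_two_pow_self : d < Q).trans_le hb
  have hQ0 : 0 < Q := by rw [hQ]; positivity
  have ht : t ≤ h.bound := (Nat.le_mul_of_pos_right t hQ0).trans (hNQ ▸ hbN)
  simp only [List.map_eq_flatMap, List.flatMap_range_mul]
  refine gFor_eval rfl hb4 fun f hf => gFor_eval (eAdd_eval (by simpa) rfl) hd fun ℓ hℓ =>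
    gFor_eval (by simpa) hb fun b hb' => gFor_eval (by simpa) ht fun r hr =>
    gFor_eval (by simpa) ht fun s hs => ?_
  have e1 : ((f * (d + 1) + ℓ) * Q + b) / Q = f * (d + 1) + ℓ := pairIdx_div hb'
  have e2 : ((f * (d + 1) + ℓ) * Q + b) % Q = b := pairIdx_mod hb'
  have e3 : (f * (d + 1) + ℓ) / (d + 1) = f := by
    rw [mul_comm, Nat.mul_add_div (by omega), Nat.div_eq_of_lt hℓ, add_zero]
  have e4 : (f * (d + 1) + ℓ) % (d + 1) = ℓ := by
    rw [mul_comm, Nat.mul_add_mod, Nat.mod_eq_of_lt hℓ]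
  have hlt : b * t + r < N := by
    have : (b + 1) * t ≤ Q * t := Nat.mul_le_mul_right t hb'
    rw [hNQ, mul_comm t]
    nlinarith
  rw [e1, e2, e3, e4]
  have mul : ∀ h' : Env, h'.bound = h.bound → h'.var 4 = t → h'.var 32 = b →
      eMul (eVar 4) (eVar 32) h' = b * t := fun h' i1 i2 i3 => by
    rw [mul_comm b]
    exact eMul_eval i2 i3 (by omega)
  refine congrArg (· :: []) (eEq_eval (eSelector_eval (h := ((((h.set 30 f).set 31 ℓ).set 32
    b).set 33 r).set 34 s) (by simpa) (by simpa) hbN hd.le (Nat.lt_of_lt_of_le hℓ hd)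
    (hlt.le.trans hbN) ?_ ?_ (fun i j => eAdd_eval (mul _ rfl ?_ ?_) ?_) ?_ ?_
    (eAdd_eval (mul _ rfl ?_ ?_) ?_))
    (eAdd_eval (eAdd_eval (mul _ rfl ?_ ?_) ?_) rfl) rfl rfl) <;> simp [h4]

end Ram

/-! ### The complete program -/

namespace Ram

def prepare : Env → Env := cSeq setup (cSeq pairTokens routeTokens)

instance : IsCmd prepare := by unfold prepare; infer_instance

theorem output_eq (T : Bool → List ℕ) (c₀ c₁ : ℕ) (h : Env) : output T c₀ c₁ h =
    [ePair 4 (eConst 0) (eConst 0) h, h.var 4,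
      eMul (eMul (eAdd (eVar 2) (eConst 1)) (eConst 5)) (eVar 3) h] ++
      gConstraints T h ++ gMatrices c₀ c₁ h := rfl

/-- The two preparation passes fill the tables of the pairing and of the positions, and `g` is the
selector read off them. The pairing table is correct only below `N`, hence the transport of the
routing to `dartPairing`. -/
theorem output_prepare {h : Env} {k m : ℕ} (hk : h.inp 0 = k) (hm : h.inp 2 = m) (hk6 : 6 ≤ k)
    (hm0 : 0 < m) (hb : 4 * (m + k) ≤ h.bound) (T : Bool → List ℕ) (c₀ c₁ : ℕ) :
    ∃ (d w N : ℕ) (P : ℕ → ℕ → ℕ) (g : ℕ → ℕ → ℕ → ℕ),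
      N = 4 * w * 2 ^ d ∧ 0 < w ∧ (d + 1) * 2 ^ d ≤ k ∧
      k < (d + 2) * 2 ^ (d + 1) ∧ m ≤ 2 ^ d * w ∧ 2 ^ d * (w - 1) < m ∧
      Routing d (4 * w) N (dartPairing (fun x => h.inp (x + 3)) (2 * m)) P ∧
      IsSelector d (4 * w) N (dartPairing (fun x => h.inp (x + 3)) (2 * m)) P g ∧
      output T c₀ c₁ (prepare h) = [4 * (d + 1) * 2 ^ d, 4 * w, 5 * (d + 1) * 2 ^ d] ++
        ((conList d (2 ^ d)).flatMap fun c => c.1 :: c.2.1 :: T c.2.2) ++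
        (List.range (4 * (d + 1) * 2 ^ d)).flatMap fun i =>
          (List.range (4 * w)).flatMap fun r => (List.range (4 * w)).map fun s =>
            if g (i / 2 ^ d / (d + 1)) (i / 2 ^ d % (d + 1)) (i % 2 ^ d * (4 * w) + r) =
              i % 2 ^ d * (4 * w) + s + 1 then c₁ else c₀ := by
  obtain ⟨d, w, e1, hdk, hkd, hmw, hwm⟩ := setup_eval (h := h) (by omega) (by omega) (by omega)
  rw [hk] at e1 hdk hkd
  rw [hm] at e1 hmw hwm
  have hw : 0 < w := Nat.pos_of_ne_zero fun h0 => by simp [h0] at hmw; omega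
  have hwm := hwm hw
  have hQ : 0 < 2 ^ d := by positivity
  have hQk : 2 ^ d ≤ k := (Nat.le_mul_of_pos_left _ (by omega)).trans hdk
  have hdQ : d < 2 ^ d := Nat.lt_two_pow_self
  -- From `2 ^ d * (w - 1) < m` and `2 ^ d ≤ k` one gets `N ≤ 4 * (m + k)`.
  have hN : 4 * w * 2 ^ d ≤ h.bound := by
    obtain ⟨w, rfl⟩ : ∃ w', w = w' + 1 := ⟨w - 1, by omega⟩
    rw [Nat.add_sub_cancel] at hwm
    nlinarith
  have hmN : 4 * m ≤ 4 * w * 2 ^ d := by nlinarith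
  generalize hN0 : 4 * w * 2 ^ d = N at *
  have hN2 : N % 2 = 0 := by rw [← hN0, mul_assoc, Nat.mul_mod]; simp
  obtain ⟨h1, hh1⟩ : ∃ h1, setup h = h1 := ⟨_, rfl⟩
  rw [hh1] at e1
  obtain ⟨a, e2, ha⟩ := pairTokens_eval (h := h1) (m := m) (N := N) (by simp [e1]) (by simp [e1])
    (by simpa [e1]) (by simp [e1]; omega) (by simp [e1]; omega) hmN
  have hpair : IsPairing N (dartPairing (fun x => h.inp (x + 3)) (2 * m)) :=
    isPairing_dartPairing _ hN2 (by omega)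
  have hinp : h1.inp = h.inp := by rw [e1]; rfl
  rw [hinp] at ha
  have hpair' : IsPairing N a := by
    refine ⟨fun y hy => ?_, fun y hy => ?_, fun y hy => ?_⟩
    · rw [ha y hy]; exact hpair.lt y hy
    · rw [ha y hy, ha _ (hpair.lt y hy)]; exact hpair.invol y hy
    · rw [ha y hy]; exact hpair.parity y hy
  obtain ⟨b3, v3, a3, r3⟩ := routeTokens_spec (h := h1.put 0 a) (t := 4 * w) (N := N) (d := d)
    (by simp [e1]) (by simp [e1]) (by simp [e1]) (by simpa [e1]) hN0.symm (by simp [e1]; omega)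
    (by omega) (by omega) (by simpa)
  have e3 : prepare h = routeTokens (h1.put 0 a) := by rw [prepare, cSeq, cSeq, hh1, e2]
  generalize prepare h = h2 at *
  rw [← e3] at b3 v3 a3 r3
  have bb : h2.bound = h.bound := by rw [b3, e1]; rfl
  have v : ∀ i ≤ 5, h2.var i = h1.var i := v3
  have a0 : (h1.put 0 a).arr 0 = a := by simp
  rw [a0] at r3 a3
  have r4 := r3.congr (ι' := dartPairing (fun x => h.inp (x + 3)) (2 * m)) hpair'.lt
    (fun _ _ _ _ => rfl) fun y hy => (ha y hy).symm
  refine ⟨d, w, N, _, _, hN0.symm, hw, hdk, hkd, hmw, hwm, r4, isSelector_selector r4 ha, ?_⟩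
  have v2 : h2.var 2 = d := by rw [v 2 (by omega), e1]; simp
  have v3 : h2.var 3 = 2 ^ d := by rw [v 3 (by omega), e1]; simp
  have v4 : h2.var 4 = 4 * w := by rw [v 4 (by omega), e1]; simp
  have v5 : h2.var 5 = N := by rw [v 5 (by omega), e1]; simp
  have hM := gMatrices_eval (Q := 2 ^ d) c₀ c₁ v2 v3 v4 v5 rfl hN0.symm (by omega) (by omega)
    (by omega)
  rw [a3] at hM
  have hC := gConstraints_eval (Q := 2 ^ d) T v2 v3 rfl (by omega) (by omega)
  have o1 : ePair 4 (eConst 0) (eConst 0) h2 = pairIdx d (2 ^ d) 4 0 0 :=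
    ePair_eval v2 v3 (by omega) (by omega) rfl rfl
  have o2 : eMul (eMul (eAdd (eVar 2) (eConst 1)) (eConst 5)) (eVar 3) h2 =
      5 * (d + 1) * 2 ^ d := by
    refine eMul_eval ?_ v3 (by omega)
    rw [mul_comm]
    exact eMul_eval (eAdd_eval v2 rfl) rfl (by omega)
  rw [output_eq, o1, o2, v4, hM, hC]
  simp [pairIdx]

end Ram


/-! ### The encoding of the instance -/

theorem List.flatMap_finRange {A : Type*} {n : ℕ} (F : ℕ → List A) :
    (List.finRange n).flatMap (fun i : Fin n => F (i : ℕ)) = (List.range n).flatMap F := by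
  rw [← List.map_coe_finRange_eq_range, List.flatMap_map]

theorem List.flatMap_finRange_getElem {A B : Type*} (l : List A) (F : A → List B) :
    (List.finRange l.length).flatMap (fun i => F l[i]) = l.flatMap F := by
  conv_rhs => rw [← List.map_getElem_finRange l, List.flatMap_map]
  rfl

/-- The truth table of a sub-constraint. -/
noncomputable def truthTable (num : F4 ≃ Fin 4) (Λ : Finset F4) (colour : Bool) : List ℕ :=
  (List.finRange 4).flatMap fun a => (List.finRange 4).map fun b =>
    (subTable Λ colour (num.symm a) (num.symm b)).toNat

theorem encode_routingInstance (num : F4 ≃ Fin 4) {d Q t : ℕ} {hQ : Q = 2 ^ d}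
    {g : ℕ → ℕ → ℕ → ℕ} {Λ : Finset F4} : (routingInstance d Q t hQ g Λ).encode num =
    [4 * (d + 1) * Q, t, 5 * (d + 1) * Q] ++
      ((conList d Q).flatMap fun c => c.1 :: c.2.1 :: truthTable num Λ c.2.2) ++
      (List.range (4 * (d + 1) * Q)).flatMap fun i =>
        (List.range t).flatMap fun r => (List.range t).map fun s =>
          if g (i / Q / (d + 1)) (i / Q % (d + 1)) (i % Q * t + r) = i % Q * t + s + 1 then
            (num 1 : ℕ) else num 0 := by
  have hK : 0 < 4 * (d + 1) * Q := by rw [hQ]; positivity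
  rw [SVecCSP.encode]
  congr 1
  · congr 1
    · rw [← length_conList]; rfl
    · refine Eq.trans ?_ (List.flatMap_finRange_getElem _ _)
      refine List.flatMap_congr_mem fun c _ => ?_
      obtain ⟨h1, h2, -⟩ := conList_spec hQ (List.getElem_mem (l := conList d Q) c.2)
      have e1 := elim_codeVar hK h1
      have e2 := elim_codeVar hK h2
      change Sum.elim _ _ (codeVar hK (conList d Q)[c].1) ::
        Sum.elim _ _ (codeVar hK (conList d Q)[c].2.1) :: _ = _
      rw [truthTable]
      exact congrArg₂ List.cons e1 (congrArg₂ List.cons e2 rfl)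
  · refine Eq.trans ?_ (List.flatMap_finRange _)
    refine List.flatMap_congr_mem fun i _ => ?_
    refine Eq.trans ?_ (List.flatMap_finRange _)
    refine List.flatMap_congr_mem fun r _ => ?_
    rw [← List.map_coe_finRange_eq_range, List.map_map]
    refine List.map_congr_left fun s _ => ?_
    change ((num (if _ then 1 else 0) : Fin 4) : ℕ) = _
    rw [apply_ite num, apply_ite Fin.val]
    rfl

theorem List.getElem?_flatMap_pair {A B : Type*} (l : List A) (f g : A → B) (i : ℕ) :
    (l.flatMap fun e => [f e, g e])[2 * i]? = l[i]?.map f ∧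
      (l.flatMap fun e => [f e, g e])[2 * i + 1]? = l[i]?.map g := by
  induction l generalizing i with
  | nil => simp
  | cons e l ih =>
    cases i with
    | zero => simp
    | succ i =>
      rw [show 2 * (i + 1) = 2 * i + 1 + 1 by ring]
      simpa using ih i

theorem encodeInput_getD {n m : ℕ} {A : Type*} (k : ℕ) (Γ : CSP (Fin n) (Fin m) A) (e : Fin m) :
    (encodeInput k Γ).getD (2 * e + 3) 0 = Γ.fst e ∧
      (encodeInput k Γ).getD (2 * e + 1 + 3) 0 = Γ.snd e := by
  obtain ⟨h1, h2⟩ := List.getElem?_flatMap_pair (List.finRange m) (fun e => (Γ.fst e : ℕ))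
    (fun e => (Γ.snd e : ℕ)) e
  simp [encodeInput, List.getD_eq_getElem?_getD, h1, h2]

/-! ### Sizes -/

/-- Double counting of incidences: every constraint meets exactly two variables, as its ends are
distinct. -/
theorem CSP.IsRegular.two_mul_card {n m d : ℕ} {A : Type*} {Γ : CSP (Fin n) (Fin m) A}
    (h : Γ.IsRegular d) : d * n = 2 * m := by
  have h1 : ∀ v, (Finset.univ.filter fun e => Γ.fst e = v ∨ Γ.snd e = v).card = d := fun v => by
    rw [← h v, Nat.card_eq_fintype_card, Fintype.card_subtype]
  have h2 : ∀ e, (Finset.univ.filter fun v => Γ.fst e = v ∨ Γ.snd e = v).card = 2 := fun e => by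
    rw [← Finset.card_pair (Γ.fst_ne_snd e)]
    congr 1
    ext v
    simp [eq_comm]
  have := Finset.sum_card_bipartiteAbove_eq_sum_card_bipartiteBelow
    (s := (Finset.univ : Finset (Fin n))) (t := (Finset.univ : Finset (Fin m)))
    fun v e => Γ.fst e = v ∨ Γ.snd e = v
  simp only [Finset.bipartiteAbove, Finset.bipartiteBelow, h1, h2, Finset.sum_const,
    Finset.card_univ, Fintype.card_fin, smul_eq_mul] at this
  linarith

theorem Polynomial.exists_eval_le (p : Polynomial ℕ) : ∃ D, ∀ n, p.eval n ≤ D * (n + 1) ^ D := by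
  induction p using Polynomial.induction_on' with
  | add p q hp hq =>
    obtain ⟨D, hD⟩ := hp
    obtain ⟨D', hD'⟩ := hq
    refine ⟨D + D', fun n => ?_⟩
    rw [Polynomial.eval_add, add_mul]
    exact Nat.add_le_add ((hD n).trans (Nat.mul_le_mul_left _
      (Nat.pow_le_pow_right (by omega) (by omega)))) ((hD' n).trans (Nat.mul_le_mul_left _
      (Nat.pow_le_pow_right (by omega) (by omega))))
  | monomial j c =>
    refine ⟨c + j, fun n => ?_⟩
    rw [Polynomial.eval_monomial]
    exact Nat.mul_le_mul (by omega) ((Nat.pow_le_pow_left (by omega) _).trans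
      (Nat.pow_le_pow_right (by omega) (by omega)))

/-- By maximality of `d`, `(w - 1) * k ≤ 2 * (d + 2) * (2 ^ d * (w - 1)) ≤ 4 * n * (d + 2)`. Both
`d` and `2` are at most `log k`, so this contributes at most `32 * n * log k` to `4 * w * k`.
Rounding `w` up adds `4 * k ≤ 2 * n * log k`. -/
theorem width_le {d w k n : ℕ} (hk : 6 ≤ k) (hkn : k ≤ n) (hd : (d + 1) * 2 ^ d ≤ k)
    (hkd : k < (d + 2) * 2 ^ (d + 1)) (hw : 0 < w) (hwn : 2 ^ d * (w - 1) < 2 * n) :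
    ((4 * w : ℕ) : ℝ) ≤ 36 * ((n : ℝ) * Real.logb 2 k / k) := by
  have hk0 : (0 : ℝ) < k := by exact_mod_cast (by omega : 0 < k)
  have hdk : 2 ^ d ≤ k := (Nat.le_mul_of_pos_left _ (by omega)).trans hd
  have hL : (d : ℝ) ≤ Real.logb 2 k := by
    rw [Real.le_logb_iff_rpow_le one_lt_two hk0, Real.rpow_natCast]
    exact_mod_cast hdk
  have hL2 : (2 : ℝ) ≤ Real.logb 2 k := by
    rw [Real.le_logb_iff_rpow_le one_lt_two hk0]
    norm_num
    exact_mod_cast (by omega : 4 ≤ k)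
  obtain ⟨u, rfl⟩ : ∃ u, w = u + 1 := ⟨w - 1, by omega⟩
  rw [Nat.add_sub_cancel] at hwn
  have key : u * k ≤ 4 * n * (d + 2) := by
    have : u * k ≤ u * ((d + 2) * 2 ^ (d + 1)) := Nat.mul_le_mul_left _ hkd.le
    have h2 : u * ((d + 2) * 2 ^ (d + 1)) = 2 * (d + 2) * (2 ^ d * u) := by ring
    nlinarith
  have key' : (u : ℝ) * k ≤ 4 * n * (d + 2) := by exact_mod_cast key
  have hkn' : (k : ℝ) ≤ n := by exact_mod_cast hkn
  rw [mul_div_assoc', le_div_iff₀ hk0]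
  push_cast
  nlinarith

/-! ### The algorithm -/

namespace Ram

/-- Register `1` becomes `16` times the second entry of the input. -/
def prelude : Program :=
  .seq (.seq (.seq (.seq (.seq (.seq (.const 1 1) (.load 1 0 1)) (.add 1 1 1)) (.add 1 1 1))
    (.add 1 1 1)) (.add 1 1 1)) (.const 0 0)

theorem exec_prelude (l : List ℕ) : ∃ s, Exec prelude (inputStore l) 7 s ∧
    Env.Rel ⟨16 * l.getD 1 0, fun i => l.getD i 0, fun _ => 0, fun _ _ => 0⟩ s := by
  refine ⟨_, ((((((Exec.const ..).seq (.load ..)).seq (.add ..)).seq (.add ..)).seq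
    (.add ..)).seq (.add ..)).seq (.const ..), ?_, fun i => ?_, ?_, fun a => ?_⟩
  · simp [Store.setReg, inputStore]; omega
  · simp (disch := omega) [Store.setReg, inputStore, Function.update_of_ne]
  · simp [Store.setReg, inputStore]
  · simp [Store.setReg, inputStore]

theorem exists_program (T : Bool → List ℕ) (c₀ c₁ : ℕ) : ∃ (P : Program) (D : ℕ), ∀ l : List ℕ,
    ∃ T', P.Computes l (output T c₀ c₁ (prepare
      ⟨16 * l.getD 1 0, fun i => l.getD i 0, fun _ => 0, fun _ _ => 0⟩)) T' ∧
      T' ≤ D * (l.getD 1 0 + 1) ^ D := by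
  obtain ⟨P, p, hP⟩ := IsCmd.exec (f := prepare) 1 le_rfl
  obtain ⟨R, r, hR⟩ := IsGen.exec (g := output T c₀ c₁) 1 le_rfl
  obtain ⟨D, hD⟩ := Polynomial.exists_eval_le ((p + r + 8).comp (16 * Polynomial.X))
  refine ⟨.seq (.seq (.seq prelude P) (.const 0 0)) R, D, fun l => ?_⟩
  obtain ⟨s1, x1, r1⟩ := exec_prelude l
  obtain ⟨T2, s2, x2, t2, r2, -⟩ := hP _ _ r1
  -- Commands promise nothing about register `0`, so it is reset to make the output empty before the
  -- generator starts.
  have r3 : Env.Rel _ (s2.setReg 0 0) := ⟨r2.bound, fun i => by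
    rw [← r2.var i]; exact Function.update_of_ne (show 2 * (i + 1) ≠ 0 by omega) 0 s2.reg, r2.inp, r2.arr⟩
  obtain ⟨T4, s4, x4, t4, -, o4, -⟩ := hR _ _ [] r3 ⟨by simp [Store.setReg], by simp⟩
  refine ⟨_, ⟨s4, ((x1.seq x2).seq (.const ..)).seq x4, o4⟩, (le_trans ?_ (hD _))⟩
  rw [IsCmd.bound] at t4
  simp only [Polynomial.eval_comp, Polynomial.eval_add, Polynomial.eval_mul, Polynomial.eval_X,
    Polynomial.eval_ofNat]
  dsimp only at t2 t4
  omega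

end Ram

theorem exists_reduction (num : F4 ≃ Fin 4) (Λ : Finset F4) (hΛ : Λ.card = 3) :
    ∃ (P : Program) (D : ℕ), ∀ (k n m : ℕ) (Γ : CSP (Fin n) (Fin m) F4), 6 ≤ k → k ≤ n →
      IsFourRegularThreeColoring Λ Γ → ∃ (G : SVecCSP F4) (T : ℕ),
        P.Computes (encodeInput k Γ) (G.encode num) T ∧ T ≤ D * (n + 1) ^ D ∧
        Fintype.card G.Var ≤ 8 * k ∧ Fintype.card G.Con ≤ 9 * k ∧
        (G.t : ℝ) ≤ 36 * ((n : ℝ) * Real.logb 2 (k : ℝ) / (k : ℝ)) ∧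
        (G.toCSP.Satisfiable ↔ Γ.Satisfiable) := by
  obtain ⟨P, D, hP⟩ := Ram.exists_program (truthTable num Λ) (num 0) (num 1)
  refine ⟨P, D, fun k n m Γ hk hkn hΓ => ?_⟩
  have hm : 4 * n = 2 * m := hΓ.1.two_mul_card
  obtain ⟨T, hT, hTD⟩ := hP (encodeInput k Γ)
  have hn : (encodeInput k Γ).getD 1 0 = n := rfl
  obtain ⟨d, w, N, p, g, hN, hw, hdk, hkd, hmw, hwm, hp, hg, e⟩ := Ram.output_prepare
    (h := ⟨16 * (encodeInput k Γ).getD 1 0, fun i => (encodeInput k Γ).getD i 0, fun _ => 0,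
      fun _ _ => 0⟩) (k := k) (m := m) rfl rfl hk (by omega)
    -- Regularity gives `m = 2 * n`, so `4 * (m + k) ≤ 12 * n`.
    (by change _ ≤ 16 * (encodeInput k Γ).getD 1 0; rw [hn]; omega)
    (truthTable num Λ) (num 0) (num 1)
  rw [hn] at hTD
  rw [e, ← encode_routingInstance (hQ := rfl)] at hT
  refine ⟨_, T, hT, hTD, ?_, ?_, ?_, ?_⟩
  · have : Fintype.card (routingInstance d (2 ^ d) (4 * w) rfl g Λ).Var =
        4 * (d + 1) * 2 ^ d + 4 * (d + 1) * 2 ^ d := by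
      rw [Fintype.card_sum, Fintype.card_fin]; rfl
    rw [this]
    linarith
  · have : Fintype.card (routingInstance d (2 ^ d) (4 * w) rfl g Λ).Con =
        5 * (d + 1) * 2 ^ d + 4 * (d + 1) * 2 ^ d := by
      rw [Fintype.card_sum, Fintype.card_fin, Fintype.card_fin, ← length_conList]; rfl
    rw [this]
    linarith
  · exact width_le hk hkn hdk hkd hw (by omega)
  · have hmN : 4 * m ≤ N := by
      rw [hN, mul_assoc, mul_comm w]; omega
    have hι := isPairing_dartPairing (fun x => (encodeInput k Γ).getD (x + 3) 0) (M := 2 * m)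
      (N := N) (by rw [hN, mul_assoc, Nat.mul_mod]; simp) (by omega)
    rw [routingInstance_satisfiable_iff_tokenColouring rfl hg hι (fun y hy => ?_) hp (by omega)
      (Dvd.intro _ rfl) hN]
    · exact exists_tokenColouring_iff (by omega) hΓ.2 (by omega) hmN
        (fun e => (encodeInput_getD k Γ e).1) fun e => (encodeInput_getD k Γ e).2
    -- A pairing that maps the tokens below `N` to themselves, being an involution, also maps the
    -- others to themselves.
    · by_contra hlt
      have := hι.lt _ (not_le.mp hlt)
      rw [dartPairing_invol] at this
      omega

/-! ### The main theorem -/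

theorem mainTheorem10 :
    ∃ C : ℕ, ∀ (num : F4 ≃ Fin 4) (Λ : Finset F4), Λ.card = 3 →
      ∃ P : Program, ∀ (k n m : ℕ) (Γ : CSP (Fin n) (Fin m) F4), 6 ≤ k → k ≤ n →
        IsFourRegularThreeColoring Λ Γ →
        ∃ (G : SVecCSP F4) (T : ℕ),
          P.Computes (encodeInput k Γ) (G.encode num) T ∧
          (T : ℝ) ≤
            ((n : ℝ) ^ 2 + ((2 : ℝ) ^ ((n : ℝ) * Real.logb 2 (k : ℝ) / (k : ℝ))) ^ 2 + (C : ℝ)) ^ C ∧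
          Fintype.card G.Var ≤ C * k ∧
          Fintype.card G.Con ≤ C * k ∧
          (G.t : ℝ) ≤ (C : ℝ) * ((n : ℝ) * Real.logb 2 (k : ℝ) / (k : ℝ)) ∧
          (G.toCSP.Satisfiable ↔ Γ.Satisfiable) := by
  have H := fun num : F4 ≃ Fin 4 => fun Λ : {Λ : Finset F4 // Λ.card = 3} =>
    exists_reduction num Λ.1 Λ.2
  choose P D h using H
  have : Finite (F4 ≃ Fin 4) := Finite.of_injective _ (DFunLike.coe_injective (F := F4 ≃ Fin 4))
  -- There are finitely many numberings of the field and colour sets, so one constant serves for all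
  -- of them.
  obtain ⟨B, hB⟩ := (Set.finite_range fun q : (F4 ≃ Fin 4) × {Λ : Finset F4 // Λ.card = 3} =>
    D q.1 q.2).bddAbove
  have hB : ∀ num Λ, D num Λ ≤ B := fun num Λ => hB ⟨(num, Λ), rfl⟩
  -- The summand `36` covers the factors `8`, `9` and `36` of the sizes, and gives an exponent of at
  -- least `D + 1`.
  refine ⟨B + 36, fun num Λ hΛ => ⟨P num ⟨Λ, hΛ⟩, fun k n m Γ hk hkn hΓ => ?_⟩⟩
  obtain ⟨G, T, h1, h2, h3, h4, h5, h6⟩ := h num ⟨Λ, hΛ⟩ k n m Γ hk hkn hΓ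
  have hD := hB num ⟨Λ, hΛ⟩
  refine ⟨G, T, h1, ?_, h3.trans (Nat.mul_le_mul_right k (by omega)),
    h4.trans (Nat.mul_le_mul_right k (by omega)), h5.trans ?_, h6⟩
  · set x : ℝ := (n : ℝ) ^ 2 + ((2 : ℝ) ^ ((n : ℝ) * Real.logb 2 (k : ℝ) / (k : ℝ))) ^ 2 +
      ((B + 36 : ℕ) : ℝ) with hx
    have hpos : (0 : ℝ) ≤ ((2 : ℝ) ^ ((n : ℝ) * Real.logb 2 (k : ℝ) / (k : ℝ))) ^ 2 := by positivity
    have hDx : (D num ⟨Λ, hΛ⟩ : ℝ) ≤ x := by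
      have : (D num ⟨Λ, hΛ⟩ : ℝ) ≤ B := by exact_mod_cast hD
      push_cast at hx
      nlinarith [sq_nonneg (n : ℝ)]
    have hnx : (n : ℝ) + 1 ≤ x := by
      push_cast at hx
      nlinarith [sq_nonneg ((n : ℝ) - 1), Nat.cast_nonneg (α := ℝ) B]
    have hx1 : 1 ≤ x := by linarith [Nat.cast_nonneg (α := ℝ) n]
    calc (T : ℝ) ≤ D num ⟨Λ, hΛ⟩ * ((n : ℝ) + 1) ^ D num ⟨Λ, hΛ⟩ := by exact_mod_cast h2
      _ ≤ x * x ^ D num ⟨Λ, hΛ⟩ := by gcongr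
      _ = x ^ (D num ⟨Λ, hΛ⟩ + 1) := (pow_succ' ..).symm
      _ ≤ x ^ (B + 36) := pow_le_pow_right₀ hx1 (by omega)
  · have hL : 0 ≤ Real.logb 2 k := Real.logb_nonneg one_lt_two (by exact_mod_cast (by omega : 1 ≤ k))
    gcongr
    push_cast
    linarith [Nat.cast_nonneg (α := ℝ) B]
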